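/- Let $G$ be an abelian group, $R=\bigoplus_{\mu\in G}R_\mu$ a commutative $G$-graded ring with unit, and $B\subset R$ an ideal generated by finitely many homogeneous elements $b_1,\dots,b_s$. Write $H^i_B(-)$ for local cohomology, computed by the Čech complex on $b_1,\dots,b_s$ (which is $G$-graded for graded modules), $\mathrm{cd}_B(M)=\max\{i : H^i_B(M)\neq 0\}$ (and $-\infty$ if there is no such $i$), and $\mathrm{Supp}_G(M)=\{\mu\in G : M_\mu\ne 0\}$ for a graded module $M$. The grade of an ideal is the supremum of the lengths of the regular sequences on the ring contained in it, with $\mathrm{grade}=\infty$ for the unit ideal. Let $m\ge 1$, $\gamma\in G$, let $f_0,\dots,f_m\in R_\gamma$, and put $I=(f_0,\dots,f_m)$. Let $Z_l$ be the module of $l$-cycles of the Koszul complex $K_\bullet=K_\bullet(f_0,\dots,f_m;R)$, $K_l=\bigwedge^l R(-\gamma)^{m+1}$, and let $\mathcal Z_\bullet$ be the approximation complex of cycles: $\mathcal Z_l=Z_l(l\gamma)\otimes_R R[T_0,\dots,T_m]$ with $\deg_G T_i=0$, and with the differential induced by the Koszul differential of $T_0,\dots,T_m$; here $M(\nu)_\mu=M_{\nu+\mu}$.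 Grade $\mathrm{Sym}_R(I)$ by $G$ so that the presentation $R[T_0,\dots,T_m]\to \mathrm{Sym}_R(I)$, $T_i\mapsto f_i$, has degree $0$. Put $$\mathfrak S_B(\gamma)=\bigcup_{k\ge 0}\bigl(\mathrm{Supp}_G(H^k_B(R))+k\gamma\bigr),\qquad \mathfrak R_B(\gamma)=\bigcup_{0<k<\min\{m,\mathrm{cd}_B(R)\}}\bigl(\mathfrak S_B(\gamma)-k\gamma\bigr).$$ Assume that $\mathrm{grade}(B)\ge 2$ and $\mathrm{cd}_B(R/I)\le 1$. (1) For every $\mu\in G\setminus\mathfrak R_B(\gamma)$ one has $H^i_B(H_j(\mathcal Z_\bullet))_\mu=0$ for all $i,j\ge 0$ if $m\ge 2$; if $m=1$, this holds for all $i,j\geq 0$ with $i=0$ or $j\ge 1$. (2) If moreover $I$ is locally an almost complete intersection off $V(B)$, that is, for every prime $\mathfrak p\not\supseteq B$ the ideal $I_{\mathfrak p}$ of $R_{\mathfrak p}$ can be generated by at most $\mathrm{grade}(I_{\mathfrak p})+1$ elements, then for every $\mu\in G\setminus\mathfrak R_B(\gamma)$ the complex $(\mathcal Z_\bullet)_\mu$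 is acyclic (its homology vanishes in all positive degrees) and $H^0_B(\mathrm{Sym}_R(I))_\mu=0$. -/

import Mathlib

namespace GradedCech

/-- The Koszul sign `(-1) ^ #{j ∈ σ | j < i}`. -/
def sgn (A : Type*) [CommRing A] {n : ℕ} (σ : Finset (Fin n)) (i : Fin n) : A :=
  (-1) ^ (σ.filter (· < i)).card

theorem sgn_erase_swap (A : Type*) [CommRing A] {n : ℕ} (τ : Finset (Fin n)) {i j : Fin n}
    (hi : i ∈ τ) (hj : j ∈ τ) (hij : i ≠ j) :
    sgn A τ i * sgn A (τ.erase i) j = -(sgn A τ j * sgn A (τ.erase j) i) := by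
  wlog h : i < j generalizing i j
  · rw [this hj hi hij.symm (lt_of_le_of_ne (not_lt.mp h) hij.symm), neg_neg]
  have h1 : (τ.erase j).filter (· < i) = τ.filter (· < i) := by
    ext x
    simp only [Finset.mem_filter, Finset.mem_erase]
    constructor
    · rintro ⟨⟨_, h2⟩, h3⟩
      exact ⟨h2, h3⟩
    · rintro ⟨h2, h3⟩
      exact ⟨⟨ne_of_lt (h3.trans h), h2⟩, h3⟩
  have h2 : (τ.filter (· < j)).card = ((τ.erase i).filter (· < j)).card + 1 := by
    rw [Finset.filter_erase, Finset.card_erase_add_one]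
    simp [hi, h]
  unfold sgn
  rw [h1, h2]
  ring

/-! ### The Čech complex and local cohomology -/

section Cech

variable {R : Type*} [CommRing R] {s : ℕ} (b : Fin s → R) (M : Type*) [AddCommGroup M] [Module R M]

/-- The multiplicative set generated by the `b i`, `i ∈ σ`; the localization at it is `M_{b_σ}`
with `b_σ = ∏ i ∈ σ, b i`. -/
def mon (σ : Finset (Fin s)) : Submonoid R := Submonoid.closure (b '' (σ : Set (Fin s)))

theorem mon_mono {σ τ : Finset (Fin s)} (h : σ ⊆ τ) : mon b σ ≤ mon b τ :=
  Submonoid.closure_mono (Set.image_mono (by exact_mod_cast h))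

/-- All Čech cochains: the product of the `M_{b_σ}` over all subsets `σ`. -/
abbrev Cochain : Type _ := (σ : Finset (Fin s)) → LocalizedModule (mon b σ) M

/-- The localization map `M_{b_σ} → M_{b_τ}` for `σ ⊆ τ`. -/
noncomputable def res {σ τ : Finset (Fin s)} (h : σ ⊆ τ) :
    LocalizedModule (mon b σ) M →ₗ[R] LocalizedModule (mon b τ) M :=
  IsLocalizedModule.liftOfLE (mon b σ) (mon b τ) (mon_mono b h)
    (LocalizedModule.mkLinearMap (mon b σ) M) (LocalizedModule.mkLinearMap (mon b τ) M)

/-- The Čech differential, `(d x)_τ = ∑_{i ∈ τ} ± x_{τ \ i}|_τ`. -/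
noncomputable def cechD : Cochain b M →ₗ[R] Cochain b M :=
  LinearMap.pi fun τ => ∑ i : τ, sgn R τ i.1 •
    (res b M (Finset.erase_subset i.1 τ) ∘ₗ LinearMap.proj (τ.erase i.1))

theorem res_res {ρ σ τ : Finset (Fin s)} (h : ρ ⊆ σ) (h' : σ ⊆ τ)
    (x : LocalizedModule (mon b ρ) M) :
    res b M h' (res b M h x) = res b M (h.trans h') x := by
  obtain ⟨⟨m, t⟩, rfl⟩ := IsLocalizedModule.mk'_surjective (mon b ρ)
    (LocalizedModule.mkLinearMap (mon b ρ) M) x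
  simp [res, IsLocalizedModule.liftOfLE_mk']

theorem res_congr (x : Cochain b M) {ρ ρ' τ : Finset (Fin s)} (e : ρ = ρ') (h : ρ ⊆ τ)
    (h' : ρ' ⊆ τ) : res b M h (x ρ) = res b M h' (x ρ') := by
  subst e
  rfl

theorem cechD_apply (x : Cochain b M) (τ : Finset (Fin s)) :
    cechD b M x τ = ∑ i : τ, sgn R τ i.1 •
      res b M (Finset.erase_subset i.1 τ) (x (τ.erase i.1)) := by
  simp [cechD]

theorem cechD_cechD (x : Cochain b M) : cechD b M (cechD b M x) = 0 := by
  funext τ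
  rw [cechD_apply]
  simp only [cechD_apply, map_sum, map_smul, res_res, Finset.smul_sum, smul_smul]
  rw [Finset.sum_sigma']
  refine Finset.sum_involution
    (fun p _ => ⟨⟨p.2.1, Finset.mem_of_mem_erase p.2.2⟩, ⟨p.1.1, ?_⟩⟩) ?_ ?_ ?_ ?_
  · exact Finset.mem_erase.2 ⟨(Finset.ne_of_mem_erase p.2.2).symm, p.1.2⟩
  · rintro ⟨⟨i, hi⟩, ⟨j, hj⟩⟩ -
    have hj' := Finset.mem_of_mem_erase hj
    have hij : i ≠ j := (Finset.ne_of_mem_erase hj).symm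
    dsimp only
    rw [sgn_erase_swap R τ hi hj' hij,
      res_congr b M x (Finset.erase_right_comm (s := τ) (a := i) (b := j)) _
        ((Finset.erase_subset _ _).trans (Finset.erase_subset _ _)), neg_smul, neg_add_cancel]
  · rintro ⟨⟨i, hi⟩, ⟨j, hj⟩⟩ - - h
    have hij : i ≠ j := (Finset.ne_of_mem_erase hj).symm
    simp only [Sigma.mk.injEq, Subtype.mk.injEq] at h
    exact hij h.1.symm
  · intros
    exact Finset.mem_univ _
  · rintro ⟨⟨i, hi⟩, ⟨j, hj⟩⟩ -
    rfl

/-- The Čech cochains of cohomological degree `p`: those living on the `p`-element subsets. -/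
def cochains (p : ℕ) : Submodule R (Cochain b M) where
  carrier := {x | ∀ σ, σ.card ≠ p → x σ = 0}
  add_mem' hx hy σ h := by simp [hx σ h, hy σ h]
  zero_mem' _ _ := rfl
  smul_mem' r x hx σ h := by simp [hx σ h]

noncomputable def cocycles (p : ℕ) : Submodule R (Cochain b M) := cochains b M p ⊓ LinearMap.ker (cechD b M)

noncomputable def coboundaries : ℕ → Submodule R (Cochain b M)
  | 0 => ⊥
  | p + 1 => (cochains b M p).map (cechD b M)

theorem cechD_mem_cochains {p : ℕ} {x : Cochain b M} (hx : x ∈ cochains b M p) :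
    cechD b M x ∈ cochains b M (p + 1) := by
  intro τ hτ
  rw [cechD_apply]
  refine Finset.sum_eq_zero fun i _ => ?_
  rw [hx (τ.erase i.1), map_zero, smul_zero]
  have := Finset.card_erase_add_one i.2
  omega

theorem coboundaries_le_cocycles (p : ℕ) : coboundaries b M p ≤ cocycles b M p := by
  cases p with
  | zero => exact bot_le
  | succ p =>
    rintro _ ⟨x, hx, rfl⟩
    exact ⟨cechD_mem_cochains b M hx, cechD_cechD b M x⟩

/-- The local cohomology module `H^p_B(M)`, `B = (b_1, …, b_s)`, computed by the Čech complex. -/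
abbrev LocCoh (p : ℕ) : Type _ :=
  cocycles b M p ⧸ (coboundaries b M p).submoduleOf (cocycles b M p)

/-- The cohomological dimension `cd_B(M) = max {i | H^i_B(M) ≠ 0}` (`-∞` if there is no such `i`). -/
noncomputable def cd : WithBot ℕ∞ :=
  ⨆ (i : ℕ) (_ : Nontrivial (LocCoh b M i)), ((i : ℕ∞) : WithBot ℕ∞)

variable {M} {G : Type*} [AddCommGroup G] (𝒜 : G → AddSubgroup R) (ℳ : G → AddSubgroup M)

/-- The degree `μ` part of the localization of a graded module: (sums of) fractions `x / t` with
`t ∈ S` homogeneous of some degree `e` and `x` homogeneous of degree `μ + e`. -/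
def locPiece (S : Submonoid R) (μ : G) : AddSubgroup (LocalizedModule S M) :=
  AddSubgroup.closure {y | ∃ (e : G) (t : S) (x : M),
    (t : R) ∈ 𝒜 e ∧ x ∈ ℳ (μ + e) ∧ y = LocalizedModule.mk x t}

/-- The Čech cochains all of whose components have degree `μ`. -/
def cochainPiece (μ : G) : AddSubgroup (Cochain b M) where
  carrier := {x | ∀ σ, x σ ∈ locPiece 𝒜 ℳ (mon b σ) μ}
  add_mem' hx hy σ := add_mem (hx σ) (hy σ)
  zero_mem' _ := zero_mem _
  neg_mem' hx σ := neg_mem (hx σ)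

/-- The degree `μ` part `H^p_B(M)_μ` of the local cohomology of a graded module: the classes of
the cocycles of degree `μ`. -/
noncomputable def locCohPiece (p : ℕ) (μ : G) : AddSubgroup (LocCoh b M p) :=
  ((cochainPiece b 𝒜 ℳ μ).comap (cocycles b M p).subtype.toAddMonoidHom).map
    ((coboundaries b M p).submoduleOf (cocycles b M p)).mkQ.toAddMonoidHom

/-- `Supp_G (H^p_B(M))`. -/
def locCohSupp (p : ℕ) : Set G := {ν | locCohPiece b 𝒜 ℳ p ν ≠ ⊥}

/-- `𝔖_B(γ) = ⋃_{k ≥ 0} (Supp_G (H^k_B(R)) + k γ)`. -/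
def sigma (γ : G) : Set G :=
  ⋃ k : ℕ, (fun ν => ν + k • γ) '' locCohSupp b 𝒜 𝒜 k

/-- `ℜ_B(γ) = ⋃_{0 < k < min {m, cd_B(R)}} (𝔖_B(γ) - k γ)`. -/
def region (m : ℕ) (γ : G) : Set G :=
  ⋃ (k : ℕ) (_ : 0 < k ∧ ((k : ℕ∞) : WithBot ℕ∞) < min ((m : ℕ∞) : WithBot ℕ∞) (cd b R)),
    (fun ν => ν - k • γ) '' sigma b 𝒜 γ

end Cech

/-! ### Grade and almost complete intersections -/

/-- The grade of an ideal `J` on `R`: the supremum of the lengths of the (weakly) `R`-regular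
sequences of elements of `J`.  For `J ≠ R` weakly regular and regular sequences in `J` are
the same, and the unit ideal has grade `∞`. -/
noncomputable def grade {R : Type*} [CommRing R] (J : Ideal R) : ℕ∞ :=
  ⨆ (rs : List R) (_ : (∀ r ∈ rs, r ∈ J) ∧ RingTheory.Sequence.IsWeaklyRegular R rs),
    (rs.length : ℕ∞)

/-- `I` is locally an almost complete intersection off `V(B)`: for each prime `p` not containing
`B`, the ideal `I_p` can be generated by at most `grade(I_p) + 1` elements. -/
def IsAlmostLCIOff {R : Type*} [CommRing R] (B I : Ideal R) : Prop :=
  ∀ (p : Ideal R) [p.IsPrime], ¬ B ≤ p →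
    ((I.map (algebraMap R (Localization.AtPrime p))).spanFinrank : ℕ∞) ≤
      grade (I.map (algebraMap R (Localization.AtPrime p))) + 1

/-! ### The Koszul complex and the approximation complex of cycles -/

section Koszul

variable {A : Type*} [CommRing A] {n : ℕ}

/-- The Koszul differential of `a_1, …, a_n` on `⋀ A^n`, in the basis `e_σ`:
`e_σ ↦ ∑_{i ∈ σ} ± a_i e_{σ \ i}`. -/
def koszulD (a : Fin n → A) : (Finset (Fin n) → A) →ₗ[A] (Finset (Fin n) → A) where
  toFun x σ := ∑ i ∈ σᶜ, sgn A σ i * a i * x (insert i σ)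
  map_add' x y := by
    funext σ
    simp [mul_add, Finset.sum_add_distrib]
  map_smul' r x := by
    funext σ
    simp only [Pi.smul_apply, smul_eq_mul, RingHom.id_apply, Finset.mul_sum]
    exact Finset.sum_congr rfl fun i _ => by ring

/-- `⋀^l A^n`, spanned by the `e_σ` with `#σ = l`. -/
def koszulChains (A : Type*) [CommRing A] (n l : ℕ) : Submodule A (Finset (Fin n) → A) where
  carrier := {x | ∀ σ, σ.card ≠ l → x σ = 0}
  add_mem' hx hy σ h := by simp [hx σ h, hy σ h]
  zero_mem' _ _ := rfl
  smul_mem' r x hx σ h := by simp [hx σ h]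

/-- The module of Koszul `l`-cycles of `a`. -/
def koszulCycles (a : Fin n → A) (l : ℕ) : Submodule A (Finset (Fin n) → A) :=
  koszulChains A n l ⊓ LinearMap.ker (koszulD a)

theorem koszulD_mem_chains (a : Fin n → A) {l : ℕ} {x : Finset (Fin n) → A}
    (hx : x ∈ koszulChains A n (l + 1)) : koszulD a x ∈ koszulChains A n l := by
  intro σ hσ
  refine Finset.sum_eq_zero fun i hi => ?_
  rw [hx (insert i σ), mul_zero]
  rw [Finset.card_insert_of_notMem (Finset.mem_compl.1 hi)]
  omega

theorem sgn_insert_swap (σ : Finset (Fin n)) {i j : Fin n} (hi : i ∉ σ) (hj : j ∉ σ)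
    (hij : i ≠ j) :
    sgn A σ i * sgn A (insert i σ) j = -(sgn A σ j * sgn A (insert j σ) i) := by
  have h1 := sgn_erase_swap A (insert i (insert j σ)) (i := i) (j := j) (by simp) (by simp) hij
  rw [Finset.erase_insert (by simpa [hi] using hij),
    Finset.insert_comm, Finset.erase_insert (by simpa [hj] using hij.symm)] at h1
  have key : ∀ u v : Fin n, sgn A (insert v (insert u σ)) u = sgn A (insert v σ) u := by
    intro u v
    unfold sgn
    rw [Finset.insert_comm, Finset.filter_insert, if_neg (lt_irrefl u)]
  have key2 : ∀ u : Fin n, sgn A (insert u σ) u = sgn A σ u := by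
    intro u
    unfold sgn
    rw [Finset.filter_insert, if_neg (lt_irrefl u)]
  rw [key i j, Finset.insert_comm j i, key j i, key2 i, key2 j] at h1
  linear_combination h1

theorem koszulD_anticomm (a c : Fin n → A) (x : Finset (Fin n) → A) :
    koszulD a (koszulD c x) = -koszulD c (koszulD a x) := by
  funext σ
  simp only [koszulD, LinearMap.coe_mk, AddHom.coe_mk, Pi.neg_apply, Finset.mul_sum]
  rw [Finset.sum_sigma', Finset.sum_sigma', ← Finset.sum_neg_distrib]
  have hmem : ∀ i j : Fin n, i ∈ σᶜ ∧ j ∈ (insert i σ)ᶜ → j ∈ σᶜ ∧ i ∈ (insert j σ)ᶜ := by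
    intro i j h
    simp only [Finset.mem_compl, Finset.mem_insert, not_or] at h ⊢
    exact ⟨h.2.2, fun e => h.2.1 e.symm, h.1⟩
  refine Finset.sum_bij' (fun p _ => ⟨p.2, p.1⟩) (fun p _ => ⟨p.2, p.1⟩) ?_ ?_ ?_ ?_ ?_
  · rintro ⟨i, j⟩ h
    exact Finset.mem_sigma.2 (hmem i j (Finset.mem_sigma.1 h))
  · rintro ⟨i, j⟩ h
    exact Finset.mem_sigma.2 (hmem i j (Finset.mem_sigma.1 h))
  · intros; rfl
  · intros; rfl
  · rintro ⟨i, j⟩ h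
    simp only [Finset.mem_sigma, Finset.mem_compl, Finset.mem_insert, not_or] at h
    obtain ⟨hi, hji, hj⟩ := h
    have h1 := sgn_insert_swap (A := A) σ hi hj (fun e => hji e.symm)
    rw [Finset.insert_comm j i]
    linear_combination (a i * c j * x (insert i (insert j σ))) * h1

theorem koszulD_koszulD (a : Fin n → A) (x : Finset (Fin n) → A) :
    koszulD a (koszulD a x) = 0 := by
  funext σ
  simp only [koszulD, LinearMap.coe_mk, AddHom.coe_mk, Pi.zero_apply, Finset.mul_sum]
  rw [Finset.sum_sigma']
  refine Finset.sum_involution (fun p _ => ⟨p.2, p.1⟩) ?_ ?_ ?_ ?_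
  · rintro ⟨i, j⟩ h
    simp only [Finset.mem_sigma, Finset.mem_compl, Finset.mem_insert, not_or] at h
    obtain ⟨hi, hji, hj⟩ := h
    have h1 := sgn_insert_swap (A := A) σ hi hj (fun e => hji e.symm)
    dsimp only
    rw [Finset.insert_comm j i]
    linear_combination (a i * a j * x (insert i (insert j σ))) * h1
  · rintro ⟨i, j⟩ h - e
    simp only [Finset.mem_sigma, Finset.mem_compl, Finset.mem_insert, not_or] at h
    simp only [Sigma.mk.injEq] at e
    exact h.2.1 e.1
  · rintro ⟨i, j⟩ h
    simp only [Finset.mem_sigma, Finset.mem_compl, Finset.mem_insert, not_or] at h ⊢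
    exact ⟨h.2.2, fun e => h.2.1 e.symm, h.1⟩
  · intros; rfl

theorem koszulD_mem_cycles (a c : Fin n → A) {l : ℕ} {x : Finset (Fin n) → A}
    (hx : x ∈ koszulCycles a (l + 1)) : koszulD c x ∈ koszulCycles a l := by
  refine ⟨koszulD_mem_chains c hx.1, ?_⟩
  have h : koszulD a x = 0 := hx.2
  show koszulD a (koszulD c x) = 0
  rw [koszulD_anticomm, h, map_zero, neg_zero]

end Koszul

section Approx

variable {R : Type*} [CommRing R] {n : ℕ} (f : Fin n → R)

/-- `𝒵_l = Z_l[l γ] ⊗_R R[T]`, where `Z_l` is the module of Koszul `l`-cycles of `f` over `R`.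
As `R[T]` is flat over `R`, this is the module of Koszul `l`-cycles of `f` over `R[T]`. -/
noncomputable def zMod (l : ℕ) :
    Submodule (MvPolynomial (Fin n) R) (Finset (Fin n) → MvPolynomial (Fin n) R) :=
  koszulCycles (fun i => MvPolynomial.C (f i)) l

/-- The differential of the approximation complexes: the Koszul differential of `T_1, …, T_n`. -/
noncomputable def zD (R : Type*) [CommRing R] (n : ℕ) :
    (Finset (Fin n) → MvPolynomial (Fin n) R) →ₗ[MvPolynomial (Fin n) R]
      (Finset (Fin n) → MvPolynomial (Fin n) R) :=
  koszulD fun i => MvPolynomial.X i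

theorem zD_mem {l : ℕ} {x : Finset (Fin n) → MvPolynomial (Fin n) R} (hx : x ∈ zMod f (l + 1)) :
    zD R n x ∈ zMod f l :=
  koszulD_mem_cycles _ _ hx

theorem zD_zD (x : Finset (Fin n) → MvPolynomial (Fin n) R) : zD R n (zD R n x) = 0 :=
  koszulD_koszulD _ _

/-- The cycles of the complex `𝒵_•` in homological degree `l` (all of `𝒵_0` for `l = 0`). -/
noncomputable def zCycles (l : ℕ) :
    Submodule (MvPolynomial (Fin n) R) (Finset (Fin n) → MvPolynomial (Fin n) R) :=
  zMod f l ⊓ LinearMap.ker (zD R n)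

/-- The homology `H_l(𝒵_•)`. -/
abbrev ZHomology (l : ℕ) : Type _ :=
  zCycles f l ⧸ ((zMod f (l + 1)).map (zD R n)).submoduleOf (zCycles f l)

variable {G : Type*} [AddCommGroup G] (𝒜 : G → AddSubgroup R)

/-- The degree `μ` part of `R[T]` for the `G`-grading in which the `T_i` have degree `0`: the
polynomials with coefficients in `R_μ`. -/
def polyPiece (n : ℕ) (μ : G) : AddSubgroup (MvPolynomial (Fin n) R) where
  carrier := {p | ∀ d, p.coeff d ∈ 𝒜 μ}
  add_mem' hp hq d := by simpa using add_mem (hp d) (hq d)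
  zero_mem' d := by simp
  neg_mem' hp d := by simpa using hp d

/-- The degree `μ` part `(𝒵_l)_μ`.  When all the `f_i` have degree `γ`, the Koszul basis elements
`e_σ`, `#σ = l`, have degree `l γ` in the Koszul complex, so degree `0` after the shift by `l γ`;
hence an element has degree `μ` when all its coefficients lie in `R_μ[T]`. -/
def zPiece (l : ℕ) (μ : G) : AddSubgroup (Finset (Fin n) → MvPolynomial (Fin n) R) where
  carrier := {x | x ∈ zMod f l ∧ ∀ σ, x σ ∈ polyPiece 𝒜 n μ}
  add_mem' hx hy := ⟨add_mem hx.1 hy.1, fun σ => add_mem (hx.2 σ) (hy.2 σ)⟩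
  zero_mem' := ⟨zero_mem _, fun _ => zero_mem _⟩
  neg_mem' hx := ⟨neg_mem hx.1, fun σ => neg_mem (hx.2 σ)⟩

/-- The induced `G`-grading on `H_l(𝒵_•)`. -/
noncomputable def zHomologyPiece (l : ℕ) (μ : G) : AddSubgroup (ZHomology f l) :=
  ((zPiece f 𝒜 l μ).comap (zCycles f l).subtype.toAddMonoidHom).map
    (((zMod f (l + 1)).map (zD R n)).submoduleOf (zCycles f l)).mkQ.toAddMonoidHom

/-- Acyclicity of the degree `μ` strand `(𝒵_•)_μ`: its homology vanishes in all positive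
homological degrees. -/
def ZAcyclicIn (μ : G) : Prop :=
  ∀ l : ℕ, ∀ x ∈ zPiece f 𝒜 (l + 1) μ, zD R n x = 0 → ∃ y ∈ zPiece f 𝒜 (l + 2) μ, zD R n y = x

/-- The degree `μ` part of `Sym_R(I)`, `I = (f_1, …, f_n)`, for the `G`-grading making the
presentation `R[T] → Sym_R(I)`, `T_i ↦ f_i`, homogeneous of degree `0`. -/
noncomputable def symPiece (μ : G) :
    AddSubgroup (SymmetricAlgebra R (Ideal.span (Set.range f))) :=
  (polyPiece 𝒜 n μ).map
    (MvPolynomial.aeval (R := R) fun i => SymmetricAlgebra.ι R (Ideal.span (Set.range f))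
      ⟨f i, Ideal.subset_span (Set.mem_range_self i)⟩).toRingHom.toAddMonoidHom

end Approx

end GradedCech

namespace GradedCech

/-! ### Functoriality of the Čech complex -/

section Functoriality

variable {R : Type*} [CommRing R] {s : ℕ} (b : Fin s → R)
  {M N : Type*} [AddCommGroup M] [Module R M] [AddCommGroup N] [Module R N]

/-! The proof is a chase through short exact sequences. `LocVanish` records that one graded strand
of one local cohomology module vanishes, and `locVanish_middle`, `locVanish_right`, `locVanish_left`
are the three segments of the long exact sequence, proved directly on Čech cochains.

Two facts feed the chase. Since `cd_B(R/I) ≤ 1`, every `I`-power torsion module has `H^p_B = 0` for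
`p ≥ 2` (`locVanishAll_of_torsion`); this covers the Koszul homology of `f`, which `I` kills, and
`H_l(𝒵)` for `l ≥ 1`, which is `I`-power torsion (`exists_pow_smul_mem_zD`). Since `grade(B) ≥ 2`,
`H^0_B(R) = H^1_B(R) = 0`, and the `Z_l`, being kernels of maps between free modules, inherit this
(`locVanish_zMod_le_one`).

Let `B_l` be the Koszul boundaries and `p ≥ 2`. The sequences `0 → B_l → Z_l → H_l → 0` and `0 →
Z_{l+1} → K_{l+1} → B_l → 0` reduce `H^p_B(Z_l)_μ = 0` to the vanishing of `H^p_B(R)_{μ-γ}` and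
`H^{p+1}_B(Z_{l+1})_{μ-γ}`, and iteration stops once `p > s`. The terms `H^{j+2}_B(R)_{μ-(j+1)γ}`
vanish because `μ` avoids the member `k = 1` of the region; the remaining ones come from the
induction itself, because `R` is a direct summand of `Z_0` (`locVanish_zMod_aux`). For `m = 1` the
region is empty, but then only `l ≥ p ≥ 2` is needed, where `I` kills `Z_l`
(`locVanish_zMod_of_le`). The same method applied to the differential of `𝒵` passes from the `Z_l`
to boundaries, cycles and homology of `𝒵` (`locVanish_map_zD`, `locVanish_zCycles`,
`locVanish_zHomology`).

For the second part, at a prime not containing `B` a minimal generating subset of the `f i` has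
Koszul homology only in degrees at most one, so its approximation complex is exact, and redundant
generators do not destroy exactness (`PartExact.insert`). Hence classes in `H_l(𝒵)`, `l ≥ 1`, are
killed by powers of the `b i`, and `H^0_B(H_l(𝒵))_μ = 0` forces them to vanish in degree `μ`.
Finally `Sym_R(I) = H_0(𝒵)` (`grShortExact_sym`). -/

theorem res_mk {σ τ : Finset (Fin s)} (h : σ ⊆ τ) (m : M) (t : mon b σ) :
    res b M h (LocalizedModule.mk m t) = LocalizedModule.mk m (⟨t.1, mon_mono b h t.2⟩ : mon b τ) := by
  rw [res, IsLocalizedModule.mk_eq_mk', IsLocalizedModule.mk_eq_mk', IsLocalizedModule.liftOfLE_mk']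

/-- The map of localizations induced by a linear map. -/
noncomputable def locMap (S : Submonoid R) (g : M →ₗ[R] N) :
    LocalizedModule S M →ₗ[R] LocalizedModule S N :=
  IsLocalizedModule.map S (LocalizedModule.mkLinearMap S M) (LocalizedModule.mkLinearMap S N) g

theorem locMap_mk (S : Submonoid R) (g : M →ₗ[R] N) (m : M) (t : S) :
    locMap S g (LocalizedModule.mk m t) = LocalizedModule.mk (g m) t := by
  rw [locMap, IsLocalizedModule.mk_eq_mk', IsLocalizedModule.mk_eq_mk', IsLocalizedModule.map_mk']

theorem locMap_injective (S : Submonoid R) {g : M →ₗ[R] N} (hg : Function.Injective g) :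
    Function.Injective (locMap S g) :=
  IsLocalizedModule.map_injective S _ _ g hg

/-- The map of Čech cochains induced by a linear map. -/
noncomputable def cechMap (g : M →ₗ[R] N) : Cochain b M →ₗ[R] Cochain b N :=
  LinearMap.pi fun σ => locMap (mon b σ) g ∘ₗ LinearMap.proj σ

theorem cechMap_apply (g : M →ₗ[R] N) (x : Cochain b M) (σ : Finset (Fin s)) :
    cechMap b g x σ = locMap (mon b σ) g (x σ) := rfl

theorem locMap_res (g : M →ₗ[R] N) {σ τ : Finset (Fin s)} (h : σ ⊆ τ)
    (y : LocalizedModule (mon b σ) M) :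
    locMap (mon b τ) g (res b M h y) = res b N h (locMap (mon b σ) g y) := by
  induction y using LocalizedModule.induction_on with
  | h m t => rw [res_mk, locMap_mk, locMap_mk, res_mk]

theorem cechMap_cechD (g : M →ₗ[R] N) (x : Cochain b M) :
    cechMap b g (cechD b M x) = cechD b N (cechMap b g x) := by
  funext τ
  rw [cechMap_apply, cechD_apply, cechD_apply, map_sum]
  exact Finset.sum_congr rfl fun i _ => by rw [map_smul, locMap_res, cechMap_apply]

theorem cechMap_injective {g : M →ₗ[R] N} (hg : Function.Injective g) :
    Function.Injective (cechMap b g) := by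
  intro x y h
  funext σ
  exact locMap_injective _ hg (congrFun h σ)

variable (M) in
/-- The cochains of degree `p - 1` (zero for `p = 0`). -/
def cochainsBelow (p : ℕ) : Submodule R (Cochain b M) where
  carrier := {x | ∀ σ, σ.card + 1 ≠ p → x σ = 0}
  add_mem' hx hy σ h := by simp [hx σ h, hy σ h]
  zero_mem' _ _ := rfl
  smul_mem' r x hx σ h := by simp [hx σ h]

theorem cochainsBelow_zero : cochainsBelow b M 0 = ⊥ := by
  refine (Submodule.eq_bot_iff _).2 fun x hx => ?_
  funext σ
  exact hx σ (by omega)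

theorem cochainsBelow_succ (p : ℕ) : cochainsBelow b M (p + 1) = cochains b M p := by
  ext x
  exact forall_congr' fun σ => by rw [Ne, Nat.add_right_cancel_iff]

theorem mem_coboundaries_iff {p : ℕ} {x : Cochain b M} :
    x ∈ coboundaries b M p ↔ ∃ y ∈ cochainsBelow b M p, cechD b M y = x := by
  cases p with
  | zero =>
    rw [cochainsBelow_zero]
    simp [coboundaries, eq_comm]
  | succ p =>
    rw [cochainsBelow_succ]
    rfl

theorem cechD_mem_of_below {p : ℕ} {x : Cochain b M} (hx : x ∈ cochainsBelow b M p) :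
    cechD b M x ∈ cochains b M p := by
  cases p with
  | zero =>
    rw [cochainsBelow_zero, Submodule.mem_bot] at hx
    rw [hx, map_zero]
    exact zero_mem _
  | succ p =>
    rw [cochainsBelow_succ] at hx
    exact cechD_mem_cochains b M hx

theorem cechMap_mem_cochains (g : M →ₗ[R] N) {p : ℕ} {x : Cochain b M} (hx : x ∈ cochains b M p) :
    cechMap b g x ∈ cochains b N p := fun σ h => by rw [cechMap_apply, hx σ h, map_zero]

theorem cechMap_mem_below (g : M →ₗ[R] N) {p : ℕ} {x : Cochain b M}
    (hx : x ∈ cochainsBelow b M p) : cechMap b g x ∈ cochainsBelow b N p :=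
  fun σ h => by rw [cechMap_apply, hx σ h, map_zero]

end Functoriality

/-! ### Graded pieces of localizations -/

section Graded

variable {R : Type*} [CommRing R] {G : Type*} [AddCommGroup G] (𝒜 : G → AddSubgroup R)
  {M : Type*} [AddCommGroup M] [Module R M] (ℳ : G → AddSubgroup M)

/-- Homogeneous scalars shift degrees. -/
def GrSMul : Prop := ∀ ⦃e g : G⦄ ⦃r : R⦄ ⦃x : M⦄, r ∈ 𝒜 e → x ∈ ℳ g → r • x ∈ ℳ (g + e)

/-- All elements of a submonoid are homogeneous. -/
def HomogeneousMon (S : Submonoid R) : Prop := ∀ t ∈ S, ∃ e, t ∈ 𝒜 e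

variable {𝒜 ℳ}

theorem homogeneousMon_mon [SetLike.GradedMonoid 𝒜] {s : ℕ} {b : Fin s → R}
    (hb : ∀ i, SetLike.IsHomogeneousElem 𝒜 (b i)) (σ : Finset (Fin s)) :
    HomogeneousMon 𝒜 (mon b σ) := by
  intro t ht
  refine Submonoid.closure_induction (motive := fun t _ => ∃ e, t ∈ 𝒜 e) ?_ ?_ ?_ ht
  · rintro _ ⟨i, -, rfl⟩
    exact hb i
  · exact ⟨0, SetLike.one_mem_graded 𝒜⟩
  · rintro x y - - ⟨e, he⟩ ⟨e', he'⟩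
    exact ⟨e + e', SetLike.mul_mem_graded he he'⟩

/-- Homogeneous fractions can be put over a common homogeneous denominator, so the generated
subgroup contains nothing new. -/
theorem mem_locPiece_iff [SetLike.GradedMonoid 𝒜] (hM : GrSMul 𝒜 ℳ) {S : Submonoid R} {μ : G}
    {y : LocalizedModule S M} :
    y ∈ locPiece 𝒜 ℳ S μ ↔ ∃ (e : G) (t : S) (x : M),
      (t : R) ∈ 𝒜 e ∧ x ∈ ℳ (μ + e) ∧ y = LocalizedModule.mk x t := by
  refine ⟨fun h => ?_, fun h => AddSubgroup.subset_closure h⟩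
  refine AddSubgroup.closure_induction (fun y h => h) ?_ ?_ ?_ h
  · exact ⟨0, 1, 0, SetLike.one_mem_graded 𝒜, zero_mem _, (LocalizedModule.zero_mk _).symm⟩
  · rintro _ _ - - ⟨e, t, x, ht, hx, rfl⟩ ⟨e', t', x', ht', hx', rfl⟩
    refine ⟨e + e', t * t', t' • x + t • x', SetLike.mul_mem_graded ht ht', ?_, ?_⟩
    · refine add_mem ?_ ?_
      · have := hM ht' hx
        rwa [add_assoc] at this
      · have := hM ht hx'
        rwa [add_assoc, add_comm e' e] at this
    · rw [LocalizedModule.mk_add_mk]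
  · rintro _ - ⟨e, t, x, ht, hx, rfl⟩
    exact ⟨e, t, -x, ht, neg_mem hx, by rw [LocalizedModule.mk_neg]⟩

theorem mk_mem_locPiece {S : Submonoid R} {μ e : G} {t : S} {x : M} (ht : (t : R) ∈ 𝒜 e)
    (hx : x ∈ ℳ (μ + e)) : LocalizedModule.mk x t ∈ locPiece 𝒜 ℳ S μ :=
  AddSubgroup.subset_closure ⟨e, t, x, ht, hx, rfl⟩

theorem locPiece_shift (S : Submonoid R) (γ μ : G) :
    locPiece 𝒜 (fun g => ℳ (g + γ)) S μ = locPiece 𝒜 ℳ S (μ + γ) := by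
  unfold locPiece
  congr 1
  ext y
  refine exists_congr fun e => exists_congr fun t => exists_congr fun x => ?_
  show _ ∧ x ∈ ℳ (μ + e + γ) ∧ _ ↔ _
  rw [add_right_comm μ e γ]

theorem locMap_mem_locPiece {N : Type*} [AddCommGroup N] [Module R N] {𝒩 : G → AddSubgroup N}
    {g : M →ₗ[R] N} (hg : ∀ ν, ∀ x ∈ ℳ ν, g x ∈ 𝒩 ν) {S : Submonoid R} {μ : G}
    {y : LocalizedModule S M} (hy : y ∈ locPiece 𝒜 ℳ S μ) :
    locMap S g y ∈ locPiece 𝒜 𝒩 S μ := by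
  have : locPiece 𝒜 ℳ S μ ≤ (locPiece 𝒜 𝒩 S μ).comap (locMap S g).toAddMonoidHom := by
    refine (AddSubgroup.closure_le _).2 ?_
    rintro _ ⟨e, t, x, ht, hx, rfl⟩
    show locMap S g _ ∈ locPiece 𝒜 𝒩 S μ
    rw [locMap_mk]
    exact mk_mem_locPiece ht (hg _ _ hx)
  exact this hy

theorem res_mem_locPiece {s : ℕ} (b : Fin s → R) {σ τ : Finset (Fin s)} (h : σ ⊆ τ) {μ : G}
    {y : LocalizedModule (mon b σ) M} (hy : y ∈ locPiece 𝒜 ℳ (mon b σ) μ) :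
    res b M h y ∈ locPiece 𝒜 ℳ (mon b τ) μ := by
  have : locPiece 𝒜 ℳ (mon b σ) μ ≤
      (locPiece 𝒜 ℳ (mon b τ) μ).comap (res b M h).toAddMonoidHom := by
    refine (AddSubgroup.closure_le _).2 ?_
    rintro _ ⟨e, t, x, ht, hx, rfl⟩
    show res b M h _ ∈ locPiece 𝒜 ℳ (mon b τ) μ
    rw [res_mk]
    exact mk_mem_locPiece ht hx
  exact this hy

theorem sgn_smul_mem {A M : Type*} [CommRing A] [AddCommGroup M] [Module A M] {n : ℕ}
    (σ : Finset (Fin n)) (i : Fin n) (L : AddSubgroup M) {x : M} (hx : x ∈ L) :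
    sgn A σ i • x ∈ L := by
  unfold sgn
  rcases neg_one_pow_eq_or A (σ.filter (· < i)).card with h | h <;> rw [h]
  · rwa [one_smul]
  · rw [neg_smul, one_smul]
    exact neg_mem hx

theorem cechD_mem_cochainPiece {s : ℕ} {b : Fin s → R} {μ : G} {x : Cochain b M}
    (hx : x ∈ cochainPiece b 𝒜 ℳ μ) : cechD b M x ∈ cochainPiece b 𝒜 ℳ μ := by
  intro τ
  rw [cechD_apply]
  exact sum_mem fun i _ => sgn_smul_mem _ _ _ (res_mem_locPiece b _ (hx _))

end Graded

/-! ### Vanishing of graded pieces of local cohomology and exact sequences -/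

section Vanishing

variable {R : Type*} [CommRing R] {s : ℕ} (b : Fin s → R) {G : Type*} [AddCommGroup G]
  (𝒜 : G → AddSubgroup R)

/-- Every Čech cocycle of degree `μ` is the coboundary of a cochain of degree `μ`. -/
def LocVanish {M : Type*} [AddCommGroup M] [Module R M] (ℳ : G → AddSubgroup M) (p : ℕ) (μ : G) :
    Prop :=
  ∀ x ∈ cochains b M p, x ∈ cochainPiece b 𝒜 ℳ μ → cechD b M x = 0 →
    ∃ y ∈ cochainsBelow b M p, y ∈ cochainPiece b 𝒜 ℳ μ ∧ cechD b M y = x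

variable {b 𝒜}

theorem LocVanish.locCohPiece_eq_bot {M : Type*} [AddCommGroup M] [Module R M]
    {ℳ : G → AddSubgroup M} {p : ℕ} {μ : G} (h : LocVanish b 𝒜 ℳ p μ) :
    locCohPiece b 𝒜 ℳ p μ = ⊥ := by
  refine (AddSubgroup.eq_bot_iff_forall _).2 ?_
  rintro _ ⟨⟨x, hx⟩, hxμ, rfl⟩
  obtain ⟨y, hy, -, e⟩ := h x hx.1 hxμ hx.2
  refine (Submodule.Quotient.mk_eq_zero _).2 ?_
  exact (mem_coboundaries_iff b).2 ⟨y, hy, e⟩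

theorem mem_coboundaries_of_locCohPiece {M : Type*} [AddCommGroup M] [Module R M]
    {ℳ : G → AddSubgroup M} {p : ℕ} {μ : G} (h : locCohPiece b 𝒜 ℳ p μ = ⊥)
    {x : Cochain b M} (hx : x ∈ cochains b M p) (hμ : x ∈ cochainPiece b 𝒜 ℳ μ)
    (hd : cechD b M x = 0) : x ∈ coboundaries b M p := by
  have hc : x ∈ cocycles b M p := ⟨hx, hd⟩
  have : ((coboundaries b M p).submoduleOf (cocycles b M p)).mkQ ⟨x, hc⟩ ∈
      locCohPiece b 𝒜 ℳ p μ := ⟨⟨x, hc⟩, hμ, rfl⟩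
  rw [h, AddSubgroup.mem_bot] at this
  exact (Submodule.Quotient.mk_eq_zero ((coboundaries b M p).submoduleOf (cocycles b M p))).1 this

/-- No subset of `Fin s` has more than `s` elements. This starts the descending inductions on `p`.
-/
theorem locVanish_of_lt {M : Type*} [AddCommGroup M] [Module R M] (ℳ : G → AddSubgroup M) {p : ℕ}
    (hp : s < p) (μ : G) : LocVanish b 𝒜 ℳ p μ := by
  intro x hx _ _
  refine ⟨0, zero_mem _, zero_mem _, ?_⟩
  rw [map_zero]
  funext σ
  refine (hx σ ?_).symm
  have := Finset.card_le_univ σ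
  rw [Fintype.card_fin] at this
  omega

theorem locVanish_shift {M : Type*} [AddCommGroup M] [Module R M] (ℳ : G → AddSubgroup M) (p : ℕ)
    (γ μ : G) : LocVanish b 𝒜 (fun g => ℳ (g + γ)) p μ ↔ LocVanish b 𝒜 ℳ p (μ + γ) := by
  have : ∀ x : Cochain b M, x ∈ cochainPiece b 𝒜 (fun g => ℳ (g + γ)) μ ↔
      x ∈ cochainPiece b 𝒜 ℳ (μ + γ) := fun x =>
    forall_congr' fun σ => by rw [locPiece_shift]
  unfold LocVanish
  simp only [this]

/-! ### Graded short exact sequences and the long exact sequence -/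

variable {M' M M'' : Type*} [AddCommGroup M'] [Module R M'] [AddCommGroup M] [Module R M]
  [AddCommGroup M''] [Module R M'']

/-- A short exact sequence of graded modules. -/
structure GrShortExact (ℳ' : G → AddSubgroup M') (ℳ : G → AddSubgroup M) (ℳ'' : G → AddSubgroup M'')
    (i : M' →ₗ[R] M) (π : M →ₗ[R] M'') : Prop where
  inj : Function.Injective i
  zero : ∀ x, π (i x) = 0
  exact : ∀ x, π x = 0 → ∃ x', i x' = x
  mem_iff : ∀ g x, i x ∈ ℳ g ↔ x ∈ ℳ' g
  mem : ∀ g, ∀ x ∈ ℳ g, π x ∈ ℳ'' g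
  surj : ∀ g, ∀ x ∈ ℳ'' g, ∃ y ∈ ℳ g, π y = x

namespace GrShortExact

variable {ℳ' : G → AddSubgroup M'} {ℳ : G → AddSubgroup M} {ℳ'' : G → AddSubgroup M''}
  {i : M' →ₗ[R] M} {π : M →ₗ[R] M''}

theorem locMap_surj (h : GrShortExact ℳ' ℳ ℳ'' i π) {S : Submonoid R} {μ : G}
    {y : LocalizedModule S M''} (hy : y ∈ locPiece 𝒜 ℳ'' S μ) :
    ∃ z ∈ locPiece 𝒜 ℳ S μ, locMap S π z = y := by
  have : locPiece 𝒜 ℳ'' S μ ≤ (locPiece 𝒜 ℳ S μ).map (locMap S π).toAddMonoidHom := by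
    refine (AddSubgroup.closure_le _).2 ?_
    rintro _ ⟨e, t, x, ht, hx, rfl⟩
    obtain ⟨y, hy, rfl⟩ := h.surj _ _ hx
    exact ⟨_, mk_mem_locPiece ht hy, locMap_mk _ _ _ _⟩
  exact this hy

theorem locMap_exact [SetLike.GradedMonoid 𝒜] (hM : GrSMul 𝒜 ℳ)
    (h : GrShortExact ℳ' ℳ ℳ'' i π) {S : Submonoid R} (hS : HomogeneousMon 𝒜 S) {μ : G}
    {y : LocalizedModule S M} (hy : y ∈ locPiece 𝒜 ℳ S μ) (h0 : locMap S π y = 0) :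
    ∃ z ∈ locPiece 𝒜 ℳ' S μ, locMap S i z = y := by
  obtain ⟨e, t, x, ht, hx, rfl⟩ := (mem_locPiece_iff hM).1 hy
  rw [locMap_mk, ← LocalizedModule.zero_mk t, LocalizedModule.mk_eq] at h0
  obtain ⟨u, hu⟩ := h0
  rw [smul_zero, smul_zero, Submonoid.smul_def, Submonoid.smul_def, ← map_smul, ← map_smul] at hu
  obtain ⟨x', hx'⟩ := h.exact _ hu
  obtain ⟨c, hc⟩ := hS _ u.2
  have hut : ((u * t : S) : R) ∈ 𝒜 (e + c) := by
    rw [add_comm]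
    exact SetLike.mul_mem_graded hc ht
  -- The image of `x'` is `u • t • x`, so a second factor `t` in the denominator is needed to return
  -- to `x / t`.
  refine ⟨LocalizedModule.mk x' (u * t * t), mk_mem_locPiece (e := e + c + e) ?_ ?_, ?_⟩
  · exact SetLike.mul_mem_graded hut ht
  · rw [← h.mem_iff, hx']
    have := hM hc (hM ht hx)
    convert this using 2
    abel
  · rw [locMap_mk, hx', LocalizedModule.mk_eq]
    refine ⟨1, ?_⟩
    simp only [Submonoid.smul_def, smul_smul, Submonoid.coe_mul, Submonoid.coe_one]
    congr 1
    ring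

theorem lift (h : GrShortExact ℳ' ℳ ℳ'' i π) {μ : G} {x : Cochain b M''}
    (hx : x ∈ cochainPiece b 𝒜 ℳ'' μ) :
    ∃ y ∈ cochainPiece b 𝒜 ℳ μ, cechMap b π y = x ∧
      (∀ p, x ∈ cochains b M'' p → y ∈ cochains b M p) ∧
      (∀ p, x ∈ cochainsBelow b M'' p → y ∈ cochainsBelow b M p) := by
  classical
  choose f hf hf' using fun σ => h.locMap_surj (hx σ)
  -- Zero components are lifted to zero, so that the lift has the same cochain degree as `x`.
  refine ⟨fun σ => if x σ = 0 then 0 else f σ, fun σ => ?_, ?_, ?_, ?_⟩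
  · dsimp only
    split_ifs
    exacts [zero_mem _, hf σ]
  · funext σ
    rw [cechMap_apply]
    split_ifs with h0
    · rw [map_zero, h0]
    · exact hf' σ
  · exact fun p hp σ hσ => if_pos (hp σ hσ)
  · exact fun p hp σ hσ => if_pos (hp σ hσ)

theorem descend [SetLike.GradedMonoid 𝒜] (hb : ∀ i, SetLike.IsHomogeneousElem 𝒜 (b i))
    (hM : GrSMul 𝒜 ℳ) (h : GrShortExact ℳ' ℳ ℳ'' i π) {μ : G} {x : Cochain b M}
    (hx : x ∈ cochainPiece b 𝒜 ℳ μ) (h0 : cechMap b π x = 0) :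
    ∃ y ∈ cochainPiece b 𝒜 ℳ' μ, cechMap b i y = x ∧
      (∀ p, x ∈ cochains b M p → y ∈ cochains b M' p) ∧
      (∀ p, x ∈ cochainsBelow b M p → y ∈ cochainsBelow b M' p) := by
  choose f hf hf' using fun σ =>
    h.locMap_exact hM (homogeneousMon_mon hb σ) (hx σ) (congrFun h0 σ)
  have key : ∀ σ, x σ = 0 → f σ = 0 := fun σ e =>
    locMap_injective _ h.inj (by rw [hf', e, map_zero])
  exact ⟨f, hf, funext hf', fun p hp σ hσ => key σ (hp σ hσ), fun p hp σ hσ => key σ (hp σ hσ)⟩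

theorem map_mem_left (h : GrShortExact ℳ' ℳ ℳ'' i π) {μ : G} {x : Cochain b M'}
    (hx : x ∈ cochainPiece b 𝒜 ℳ' μ) : cechMap b i x ∈ cochainPiece b 𝒜 ℳ μ :=
  fun σ => locMap_mem_locPiece (fun g x hx => (h.mem_iff g x).2 hx) (hx σ)

theorem map_mem_right (h : GrShortExact ℳ' ℳ ℳ'' i π) {μ : G} {x : Cochain b M}
    (hx : x ∈ cochainPiece b 𝒜 ℳ μ) : cechMap b π x ∈ cochainPiece b 𝒜 ℳ'' μ :=
  fun σ => locMap_mem_locPiece h.mem (hx σ)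

theorem map_map_eq_zero (h : GrShortExact ℳ' ℳ ℳ'' i π) (x : Cochain b M') :
    cechMap b π (cechMap b i x) = 0 := by
  funext σ
  rw [cechMap_apply, cechMap_apply]
  induction x σ using LocalizedModule.induction_on with
  | h m t =>
    rw [locMap_mk, locMap_mk, h.zero, LocalizedModule.zero_mk]
    rfl

variable [SetLike.GradedMonoid 𝒜]

/-- The segment `H^p(M') → H^p(M) → H^p(M'')`: after subtraction of a coboundary lifted from `M''`,
the cocycle comes from `M'`. -/
theorem locVanish_middle (h : GrShortExact ℳ' ℳ ℳ'' i π)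
    (hb : ∀ i, SetLike.IsHomogeneousElem 𝒜 (b i)) (hM : GrSMul 𝒜 ℳ) {p : ℕ} {μ : G}
    (h' : LocVanish b 𝒜 ℳ' p μ) (h'' : LocVanish b 𝒜 ℳ'' p μ) : LocVanish b 𝒜 ℳ p μ := by
  intro x hx hμ hd
  obtain ⟨y, hy, hyμ, e⟩ := h'' _ (cechMap_mem_cochains b π hx) (h.map_mem_right hμ)
    (by rw [← cechMap_cechD, hd, map_zero])
  obtain ⟨z, hzμ, hzy, -, hz⟩ := h.lift hyμ
  obtain ⟨w, hwμ, hwx, hw, -⟩ := h.descend (x := x - cechD b M z) hb hM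
    (sub_mem hμ (cechD_mem_cochainPiece hzμ))
    (by rw [map_sub, cechMap_cechD, hzy, e, sub_self])
  obtain ⟨v, hv, hvμ, e'⟩ := h' w (hw p (sub_mem hx (cechD_mem_of_below b (hz p hy)))) hwμ
    (cechMap_injective b h.inj (by rw [cechMap_cechD, hwx, map_sub, hd, cechD_cechD]; simp))
  refine ⟨z + cechMap b i v, add_mem (hz p hy) (cechMap_mem_below b i hv),
    add_mem hzμ (h.map_mem_left hvμ), ?_⟩
  rw [map_add, ← cechMap_cechD, e', hwx, add_sub_cancel]

/-- The segment `H^p(M) → H^p(M'') → H^{p+1}(M')`: the coboundary of a lift is a cocycle of `M'`,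
and its primitive corrects the lift. -/
theorem locVanish_right (h : GrShortExact ℳ' ℳ ℳ'' i π)
    (hb : ∀ i, SetLike.IsHomogeneousElem 𝒜 (b i)) (hM : GrSMul 𝒜 ℳ) {p : ℕ} {μ : G}
    (h1 : LocVanish b 𝒜 ℳ p μ) (h2 : LocVanish b 𝒜 ℳ' (p + 1) μ) : LocVanish b 𝒜 ℳ'' p μ := by
  intro x hx hμ hd
  obtain ⟨y, hyμ, hyx, hy, -⟩ := h.lift hμ
  obtain ⟨w, hwμ, hwy, hw, -⟩ := h.descend (x := cechD b M y) hb hM (cechD_mem_cochainPiece hyμ)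
    (by rw [cechMap_cechD, hyx, hd])
  obtain ⟨v, hv, hvμ, e⟩ := h2 w (hw _ (cechD_mem_cochains b M (hy p hx))) hwμ
    (cechMap_injective b h.inj (by rw [cechMap_cechD, hwy, cechD_cechD, map_zero]))
  rw [cochainsBelow_succ] at hv
  obtain ⟨z, hz, hzμ, e'⟩ := h1 (y - cechMap b i v)
    (sub_mem (hy p hx) (cechMap_mem_cochains b i hv)) (sub_mem hyμ (h.map_mem_left hvμ))
    (by rw [map_sub, ← cechMap_cechD, e, hwy, sub_self])
  refine ⟨cechMap b π z, cechMap_mem_below b π hz, h.map_mem_right hzμ, ?_⟩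
  rw [← cechMap_cechD, e', map_sub, h.map_map_eq_zero, sub_zero, hyx]

/-- The segment `H^{p-1}(M'') → H^p(M') → H^p(M)`. Quantifying over `q` with `q + 1 = p` makes the
left term disappear for `p = 0`. -/
theorem locVanish_left (h : GrShortExact ℳ' ℳ ℳ'' i π)
    (hb : ∀ i, SetLike.IsHomogeneousElem 𝒜 (b i)) (hM : GrSMul 𝒜 ℳ) {p : ℕ} {μ : G}
    (h1 : LocVanish b 𝒜 ℳ p μ) (h2 : ∀ q, q + 1 = p → LocVanish b 𝒜 ℳ'' q μ) :
    LocVanish b 𝒜 ℳ' p μ := by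
  intro x hx hμ hd
  obtain ⟨y, hy, hyμ, e⟩ := h1 _ (cechMap_mem_cochains b i hx) (h.map_mem_left hμ)
    (by rw [← cechMap_cechD, hd, map_zero])
  have key : ∃ y ∈ cochainsBelow b M p, y ∈ cochainPiece b 𝒜 ℳ μ ∧
      cechD b M y = cechMap b i x ∧ cechMap b π y = 0 := by
    cases p with
    | zero =>
      refine ⟨y, hy, hyμ, e, ?_⟩
      rw [cochainsBelow_zero, Submodule.mem_bot] at hy
      rw [hy, map_zero]
    | succ q =>
      rw [cochainsBelow_succ] at hy
      obtain ⟨z, hz, hzμ, e'⟩ := h2 q rfl _ (cechMap_mem_cochains b π hy) (h.map_mem_right hyμ)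
        (by rw [← cechMap_cechD, e, h.map_map_eq_zero])
      obtain ⟨w, hwμ, hwz, -, hw⟩ := h.lift hzμ
      refine ⟨y - cechD b M w, ?_, sub_mem hyμ (cechD_mem_cochainPiece hwμ), ?_, ?_⟩
      · rw [cochainsBelow_succ]
        exact sub_mem hy (cechD_mem_of_below b (hw q hz))
      · rw [map_sub, cechD_cechD, sub_zero, e]
      · rw [map_sub, cechMap_cechD, hwz, e', sub_self]
  obtain ⟨y, hy, hyμ, e, h0⟩ := key
  obtain ⟨w, hwμ, hwy, -, hw⟩ := h.descend hb hM hyμ h0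
  exact ⟨w, hw p hy, hwμ, cechMap_injective b h.inj (by rw [cechMap_cechD, hwy, e])⟩

end GrShortExact

end Vanishing

end GradedCech

namespace GradedCech

/-! ### Projections onto the graded pieces -/

section Projections

variable {R : Type*} [CommRing R] {G : Type*} [AddCommGroup G] {𝒜 : G → AddSubgroup R}
  {M : Type*} [AddCommGroup M] [Module R M] {ℳ : G → AddSubgroup M}

variable (𝒜 ℳ) in
/-- Additive projections of a module onto its graded pieces, compatible with homogeneous
scalars. -/
structure IsProjFamily (π : G → M →+ M) : Prop where
  mem : ∀ g m, π g m ∈ ℳ g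
  self : ∀ g, ∀ m ∈ ℳ g, π g m = m
  smul : ∀ e g, ∀ r ∈ 𝒜 e, ∀ m, π (g + e) (r • m) = r • π g m

namespace IsProjFamily

variable {π : G → M →+ M}

theorem grSMul (h : IsProjFamily 𝒜 ℳ π) : GrSMul 𝒜 ℳ := by
  intro e g r x hr hx
  rw [← h.self g x hx, ← h.smul e g r hr]
  exact h.mem _ _

/-- Projections pass through the relation defining equality of fractions because they commute with
homogeneous scalars. The degrees `e`, `e'` are arbitrary, so the projection of a fraction depends
neither on the representative nor on the degree chosen for its denominator. -/
theorem mk_eq_mk (h : IsProjFamily 𝒜 ℳ π) {S : Submonoid R} (hS : HomogeneousMon 𝒜 S) (μ : G)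
    {e e' : G} {t t' : S} (ht : (t : R) ∈ 𝒜 e) (ht' : (t' : R) ∈ 𝒜 e') {m m' : M}
    (hm : LocalizedModule.mk m t = LocalizedModule.mk m' t') :
    LocalizedModule.mk (π (μ + e) m) t = LocalizedModule.mk (π (μ + e') m') t' := by
  obtain ⟨u, hu⟩ := LocalizedModule.mk_eq.1 hm
  obtain ⟨c, hc⟩ := hS _ u.2
  refine LocalizedModule.mk_eq.2 ⟨u, ?_⟩
  simp only [Submonoid.smul_def] at hu ⊢
  rw [← h.smul e' _ _ ht', ← h.smul e _ _ ht, ← h.smul c _ _ hc, ← h.smul c _ _ hc, hu,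
    add_right_comm μ e e']

/-- The projection of a localization onto its degree `μ` piece. -/
noncomputable def locProj (h : IsProjFamily 𝒜 ℳ π) {S : Submonoid R} (hS : HomogeneousMon 𝒜 S)
    (μ : G) (y : LocalizedModule S M) : LocalizedModule S M :=
  LocalizedModule.liftOn y
    (fun p => LocalizedModule.mk (π (μ + (hS p.2.1 p.2.2).choose) p.1) p.2)
    fun p p' hp => h.mk_eq_mk hS μ (hS p.2.1 p.2.2).choose_spec (hS p'.2.1 p'.2.2).choose_spec
      (LocalizedModule.mk_eq.2 hp)

theorem locProj_mk (h : IsProjFamily 𝒜 ℳ π) {S : Submonoid R} (hS : HomogeneousMon 𝒜 S)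
    (μ : G) {e : G} {t : S} (ht : (t : R) ∈ 𝒜 e) (m : M) :
    h.locProj hS μ (LocalizedModule.mk m t) = LocalizedModule.mk (π (μ + e) m) t :=
  h.mk_eq_mk hS μ (hS t.1 t.2).choose_spec ht rfl

theorem locProj_add [SetLike.GradedMonoid 𝒜] (h : IsProjFamily 𝒜 ℳ π) {S : Submonoid R}
    (hS : HomogeneousMon 𝒜 S) (μ : G) (y z : LocalizedModule S M) :
    h.locProj hS μ (y + z) = h.locProj hS μ y + h.locProj hS μ z := by
  induction y, z using LocalizedModule.induction_on₂ with
  | h m m' t t' =>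
    obtain ⟨e, he⟩ := hS _ t.2
    obtain ⟨e', he'⟩ := hS _ t'.2
    have hee : ((t * t' : S) : R) ∈ 𝒜 (e + e') := SetLike.mul_mem_graded he he'
    rw [LocalizedModule.mk_add_mk, h.locProj_mk hS μ he, h.locProj_mk hS μ he',
      h.locProj_mk hS μ hee, LocalizedModule.mk_add_mk, map_add]
    simp only [Submonoid.smul_def]
    rw [← h.smul _ _ _ he, ← h.smul _ _ _ he', add_assoc, add_assoc, add_comm e' e]

theorem locProj_self [SetLike.GradedMonoid 𝒜] (h : IsProjFamily 𝒜 ℳ π) {S : Submonoid R}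
    (hS : HomogeneousMon 𝒜 S) {μ : G} {y : LocalizedModule S M} (hy : y ∈ locPiece 𝒜 ℳ S μ) :
    h.locProj hS μ y = y := by
  obtain ⟨e, t, x, ht, hx, rfl⟩ := (mem_locPiece_iff h.grSMul).1 hy
  rw [h.locProj_mk hS μ ht, h.self _ _ hx]

theorem locProj_mem (h : IsProjFamily 𝒜 ℳ π) {S : Submonoid R}
    (hS : HomogeneousMon 𝒜 S) (μ : G) (y : LocalizedModule S M) :
    h.locProj hS μ y ∈ locPiece 𝒜 ℳ S μ := by
  induction y using LocalizedModule.induction_on with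
  | h m t =>
    obtain ⟨e, he⟩ := hS _ t.2
    rw [h.locProj_mk hS μ he]
    exact mk_mem_locPiece he (h.mem _ _)

theorem locProj_res {s : ℕ} (b : Fin s → R) (h : IsProjFamily 𝒜 ℳ π) {σ τ : Finset (Fin s)}
    (hσ : HomogeneousMon 𝒜 (mon b σ)) (hτ : HomogeneousMon 𝒜 (mon b τ)) (hστ : σ ⊆ τ)
    (μ : G) (y : LocalizedModule (mon b σ) M) :
    h.locProj hτ μ (res b M hστ y) = res b M hστ (h.locProj hσ μ y) := by
  induction y using LocalizedModule.induction_on with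
  | h m t =>
    obtain ⟨e, he⟩ := hσ _ t.2
    rw [h.locProj_mk hσ μ he, res_mk, res_mk]
    exact h.locProj_mk hτ μ he m

/-- Projection to degree `μ` commutes with the restriction maps, hence with the Čech differential,
so it turns any primitive of a degree `μ` cocycle into one of degree `μ`. This transfers ungraded
vanishing to each strand. -/
theorem exists_graded_of_mem_coboundaries [SetLike.GradedMonoid 𝒜] {s : ℕ} {b : Fin s → R}
    (hb : ∀ i, SetLike.IsHomogeneousElem 𝒜 (b i)) (h : IsProjFamily 𝒜 ℳ π) {p : ℕ} {μ : G}
    {x : Cochain b M} (hx : x ∈ cochainPiece b 𝒜 ℳ μ) (hp : x ∈ coboundaries b M p) :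
    ∃ y ∈ cochainsBelow b M p, y ∈ cochainPiece b 𝒜 ℳ μ ∧ cechD b M y = x := by
  obtain ⟨y, hy, rfl⟩ := (mem_coboundaries_iff b).1 hp
  have hS := homogeneousMon_mon hb
  let P : ∀ σ, LocalizedModule (mon b σ) M →+ LocalizedModule (mon b σ) M := fun σ =>
    AddMonoidHom.mk' (h.locProj (hS σ) μ) (h.locProj_add (hS σ) μ)
  refine ⟨fun σ => P σ (y σ), fun σ hσ => ?_, fun σ => h.locProj_mem (hS σ) _ _, ?_⟩
  · show P σ (y σ) = 0
    rw [hy σ hσ, map_zero]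
  · funext τ
    have h1 : P τ (cechD b M y τ) = cechD b M y τ := h.locProj_self (hS τ) (hx τ)
    rw [← h1, cechD_apply, cechD_apply, map_sum]
    refine Finset.sum_congr rfl fun i _ => ?_
    have h2 : ∀ z, P τ (sgn R τ i.1 • z) = sgn R τ i.1 • P τ z := by
      intro z
      unfold sgn
      rcases neg_one_pow_eq_or R (τ.filter (· < i.1)).card with e | e <;> rw [e] <;> simp
    rw [h2]
    congr 1
    exact (h.locProj_res b (hS _) (hS _) _ _ _).symm

end IsProjFamily

end Projections

/-! ### Vanishing of ungraded local cohomology -/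

section Ungraded

variable {R : Type*} [CommRing R] {s : ℕ} (b : Fin s → R)

variable (M : Type*) [AddCommGroup M] [Module R M] in
/-- The vanishing of `H^p_B(M)`. -/
def LocVanishAll (p : ℕ) : Prop :=
  ∀ x ∈ cochains b M p, cechD b M x = 0 → x ∈ coboundaries b M p

/-- The trivial grading. -/
def trivGrading (M : Type*) [AddCommGroup M] : Unit → AddSubgroup M := fun _ => ⊤

instance : SetLike.GradedMonoid (trivGrading R) where
  one_mem := trivial
  mul_mem _ _ _ _ _ _ := trivial

theorem isHomogeneousElem_trivGrading (r : R) : SetLike.IsHomogeneousElem (trivGrading R) r :=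
  ⟨(), trivial⟩

variable {b}
variable {M : Type*} [AddCommGroup M] [Module R M]

theorem grSMul_trivGrading : GrSMul (trivGrading R) (trivGrading M) :=
  fun _ _ _ _ _ _ => trivial

theorem mem_cochainPiece_trivGrading (x : Cochain b M) :
    x ∈ cochainPiece b (trivGrading R) (trivGrading M) () := by
  intro σ
  induction x σ using LocalizedModule.induction_on with
  | h m t => exact mk_mem_locPiece (e := ()) trivial trivial

/-- Through the grading by `Unit`, the graded exact sequence lemmas also serve for ungraded modules.
-/
theorem locVanish_trivGrading_iff {p : ℕ} :
    LocVanish b (trivGrading R) (trivGrading M) p () ↔ LocVanishAll b M p := by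
  constructor
  · intro h x hx hd
    obtain ⟨y, hy, -, e⟩ := h x hx (mem_cochainPiece_trivGrading x) hd
    exact (mem_coboundaries_iff b).2 ⟨y, hy, e⟩
  · intro h x hx _ hd
    obtain ⟨y, hy, e⟩ := (mem_coboundaries_iff b).1 (h x hx hd)
    exact ⟨y, hy, mem_cochainPiece_trivGrading y, e⟩

theorem LocVanishAll.locVanish {G : Type*} [AddCommGroup G] {𝒜 : G → AddSubgroup R}
    [SetLike.GradedMonoid 𝒜] {ℳ : G → AddSubgroup M} {π : G → M →+ M}
    (hb : ∀ i, SetLike.IsHomogeneousElem 𝒜 (b i)) (hπ : IsProjFamily 𝒜 ℳ π) {p : ℕ}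
    (h : LocVanishAll b M p) (μ : G) : LocVanish b 𝒜 ℳ p μ :=
  fun x hx hμ hd => hπ.exists_graded_of_mem_coboundaries hb hμ (h x hx hd)

theorem grShortExact_trivGrading {M' M'' : Type*} [AddCommGroup M'] [Module R M']
    [AddCommGroup M''] [Module R M''] {i : M' →ₗ[R] M} {π : M →ₗ[R] M''}
    (hi : Function.Injective i) (h : LinearMap.range i = LinearMap.ker π)
    (hπ : Function.Surjective π) :
    GrShortExact (trivGrading M') (trivGrading M) (trivGrading M'') i π where
  inj := hi
  zero x := by
    have : i x ∈ LinearMap.ker π := h ▸ LinearMap.mem_range_self i x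
    exact this
  exact x hx := by
    have : x ∈ LinearMap.range i := h ▸ hx
    exact this
  mem_iff _ _ := ⟨fun _ => trivial, fun _ => trivial⟩
  mem _ _ _ := trivial
  surj _ x _ := by
    obtain ⟨y, hy⟩ := hπ x
    exact ⟨y, trivial, hy⟩

theorem LocVanishAll.of_submodule (N : Submodule R M) {p : ℕ} (h : LocVanishAll b N p)
    (h' : LocVanishAll b (M ⧸ N) p) : LocVanishAll b M p :=
  locVanish_trivGrading_iff.1 ((grShortExact_trivGrading N.injective_subtype
    (by rw [Submodule.range_subtype, Submodule.ker_mkQ]) N.mkQ_surjective).locVanish_middle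
    (fun i => isHomogeneousElem_trivGrading (b i)) grSMul_trivGrading
    (locVanish_trivGrading_iff.2 h) (locVanish_trivGrading_iff.2 h'))

theorem LocVanishAll.of_surjective {N : Type*} [AddCommGroup N] [Module R N] {g : M →ₗ[R] N}
    (hg : Function.Surjective g) {p : ℕ} (h : LocVanishAll b M p)
    (h' : LocVanishAll b (LinearMap.ker g) (p + 1)) : LocVanishAll b N p :=
  locVanish_trivGrading_iff.1 ((grShortExact_trivGrading (LinearMap.ker g).injective_subtype
    (Submodule.range_subtype _) hg).locVanish_right
    (fun i => isHomogeneousElem_trivGrading (b i)) grSMul_trivGrading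
    (locVanish_trivGrading_iff.2 h) (locVanish_trivGrading_iff.2 h'))

/-- A cochain has finitely many components and each numerator meets finitely many summands, so a
finite sum of primitives found in `N` suffices. This covers infinite direct sums of copies of `N`
and also retracts. -/
theorem LocVanish.of_summands {G : Type*} [AddCommGroup G] {𝒜 : G → AddSubgroup R}
    {N : Type*} [AddCommGroup N] [Module R N] {𝒩 : G → AddSubgroup N} {ℳ : G → AddSubgroup M}
    {ι : Type*} (j : ι → N →ₗ[R] M) (q : ι → M →ₗ[R] N)
    (hj : ∀ i g, ∀ x ∈ 𝒩 g, j i x ∈ ℳ g) (hq : ∀ i g, ∀ x ∈ ℳ g, q i x ∈ 𝒩 g)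
    (hfin : ∀ m, ∃ F : Finset ι, ∀ F', F ⊆ F' → ∑ i ∈ F', j i (q i m) = m) {p : ℕ} {μ : G}
    (h : LocVanish b 𝒜 𝒩 p μ) : LocVanish b 𝒜 ℳ p μ := by
  classical
  intro x hx hμ hd
  choose y hy hyμ hyx using fun i => h (cechMap b (q i) x) (cechMap_mem_cochains b _ hx)
    (fun σ => locMap_mem_locPiece (hq i) (hμ σ)) (by rw [← cechMap_cechD, hd, map_zero])
  have hF : ∀ σ, ∃ F : Finset ι, ∀ F', F ⊆ F' →
      ∑ i ∈ F', locMap (mon b σ) (j i) (locMap (mon b σ) (q i) (x σ)) = x σ := by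
    intro σ
    induction x σ using LocalizedModule.induction_on with
    | h m t =>
      obtain ⟨F, hF⟩ := hfin m
      refine ⟨F, fun F' hFF => ?_⟩
      have h1 : ∀ i, locMap (mon b σ) (j i) (locMap (mon b σ) (q i) (LocalizedModule.mk m t)) =
          locMap (mon b σ) (j i ∘ₗ q i) (LocalizedModule.mk m t) := fun i => by
        rw [locMap_mk, locMap_mk, locMap_mk, LinearMap.comp_apply]
      simp only [h1]
      have h2 : ∑ i ∈ F', locMap (mon b σ) (j i ∘ₗ q i) (LocalizedModule.mk m t) =
          locMap (mon b σ) (∑ i ∈ F', j i ∘ₗ q i) (LocalizedModule.mk m t) := by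
        simp only [locMap, map_sum, LinearMap.sum_apply]
      rw [h2, locMap_mk, LinearMap.sum_apply]
      simp only [LinearMap.comp_apply]
      rw [hF F' hFF]
  choose F hF using hF
  refine ⟨∑ i ∈ Finset.univ.biUnion F, cechMap b (j i) (y i),
    sum_mem fun i _ => cechMap_mem_below b _ (hy i),
    sum_mem fun i _ σ => locMap_mem_locPiece (hj i) (hyμ i σ), ?_⟩
  rw [map_sum]
  funext σ
  rw [Finset.sum_apply]
  rw [← hF σ (Finset.univ.biUnion F) (Finset.subset_biUnion_of_mem F (Finset.mem_univ σ))]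
  refine Finset.sum_congr rfl fun i _ => ?_
  rw [← cechMap_cechD, hyx]
  rfl

theorem LocVanishAll.finsupp (ι : Type*) {p : ℕ} (h : LocVanishAll b M p) :
    LocVanishAll b (ι →₀ M) p := by
  classical
  refine locVanish_trivGrading_iff.1 (LocVanish.of_summands (𝒩 := trivGrading M)
    (ℳ := trivGrading (ι →₀ M)) (fun i => Finsupp.lsingle i)
    (fun i => Finsupp.lapply i) (fun _ _ _ _ => trivial) (fun _ _ _ _ => trivial) (fun m => ?_)
    (locVanish_trivGrading_iff.2 h))
  refine ⟨m.support, fun F' hF => ?_⟩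
  conv_rhs => rw [← m.sum_single]
  exact (Finset.sum_subset hF fun i _ hi => by simp [Finsupp.notMem_support_iff.1 hi]).symm

/-! ### Cohomological dimension and torsion modules -/

theorem locVanishAll_of_cd {p : ℕ} {c : ℕ} (h : cd b M ≤ ((c : ℕ∞) : WithBot ℕ∞)) (hp : c < p) :
    LocVanishAll b M p := by
  have : Subsingleton (LocCoh b M p) := by
    by_contra hn
    rw [not_subsingleton_iff_nontrivial] at hn
    have h1 : (((p : ℕ∞)) : WithBot ℕ∞) ≤ cd b M :=
      le_iSup₂ (f := fun (i : ℕ) (_ : Nontrivial (LocCoh b M i)) => ((i : ℕ∞) : WithBot ℕ∞)) p hn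
    have h2 := h1.trans h
    norm_cast at h2
    omega
  intro x hx hd
  exact (Submodule.Quotient.mk_eq_zero
    ((coboundaries b M p).submoduleOf (cocycles b M p)) (x := ⟨x, hx, hd⟩)).1
    (Subsingleton.elim _ _)

theorem natCast_le_cd {p : ℕ} {x : Cochain b M} (hx : x ∈ cochains b M p)
    (hd : cechD b M x = 0) (h : x ∉ coboundaries b M p) :
    ((p : ℕ∞) : WithBot ℕ∞) ≤ cd b M := by
  refine le_iSup₂ (f := fun (i : ℕ) (_ : Nontrivial (LocCoh b M i)) => ((i : ℕ∞) : WithBot ℕ∞)) p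
    ⟨Submodule.Quotient.mk ⟨x, hx, hd⟩, 0, fun e => h ?_⟩
  exact (Submodule.Quotient.mk_eq_zero
    ((coboundaries b M p).submoduleOf (cocycles b M p)) (x := ⟨x, hx, hd⟩)).1 e

end Ungraded

section Torsion

universe u

variable {R : Type u} [CommRing R] {s : ℕ} {b : Fin s → R} {I : Ideal R} {c : ℕ}

/-- Descending induction on `p`. A module killed by `I` is a quotient of a free `R/I`-module with
kernel killed by `I`, so `H^p(N)` lies between `H^p` of the free module and `H^{p+1}` of the kernel.
Free modules of any rank are allowed, so no finiteness is needed. -/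
theorem locVanishAll_of_killed (h : ∀ p, c < p → LocVanishAll b (R ⧸ I) p) (k : ℕ) :
    ∀ (p : ℕ), c < p → s < p + k → ∀ (N : Type u) [AddCommGroup N] [Module R N],
      (∀ r ∈ I, ∀ x : N, r • x = 0) → LocVanishAll b N p := by
  induction k with
  | zero =>
    intro p _ hp N _ _ _
    exact locVanish_trivGrading_iff.1 (locVanish_of_lt _ (by omega) ())
  | succ k ih =>
    intro p hc hp N _ _ hN
    let g : (N →₀ R ⧸ I) →ₗ[R] N := Finsupp.lsum ℕ fun x =>
      I.liftQ (LinearMap.toSpanSingleton R N x) fun r hr => hN r hr x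
    have hg : Function.Surjective g := by
      intro x
      refine ⟨Finsupp.single x (Submodule.Quotient.mk 1), ?_⟩
      rw [Finsupp.lsum_single]
      exact (Submodule.liftQ_apply _ _ _).trans (one_smul R x)
    refine LocVanishAll.of_surjective hg ((h p hc).finsupp N)
      (ih (p + 1) (by omega) (by omega) _ ?_)
    intro r hr x
    refine Subtype.ext (Finsupp.ext fun i => ?_)
    show r • (x.1 i) = 0
    obtain ⟨a, ha⟩ := Submodule.Quotient.mk_surjective _ (x.1 i)
    rw [← ha, ← Submodule.Quotient.mk_smul]
    exact (Submodule.Quotient.mk_eq_zero _).2 (I.mul_mem_right a hr)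

/-- Induction on `k`: the submodule of elements killed by `I ^ k` has quotient killed by `I`. -/
theorem locVanishAll_of_killed_pow (h : ∀ p, c < p → LocVanishAll b (R ⧸ I) p) {p : ℕ}
    (hp : c < p) (k : ℕ) : ∀ (N : Type u) [AddCommGroup N] [Module R N],
      (∀ r ∈ I ^ k, ∀ x : N, r • x = 0) → LocVanishAll b N p := by
  induction k with
  | zero =>
    intro N _ _ hN
    have : Subsingleton N := ⟨fun x y => by
      rw [← one_smul R x, ← one_smul R y, hN 1 (by simp), hN 1 (by simp)]⟩
    intro x _ _
    have : x = 0 := by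
      funext σ
      induction x σ using LocalizedModule.induction_on with
      | h m t => rw [Subsingleton.elim m 0, LocalizedModule.zero_mk]; rfl
    rw [this]
    exact zero_mem _
  | succ k ih =>
    intro N _ _ hN
    let N' : Submodule R N := Submodule.torsionBySet R N (I ^ k : Ideal R)
    refine LocVanishAll.of_submodule N' (ih N' fun r hr x => ?_)
      (locVanishAll_of_killed h (s + 1) p hp (by omega) _ fun r hr x => ?_)
    · exact Subtype.ext ((Submodule.mem_torsionBySet_iff _ _).1 x.2 ⟨r, hr⟩)
    · obtain ⟨y, rfl⟩ := Submodule.Quotient.mk_surjective _ x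
      rw [← Submodule.Quotient.mk_smul]
      refine (Submodule.Quotient.mk_eq_zero _).2 ((Submodule.mem_torsionBySet_iff _ _).2 ?_)
      rintro ⟨t, ht⟩
      show t • r • y = 0
      rw [smul_smul]
      exact hN _ (by rw [pow_succ]; exact Ideal.mul_mem_mul ht hr) y

/-- If `cd_B(R/I) ≤ c` then `H^p_B(N) = 0` for `p > c` and every `I`-power torsion module `N`. -/
theorem locVanishAll_of_torsion (h : ∀ p, c < p → LocVanishAll b (R ⧸ I) p) {p : ℕ}
    (hp : c < p) (N : Type u) [AddCommGroup N] [Module R N]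
    (hN : ∀ x : N, ∃ k, ∀ r ∈ I ^ k, r • x = 0) : LocVanishAll b N p := by
  intro x hx hd
  have hx' : ∀ σ, ∃ (m : N) (t : mon b σ), x σ = LocalizedModule.mk m t := fun σ => by
    induction x σ using LocalizedModule.induction_on with
    | h m t => exact ⟨m, t, rfl⟩
  choose m t hmt using hx'
  choose k hk using fun σ => hN (m σ)
  -- The cocycle has finitely many components, so a single power of `I` kills all numerators and the
  -- cocycle already lives over `N'`.
  let K := Finset.univ.sup k
  let N' : Submodule R N := Submodule.torsionBySet R N (I ^ K : Ideal R)
  have hm : ∀ σ, m σ ∈ N' := fun σ => (Submodule.mem_torsionBySet_iff _ _).2 fun r =>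
    hk σ r (Ideal.pow_le_pow_right (Finset.le_sup (Finset.mem_univ σ)) r.2)
  let y : Cochain b N' := fun σ => LocalizedModule.mk ⟨m σ, hm σ⟩ (t σ)
  have hy : cechMap b N'.subtype y = x := by
    funext σ
    rw [cechMap_apply, hmt σ]
    exact locMap_mk _ _ _ _
  have hinj := N'.injective_subtype
  have h1 : y ∈ cochains b N' p := fun σ hσ => locMap_injective _ hinj (by
    rw [← cechMap_apply, hy, hx σ hσ, map_zero])
  have h2 : cechD b N' y = 0 := cechMap_injective b hinj (by
    rw [cechMap_cechD, hy, hd, map_zero])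
  have h3 : LocVanishAll b N' p := locVanishAll_of_killed_pow h hp K N' fun r hr x =>
    Subtype.ext ((Submodule.mem_torsionBySet_iff _ _).1 x.2 ⟨r, hr⟩)
  obtain ⟨z, hz, e⟩ := (mem_coboundaries_iff b).1 (h3 y h1 h2)
  exact (mem_coboundaries_iff b).2 ⟨_, cechMap_mem_below b N'.subtype hz, by
    rw [← cechMap_cechD, e, hy]⟩

end Torsion

end GradedCech

namespace GradedCech

/-! ### Local cohomology in degrees zero and one, and grade -/

section Depth

variable {R : Type*} [CommRing R] {s : ℕ} {b : Fin s → R} {M : Type*} [AddCommGroup M] [Module R M]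

/-- A denominator for `insert i σ` is a power of `b i` times a denominator for `σ`; the latter is
already invertible. -/
theorem exists_pow_smul_eq_zero_of_res {σ : Finset (Fin s)} (i : Fin s)
    {y : LocalizedModule (mon b σ) M} (h : res b M (Finset.subset_insert i σ) y = 0) :
    ∃ N : ℕ, b i ^ N • y = 0 := by
  induction y using LocalizedModule.induction_on with
  | h m t =>
    rw [res_mk, ← LocalizedModule.zero_mk (⟨t.1, mon_mono b (Finset.subset_insert i σ) t.2⟩ :
      mon b (insert i σ)), LocalizedModule.mk_eq] at h
    obtain ⟨⟨u, hu⟩, h⟩ := h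
    rw [smul_zero, smul_zero, Submonoid.smul_def, Submonoid.smul_def, smul_smul] at h
    rw [mon, Finset.coe_insert, Set.image_insert_eq, ← Set.singleton_union,
      Submonoid.closure_union, Submonoid.mem_sup] at hu
    obtain ⟨c, hc, v, hv, rfl⟩ := hu
    obtain ⟨N, rfl⟩ := Submonoid.mem_closure_singleton.1 hc
    refine ⟨N, ?_⟩
    rw [LocalizedModule.smul'_mk, ← LocalizedModule.zero_mk t, LocalizedModule.mk_eq]
    refine ⟨(⟨v, hv⟩ : mon b σ) * t, ?_⟩
    simp only [smul_zero, Submonoid.smul_def, Submonoid.coe_mul, smul_smul]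
    rw [← smul_zero t.1, ← h, smul_smul]
    congr 1
    ring

/-- In the component of the coboundary at `insert i σ`, every face other than `σ` contains `i` and
contributes zero. Hence `z σ` dies once `b i` is inverted. -/
theorem exists_pow_smul_eq_zero_of_cocycle {z : Cochain b M} (hd : cechD b M z = 0) (i : Fin s)
    (hz : ∀ τ, i ∈ τ → z τ = 0) : ∃ N : ℕ, b i ^ N • z = 0 := by
  have key : ∀ σ, ∃ N : ℕ, b i ^ N • z σ = 0 := by
    intro σ
    by_cases hi : i ∈ σ
    · exact ⟨0, by rw [hz σ hi, smul_zero]⟩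
    · refine exists_pow_smul_eq_zero_of_res i ?_
      have h := congrFun hd (insert i σ)
      rw [cechD_apply, Fintype.sum_eq_single ⟨i, Finset.mem_insert_self i σ⟩] at h
      · rw [res_congr b M z (Finset.erase_insert hi) _ (Finset.subset_insert i σ)] at h
        have h' : ∀ x : LocalizedModule (mon b (insert i σ)) M,
            sgn R (insert i σ) i • x = 0 → x = 0 := by
          intro x hx
          unfold sgn at hx
          rcases neg_one_pow_eq_or R ((insert i σ).filter (· < i)).card with e | e <;>
            rw [e] at hx <;> simpa using hx
        exact h' _ h
      · intro k hk
        rw [hz, map_zero, smul_zero]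
        refine Finset.mem_erase.2 ⟨fun e => hk (Subtype.ext e.symm), Finset.mem_insert_self i σ⟩
  choose N hN using key
  refine ⟨Finset.univ.sup N, funext fun σ => ?_⟩
  obtain ⟨k, hk⟩ := Nat.exists_eq_add_of_le (Finset.le_sup (f := N) (Finset.mem_univ σ))
  show b i ^ _ • z σ = 0
  rw [hk, add_comm, pow_add, mul_smul, hN, smul_zero]

theorem exists_pow_smul_eq_mk (i : Fin s) (y : LocalizedModule (mon b {i}) M) :
    ∃ (N : ℕ) (m : M), b i ^ N • y =
      res b M (Finset.empty_subset {i}) (LocalizedModule.mk m 1) := by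
  induction y using LocalizedModule.induction_on with
  | h m t =>
    have ht : t.1 ∈ Submonoid.closure (b '' (({i} : Finset (Fin s)) : Set (Fin s))) := t.2
    rw [Finset.coe_singleton, Set.image_singleton, Submonoid.mem_closure_singleton] at ht
    obtain ⟨N, hN⟩ := ht
    refine ⟨N, m, ?_⟩
    rw [res_mk, LocalizedModule.smul'_mk, hN, ← Submonoid.smul_def, LocalizedModule.mk_cancel]
    rfl

theorem exists_pow_smul_mem_coboundaries {p : ℕ} (hp : p ≤ 1) {x : Cochain b M}
    (hx : x ∈ cochains b M p) (hd : cechD b M x = 0) (i : Fin s) :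
    ∃ N : ℕ, b i ^ N • x ∈ coboundaries b M p := by
  rcases Nat.le_one_iff_eq_zero_or_eq_one.1 hp with rfl | rfl
  · obtain ⟨N, hN⟩ := exists_pow_smul_eq_zero_of_cocycle hd i fun τ hτ =>
      hx τ (Finset.card_pos.2 ⟨i, hτ⟩).ne'
    exact ⟨N, by rw [hN]; exact zero_mem _⟩
  · obtain ⟨N, m, hm⟩ := exists_pow_smul_eq_mk i (x {i})
    -- After multiplication by `b i ^ N` the component at `{i}` comes from `m : M`. Subtracting the
    -- coboundary of `m` makes the cocycle vanish on all sets containing `i`.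
    let y : Cochain b M := Pi.single ∅ (LocalizedModule.mk m 1)
    have hy : y ∈ cochains b M 0 := fun σ hσ =>
      Pi.single_eq_of_ne (by rintro rfl; exact hσ Finset.card_empty) _
    have hz : b i ^ N • x - cechD b M y ∈ cochains b M 1 :=
      sub_mem (Submodule.smul_mem _ _ hx) (cechD_mem_cochains b M hy)
    obtain ⟨N', hN'⟩ := exists_pow_smul_eq_zero_of_cocycle (b := b) (i := i)
      (z := b i ^ N • x - cechD b M y)
      (by rw [map_sub, map_smul, hd, smul_zero, cechD_cechD, sub_zero]) (by
        intro τ hτ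
        by_cases hc : τ.card = 1
        · obtain ⟨j, rfl⟩ := Finset.card_eq_one.1 hc
          obtain rfl := Finset.mem_singleton.1 hτ
          show b i ^ N • x {i} - cechD b M y {i} = 0
          rw [hm, cechD_apply, Fintype.sum_eq_single ⟨i, hτ⟩
            (fun k hk => absurd (Subtype.ext (Finset.mem_singleton.1 k.2)) hk),
            res_congr b M y (show ({i} : Finset (Fin s)).erase i = ∅ by simp) _
              (Finset.empty_subset _)]
          have h1 : sgn R ({i} : Finset (Fin s)) i = 1 := by
            unfold sgn
            rw [Finset.filter_singleton, if_neg (lt_irrefl i), Finset.card_empty, pow_zero]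
          rw [h1, one_smul, sub_eq_zero]
          exact congrArg _ (Pi.single_eq_same (M := fun σ => LocalizedModule (mon b σ) M) ∅ _).symm
        · exact hz τ hc)
    refine ⟨N' + N, b i ^ N' • y, Submodule.smul_mem _ _ hy, ?_⟩
    rw [smul_sub, sub_eq_zero, smul_smul, ← pow_add] at hN'
    rw [map_smul, hN']

/-- The radical of the annihilator of the class of `x` contains every `b i`, hence the ideal they
generate. -/
theorem exists_pow_smul_mem_coboundaries_of_mem {p : ℕ} (hp : p ≤ 1) {x : Cochain b M}
    (hx : x ∈ cochains b M p) (hd : cechD b M x = 0) {r : R} (hr : r ∈ Ideal.span (Set.range b)) :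
    ∃ N : ℕ, r ^ N • x ∈ coboundaries b M p := by
  let J : Ideal R := (coboundaries b M p).comap (LinearMap.toSpanSingleton R _ x)
  have hJ : Ideal.span (Set.range b) ≤ J.radical := by
    refine Ideal.span_le.2 ?_
    rintro _ ⟨i, rfl⟩
    exact exists_pow_smul_mem_coboundaries hp hx hd i
  exact hJ hr

/-! ### Regular elements cancel on cochains; vanishing from grade -/

theorem isSMulRegular_cochain {r : R} (hr : IsSMulRegular M r) :
    IsSMulRegular (Cochain b M) r := by
  intro x y h
  funext σ
  have h' : locMap (mon b σ) (LinearMap.lsmul R M r) (x σ) =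
      locMap (mon b σ) (LinearMap.lsmul R M r) (y σ) := by
    have : ∀ z : LocalizedModule (mon b σ) M,
        locMap (mon b σ) (LinearMap.lsmul R M r) z = r • z := by
      intro z
      induction z using LocalizedModule.induction_on with
      | h m t =>
        rw [locMap_mk, LocalizedModule.smul'_mk]
        rfl
    rw [this, this]
    exact congrFun h σ
  exact locMap_injective _ (g := LinearMap.lsmul R M r) hr h'

theorem locVanishAll_zero {r : R} (hr : r ∈ Ideal.span (Set.range b)) (hreg : IsSMulRegular M r) :
    LocVanishAll b M 0 := by
  intro x hx hd
  obtain ⟨N, hN⟩ := exists_pow_smul_mem_coboundaries_of_mem (by omega) hx hd hr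
  rw [coboundaries, Submodule.mem_bot] at hN ⊢
  exact (isSMulRegular_cochain (hreg.pow N)).right_eq_zero_of_smul hN

/-- If `r • x` is the coboundary of `y`, then `y` is a degree zero cocycle modulo `r`, so zero there
because `r'` is regular on the quotient. Thus `y = r • z`, and cancelling `r` makes `x` the
coboundary of `z`. Some `r ^ N • x` is a coboundary, and its factors `r` are removed one by one. -/
theorem locVanishAll_one {r r' : R} (hr : r ∈ Ideal.span (Set.range b))
    (hr' : r' ∈ Ideal.span (Set.range b)) (hreg : IsSMulRegular M r)
    (hreg' : IsSMulRegular (QuotSMulTop r M) r') : LocVanishAll b M 1 := by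
  have h0 := locVanishAll_zero hr' hreg'
  have hses : GrShortExact (trivGrading M) (trivGrading M) (trivGrading (QuotSMulTop r M))
      (LinearMap.lsmul R M r) (Submodule.mkQ _) := by
    refine grShortExact_trivGrading hreg ?_ (Submodule.mkQ_surjective _)
    rw [Submodule.ker_mkQ]
    ext x
    simp [Submodule.mem_smul_pointwise_iff_exists]
  have hmap : ∀ z : Cochain b M, cechMap b (LinearMap.lsmul R M r) z = r • z := by
    intro z
    funext σ
    rw [cechMap_apply]
    show _ = r • z σ
    induction z σ using LocalizedModule.induction_on with
    | h m t =>
      rw [locMap_mk, LocalizedModule.smul'_mk]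
      rfl
  have step : ∀ x ∈ cochains b M 1, r • x ∈ coboundaries b M 1 → x ∈ coboundaries b M 1 := by
    rintro x - ⟨y, hy, hyx⟩
    have h1 := h0 (cechMap b (Submodule.mkQ _) y) (cechMap_mem_cochains b _ hy) (by
      rw [← cechMap_cechD, hyx, ← hmap, hses.map_map_eq_zero])
    rw [coboundaries, Submodule.mem_bot] at h1
    obtain ⟨z, -, hz, hz', -⟩ := hses.descend (fun i => isHomogeneousElem_trivGrading (b i))
      grSMul_trivGrading (mem_cochainPiece_trivGrading y) h1
    refine ⟨z, hz' 0 hy, isSMulRegular_cochain hreg ?_⟩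
    show r • cechD b M z = r • x
    rw [← map_smul, ← hmap, hz, hyx]
  intro x hx hd
  obtain ⟨N, hN⟩ := exists_pow_smul_mem_coboundaries_of_mem le_rfl hx hd hr
  induction N with
  | zero => rwa [pow_zero, one_smul] at hN
  | succ N ih =>
    rw [pow_succ', mul_smul] at hN
    exact ih (step _ (Submodule.smul_mem _ _ hx) hN)

theorem exists_isWeaklyRegular_of_le_grade {J : Ideal R} {k : ℕ} (h : (k : ℕ∞) ≤ grade J) :
    ∃ rs : List R, (∀ r ∈ rs, r ∈ J) ∧ RingTheory.Sequence.IsWeaklyRegular R rs ∧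
      k ≤ rs.length := by
  by_contra! hcon
  cases k with
  | zero =>
    exact (Nat.not_lt_zero _ (hcon [] (by simp) (RingTheory.Sequence.IsWeaklyRegular.nil R R))).elim
  | succ k =>
    have : grade J ≤ (k : ℕ∞) := iSup₂_le fun rs hrs => by
      exact_mod_cast Nat.lt_succ_iff.1 (hcon rs hrs.1 hrs.2)
    have h2 := h.trans this
    norm_cast at h2
    omega

theorem locVanishAll_of_two_le_grade (h : 2 ≤ grade (Ideal.span (Set.range b))) {p : ℕ}
    (hp : p ≤ 1) : LocVanishAll b R p := by
  obtain ⟨rs, hmem, hreg, hlen⟩ := exists_isWeaklyRegular_of_le_grade (k := 2) (by exact_mod_cast h)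
  match rs, hlen with
  | r :: r' :: l, _ =>
    rw [RingTheory.Sequence.isWeaklyRegular_cons_iff,
      RingTheory.Sequence.isWeaklyRegular_cons_iff] at hreg
    rcases Nat.le_one_iff_eq_zero_or_eq_one.1 hp with rfl | rfl
    · exact locVanishAll_zero (hmem r (by simp)) hreg.1
    · exact locVanishAll_one (hmem r (by simp)) (hmem r' (by simp)) hreg.1 hreg.2.1

end Depth

end GradedCech

namespace GradedCech

/-! ### Koszul complexes with coefficients -/

section Kos

variable {A : Type*} [CommRing A] {n : ℕ} {M : Type*} [AddCommGroup M] [Module A M]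

theorem sgn_mul_self (σ : Finset (Fin n)) (i : Fin n) : sgn A σ i * sgn A σ i = 1 := by
  unfold sgn
  rcases neg_one_pow_eq_or A (σ.filter (· < i)).card with e | e <;> rw [e] <;> simp

theorem sgn_insert_self (σ : Finset (Fin n)) (i : Fin n) :
    sgn A (insert i σ) i = sgn A σ i := by
  unfold sgn
  rw [Finset.filter_insert, if_neg (lt_irrefl i)]

theorem sgn_erase_self (σ : Finset (Fin n)) (i : Fin n) :
    sgn A (σ.erase i) i = sgn A σ i := by
  by_cases h : i ∈ σ
  · rw [← sgn_insert_self (σ.erase i), Finset.insert_erase h]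
  · rw [Finset.erase_eq_of_notMem h]

/-- The Koszul differential of `a` with coefficients in a module. -/
def kos (a : Fin n → A) : (Finset (Fin n) → M) →ₗ[A] (Finset (Fin n) → M) where
  toFun x σ := ∑ i ∈ σᶜ, (sgn A σ i * a i) • x (insert i σ)
  map_add' x y := by
    funext σ
    simp [Finset.sum_add_distrib]
  map_smul' r x := by
    funext σ
    simp only [Pi.smul_apply, RingHom.id_apply, Finset.smul_sum]
    exact Finset.sum_congr rfl fun i _ => smul_comm _ _ _

theorem kos_apply (a : Fin n → A) (x : Finset (Fin n) → M) (σ : Finset (Fin n)) :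
    kos a x σ = ∑ i ∈ σᶜ, (sgn A σ i * a i) • x (insert i σ) := rfl

theorem koszulD_eq_kos (a : Fin n → A) : koszulD a = kos a (M := A) := rfl

theorem koszulD_apply (a : Fin n → A) (x : Finset (Fin n) → A) (σ : Finset (Fin n)) :
    koszulD a x σ = ∑ i ∈ σᶜ, sgn A σ i * a i * x (insert i σ) := rfl

theorem kos_kos (a : Fin n → A) (x : Finset (Fin n) → M) : kos a (kos a x) = 0 := by
  funext σ
  simp only [kos_apply, Pi.zero_apply, Finset.smul_sum]
  rw [Finset.sum_sigma']
  refine Finset.sum_involution (fun p _ => ⟨p.2, p.1⟩) ?_ ?_ ?_ ?_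
  · rintro ⟨i, j⟩ h
    simp only [Finset.mem_sigma, Finset.mem_compl, Finset.mem_insert, not_or] at h
    obtain ⟨hi, hji, hj⟩ := h
    have h1 := sgn_insert_swap (A := A) σ hi hj (fun e => hji e.symm)
    dsimp only
    rw [Finset.insert_comm j i, smul_smul, smul_smul, ← add_smul]
    convert zero_smul A _
    linear_combination (a i * a j) * h1
  · rintro ⟨i, j⟩ h - e
    simp only [Finset.mem_sigma, Finset.mem_compl, Finset.mem_insert, not_or] at h
    simp only [Sigma.mk.injEq] at e
    exact h.2.1 e.1
  · rintro ⟨i, j⟩ h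
    simp only [Finset.mem_sigma, Finset.mem_compl, Finset.mem_insert, not_or] at h ⊢
    exact ⟨h.2.2, fun e => h.2.1 e.symm, h.1⟩
  · intros; rfl

variable (A) in
/-- Exterior multiplication by the basis element `e_i`. -/
def wedge (i : Fin n) : (Finset (Fin n) → M) →ₗ[A] (Finset (Fin n) → M) where
  toFun x σ := if i ∈ σ then sgn A σ i • x (σ.erase i) else 0
  map_add' x y := by
    funext σ
    by_cases h : i ∈ σ <;> simp [h]
  map_smul' r x := by
    funext σ
    by_cases h : i ∈ σ <;> simp [h, smul_comm r]

theorem wedge_apply (i : Fin n) (x : Finset (Fin n) → M) (σ : Finset (Fin n)) :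
    wedge A i x σ = if i ∈ σ then sgn A σ i • x (σ.erase i) else 0 := rfl

/-- Exterior multiplication by `e_i` is a homotopy from multiplication by `a i` to zero, so Koszul
homology is killed by every `a i`. -/
theorem kos_wedge (a : Fin n → A) (i : Fin n) (x : Finset (Fin n) → M) :
    kos a (wedge A i x) + wedge A i (kos a x) = a i • x := by
  funext σ
  simp only [Pi.add_apply, Pi.smul_apply]
  rw [kos_apply, wedge_apply]
  split_ifs with hi
  · rw [kos_apply, Finset.compl_erase, Finset.sum_insert (by simpa using hi),
      Finset.insert_erase hi, smul_add, smul_smul, sgn_erase_self, ← mul_assoc, sgn_mul_self,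
      one_mul, add_left_comm, Finset.smul_sum, ← Finset.sum_add_distrib, Finset.sum_eq_zero,
      add_zero]
    intro j hj
    have hj' : j ∉ σ := Finset.mem_compl.1 hj
    have hij : i ≠ j := fun e => hj' (e ▸ hi)
    rw [wedge_apply, if_pos (Finset.mem_insert_of_mem hi), smul_smul, smul_smul,
      Finset.erase_insert_of_ne (Ne.symm hij), ← add_smul]
    convert zero_smul A _
    have h1 := sgn_erase_swap A (insert j σ) (i := i) (j := j)
      (Finset.mem_insert_of_mem hi) (Finset.mem_insert_self j σ) hij
    rw [Finset.erase_insert_of_ne (Ne.symm hij), sgn_insert_self, sgn_insert_self,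
      Finset.erase_insert hj'] at h1
    have h2 := sgn_mul_self (A := A) (σ.erase i) j
    have h3 := sgn_mul_self (A := A) σ j
    linear_combination a j * sgn A σ j * sgn A (σ.erase i) j * h1
      - a j * sgn A σ j * sgn A (insert j σ) i * h2
      - a j * sgn A (σ.erase i) j * sgn A σ i * h3
  · rw [add_zero, Finset.sum_eq_single i]
    · rw [wedge_apply, if_pos (Finset.mem_insert_self i σ), Finset.erase_insert hi, smul_smul,
        sgn_insert_self, mul_right_comm, sgn_mul_self, one_mul]
    · intro j _ hji
      rw [wedge_apply, if_neg, smul_zero]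
      rw [Finset.mem_insert, not_or]
      exact ⟨Ne.symm hji, hi⟩
    · intro h
      exact absurd (Finset.mem_compl.2 hi) h

variable (A M) in
/-- The Koszul chains of degree `l` supported on the subsets of `S`. -/
def kosPart (S : Finset (Fin n)) (l : ℕ) : Submodule A (Finset (Fin n) → M) where
  carrier := {x | ∀ σ, ¬(σ ⊆ S ∧ σ.card = l) → x σ = 0}
  add_mem' hx hy σ h := by simp [hx σ h, hy σ h]
  zero_mem' _ _ := rfl
  smul_mem' r x hx σ h := by simp [hx σ h]

theorem kosPart_univ (l : ℕ) : kosPart A A (Finset.univ : Finset (Fin n)) l = koszulChains A n l := by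
  ext x
  exact forall_congr' fun σ => by simp

theorem kosPart_mono {S S' : Finset (Fin n)} (h : S ⊆ S') (l : ℕ) :
    kosPart A M S l ≤ kosPart A M S' l :=
  fun _ hx σ hσ => hx σ fun h' => hσ ⟨h'.1.trans h, h'.2⟩

theorem kosPart_eq_zero {S : Finset (Fin n)} {l : ℕ} (h : S.card < l) {x : Finset (Fin n) → M}
    (hx : x ∈ kosPart A M S l) : x = 0 := by
  funext σ
  refine hx σ fun h' => ?_
  have := Finset.card_le_card h'.1
  omega

theorem kos_mem (a : Fin n → A) {S : Finset (Fin n)} {l : ℕ} {x : Finset (Fin n) → M}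
    (hx : x ∈ kosPart A M S (l + 1)) : kos a x ∈ kosPart A M S l := by
  intro σ hσ
  refine Finset.sum_eq_zero fun i hi => ?_
  rw [hx (insert i σ), smul_zero]
  rintro ⟨h1, h2⟩
  rw [Finset.card_insert_of_notMem (Finset.mem_compl.1 hi)] at h2
  exact hσ ⟨(Finset.subset_insert i σ).trans h1, by omega⟩

theorem wedge_mem {S : Finset (Fin n)} {i : Fin n} (hi : i ∈ S) {l : ℕ} {x : Finset (Fin n) → M}
    (hx : x ∈ kosPart A M S l) : wedge A i x ∈ kosPart A M S (l + 1) := by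
  intro σ hσ
  rw [wedge_apply]
  split_ifs with h
  · rw [hx, smul_zero]
    rintro ⟨h1, h2⟩
    have := Finset.card_erase_add_one h
    refine hσ ⟨?_, by omega⟩
    rw [← Finset.insert_erase h]
    exact Finset.insert_subset hi h1
  · rfl

theorem kos_eq_zero_of_zero (a : Fin n → A) {S : Finset (Fin n)} {x : Finset (Fin n) → M}
    (hx : x ∈ kosPart A M S 0) : kos a x = 0 := by
  funext σ
  refine Finset.sum_eq_zero fun i _ => ?_
  rw [hx (insert i σ), smul_zero]
  rintro ⟨-, h2⟩
  exact absurd h2 (Finset.card_pos.2 ⟨i, Finset.mem_insert_self i σ⟩).ne'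

theorem koszulD_wedge (a : Fin n → A) (i : Fin n) (x : Finset (Fin n) → A) :
    koszulD a (wedge A i x) + wedge A i (koszulD a x) = a i • x := by
  rw [koszulD_eq_kos, kos_wedge]

theorem koszulD_mem (a : Fin n → A) {S : Finset (Fin n)} {l : ℕ} {x : Finset (Fin n) → A}
    (hx : x ∈ kosPart A A S (l + 1)) : koszulD a x ∈ kosPart A A S l := by
  rw [koszulD_eq_kos]
  exact kos_mem a hx

theorem exists_sum_of_mem_span_image {A : Type*} [CommRing A] {n : ℕ} {a : Fin n → A}
    {S : Finset (Fin n)} {r : A} (h : r ∈ Ideal.span (a '' S)) :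
    ∃ c : Fin n → A, ∑ i ∈ S, c i * a i = r := by
  obtain ⟨c, hc⟩ := (Submodule.mem_span_image_finset_iff_exists_fun A).1 h
  refine ⟨fun i => if hi : i ∈ S then c ⟨i, hi⟩ else 0, ?_⟩
  rw [← hc, ← Finset.sum_coe_sort S]
  exact Finset.sum_congr rfl fun i _ => by simp

/-- A regular sequence of length `g` in the ideal generated by the `a i`, `i ∈ S`, makes the
Koszul homology vanish in degrees `l > #S - g`. -/
theorem exists_kos_eq_of_isWeaklyRegular {A : Type*} [CommRing A] {n : ℕ} (a : Fin n → A)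
    (S : Finset (Fin n)) (rs : List A) :
    ∀ {M : Type*} [AddCommGroup M] [Module A M], RingTheory.Sequence.IsWeaklyRegular M rs →
      (∀ r ∈ rs, r ∈ Ideal.span (a '' S)) → ∀ {l : ℕ}, S.card < l + rs.length →
      ∀ x ∈ kosPart A M S l, kos a x = 0 → ∃ y ∈ kosPart A M S (l + 1), kos a y = x := by
  induction rs with
  | nil =>
    intro M _ _ _ _ l hl x hx _
    exact ⟨0, zero_mem _, by rw [map_zero, kosPart_eq_zero hl hx]⟩
  | cons r rs ih =>
    intro M _ _ hreg hmem l hl x hx hd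
    rw [RingTheory.Sequence.isWeaklyRegular_cons_iff] at hreg
    obtain ⟨hr, hreg⟩ := hreg
    obtain ⟨c, hc⟩ := exists_sum_of_mem_span_image (hmem r (by simp))
    -- As `r = ∑ c i * a i`, the chain `w` is a primitive of `r • x`. Modulo `r` it is a cycle one
    -- degree higher, to which the shorter sequence applies.
    set w := ∑ i ∈ S, c i • wedge A i x with hw
    have hwmem : w ∈ kosPart A M S (l + 1) :=
      sum_mem fun i hi => Submodule.smul_mem _ _ (wedge_mem hi hx)
    have hdw : kos a w = r • x := by
      rw [hw, map_sum, ← hc, Finset.sum_smul]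
      refine Finset.sum_congr rfl fun i _ => ?_
      have := kos_wedge a i x
      rw [hd, map_zero, add_zero] at this
      rw [map_smul, this, smul_smul]
    let π : M →ₗ[A] QuotSMulTop r M := Submodule.mkQ _
    have hπ : ∀ z : Finset (Fin n) → M, kos a (fun σ => π (z σ)) = fun σ => π (kos a z σ) := by
      intro z
      funext σ
      simp only [kos_apply, map_sum, map_smul]
    have hker : ∀ m, π m = 0 ↔ ∃ u, r • u = m := by
      intro m
      simp [π, Submodule.mem_smul_pointwise_iff_exists]
    obtain ⟨v, hv, hvw⟩ := ih hreg (fun t ht => hmem t (by simp [ht])) (l := l + 1)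
      (by rw [List.length_cons] at hl; omega) (fun σ => π (w σ))
      (fun σ hσ => (congrArg π (hwmem σ hσ)).trans (map_zero π)) (by
        rw [hπ, hdw]
        funext σ
        exact (hker _).2 ⟨x σ, rfl⟩)
    classical
    have hπs : Function.Surjective π := Submodule.mkQ_surjective _
    choose v' hv' using fun σ => hπs (v σ)
    let V : Finset (Fin n) → M := fun σ => if v σ = 0 then 0 else v' σ
    have hV : V ∈ kosPart A M S (l + 2) := fun σ hσ => if_pos (hv σ hσ)
    have hπV : ∀ σ, π (V σ) = v σ := by
      intro σ
      by_cases h0 : v σ = 0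
      · rw [show V σ = 0 from if_pos h0, map_zero, h0]
      · rw [show V σ = v' σ from if_neg h0]
        exact hv' σ
    have hdiff : ∀ σ, ∃ u, r • u = w σ - kos a V σ := by
      intro σ
      rw [← hker, map_sub, sub_eq_zero, ← congrFun hvw σ, ← congrFun (hπ V) σ]
      simp only [hπV]
    -- The difference `w - kos a V` is divisible by `r`, and its quotient `u` satisfies `r • kos a u
    -- = r • x`; regularity of `r` finishes.
    choose u hu using hdiff
    have humem : u ∈ kosPart A M S (l + 1) := by
      intro σ hσ
      refine hr.right_eq_zero_of_smul ?_
      rw [hu, hwmem σ hσ, kos_mem a hV σ hσ, sub_zero]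
    refine ⟨u, humem, ?_⟩
    have hru : r • u = w - kos a V := funext hu
    have : r • kos a u = r • x := by
      rw [← map_smul, hru, map_sub, kos_kos, sub_zero, hdw]
    funext σ
    exact hr (congrFun this σ)

end Kos

end GradedCech

namespace GradedCech

open MvPolynomial

/-! ### Exactness of approximation complexes -/

section Exactness

variable {A : Type*} [CommRing A] {n : ℕ}

/-- The Koszul differential of `f` over the polynomial ring. -/
noncomputable abbrev fD (f : Fin n → A) :
    (Finset (Fin n) → MvPolynomial (Fin n) A) →ₗ[MvPolynomial (Fin n) A]
      (Finset (Fin n) → MvPolynomial (Fin n) A) :=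
  koszulD fun i => C (f i)

/-- The cycles of `f` of degree `l` supported on `S`. -/
noncomputable def partCycles (f : Fin n → A) (S : Finset (Fin n)) (l : ℕ) :
    Submodule (MvPolynomial (Fin n) A) (Finset (Fin n) → MvPolynomial (Fin n) A) :=
  kosPart _ _ S l ⊓ LinearMap.ker (fD f)

theorem partCycles_univ (f : Fin n → A) (l : ℕ) : partCycles f Finset.univ l = zMod f l := by
  rw [partCycles, kosPart_univ]
  rfl

theorem fD_eq_zero {f : Fin n → A} {S : Finset (Fin n)} {l : ℕ}
    {x : Finset (Fin n) → MvPolynomial (Fin n) A} (hx : x ∈ partCycles f S l) : fD f x = 0 := hx.2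

/-- Exactness in positive degrees of the part of the approximation complex supported on `S`. -/
def PartExact (f : Fin n → A) (S : Finset (Fin n)) : Prop :=
  ∀ l, ∀ z ∈ partCycles f S (l + 1), zD A n z = 0 → ∃ y ∈ partCycles f S (l + 2), zD A n y = z

/-! #### Coefficientwise operations -/

theorem map_sgn_mul {B : Type*} [CommRing B] (q : A →+ B) (σ : Finset (Fin n)) (i : Fin n)
    (p : A) : q (sgn A σ i * p) = sgn B σ i * q p := by
  unfold sgn
  rcases Nat.even_or_odd (σ.filter (· < i)).card with e | e
  · rw [e.neg_one_pow, e.neg_one_pow, one_mul, one_mul]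
  · rw [e.neg_one_pow, e.neg_one_pow, neg_one_mul, neg_one_mul, map_neg]

/-- Two maps `q`, `q'` are allowed because multiplication by `a i` may shift degrees, as for
homogeneous components in the variables or projections to graded pieces. -/
theorem koszulD_map {B : Type*} [CommRing B] (q q' : A →+ B) {a : Fin n → A} {a' : Fin n → B}
    {x : Finset (Fin n) → A} (h : ∀ σ : Finset (Fin n), ∀ i ∉ σ,
      q' (a i * x (insert i σ)) = a' i * q (x (insert i σ))) :
    koszulD a' (fun σ => q (x σ)) = fun σ => q' (koszulD a x σ) := by
  funext σ
  rw [koszulD_apply, koszulD_apply, map_sum]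
  refine Finset.sum_congr rfl fun i hi => ?_
  rw [mul_assoc, mul_assoc, map_sgn_mul, h σ i (Finset.mem_compl.1 hi)]

theorem fD_map (f : Fin n → A) (q : MvPolynomial (Fin n) A →ₗ[A] MvPolynomial (Fin n) A)
    (x : Finset (Fin n) → MvPolynomial (Fin n) A) :
    fD f (fun σ => q (x σ)) = fun σ => q (fD f x σ) :=
  koszulD_map q.toAddMonoidHom q.toAddMonoidHom fun σ i _ => by
    show q (C (f i) * _) = C (f i) * q _
    rw [← smul_eq_C_mul, ← smul_eq_C_mul, map_smul]

theorem map_mem_kosPart {S : Finset (Fin n)} {l : ℕ}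
    (q : MvPolynomial (Fin n) A →ₗ[A] MvPolynomial (Fin n) A)
    {x : Finset (Fin n) → MvPolynomial (Fin n) A} (hx : x ∈ kosPart (MvPolynomial (Fin n) A) (MvPolynomial (Fin n) A) S l) :
    (fun σ => q (x σ)) ∈ kosPart (MvPolynomial (Fin n) A) (MvPolynomial (Fin n) A) S l :=
  fun σ hσ => (congrArg q (hx σ hσ)).trans (map_zero q)

/-! #### Redundant generators -/

/-- Division by the monomial `X c`, conjugated by the automorphism `X c ↦ X c + L`, which carries `X
c - L` to `X c` and fixes the other variables. -/
theorem exists_division (c : Fin n) (L : MvPolynomial (Fin n) A) {S : Finset (Fin n)} (hc : c ∉ S)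
    {r : Fin n → A} (hL : L = ∑ i ∈ S, C (r i) * X i) :
    ∃ q : MvPolynomial (Fin n) A →ₗ[A] MvPolynomial (Fin n) A,
      (∀ i ≠ c, ∀ p, q (X i * p) = X i * q p) ∧ ∀ p, q ((X c - L) * p) = p := by
  classical
  let d : MvPolynomial (Fin n) A →ₗ[A] MvPolynomial (Fin n) A :=
    { toFun := fun p => p.divMonomial (Finsupp.single c 1)
      map_add' := fun p p' => add_divMonomial _ _ _
      map_smul' := fun a p => by
        ext m
        simp [coeff_divMonomial] }
  have hd1 : ∀ i ≠ c, ∀ p, d (X i * p) = X i * d p := by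
    intro i hi p
    ext m
    show coeff m ((X i * p).divMonomial _) = coeff m (X i * p.divMonomial _)
    rw [coeff_divMonomial, coeff_X_mul', coeff_X_mul']
    have h1 : i ∈ (Finsupp.single c 1 + m).support ↔ i ∈ m.support := by
      simp [Ne.symm hi]
    by_cases h : i ∈ m.support
    · rw [if_pos h, if_pos (h1.2 h), coeff_divMonomial]
      congr 1
      rw [add_tsub_assoc_of_le]
      rw [Finsupp.single_le_iff]
      exact Nat.one_le_iff_ne_zero.2 (Finsupp.mem_support_iff.1 h)
    · rw [if_neg h, if_neg (mt h1.1 h)]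
  have hd2 : ∀ p, d (X c * p) = p := fun p => X_mul_divMonomial c p
  let α : MvPolynomial (Fin n) A →ₐ[A] MvPolynomial (Fin n) A :=
    aeval fun j => if j = c then X c + L else X j
  let β : MvPolynomial (Fin n) A →ₐ[A] MvPolynomial (Fin n) A :=
    aeval fun j => if j = c then X c - L else X j
  have hα : ∀ i ≠ c, α (X i) = X i := fun i hi => by simp [α, hi]
  have hβ : ∀ i ≠ c, β (X i) = X i := fun i hi => by simp [β, hi]
  have hne : ∀ i ∈ S, i ≠ c := fun i hi e => hc (e ▸ hi)
  have hαL : α L = L := by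
    rw [hL, map_sum]
    exact Finset.sum_congr rfl fun i hi => by
      rw [map_mul, hα i (hne i hi)]
      simp [α]
  have hβL : β L = L := by
    rw [hL, map_sum]
    exact Finset.sum_congr rfl fun i hi => by
      rw [map_mul, hβ i (hne i hi)]
      simp [β]
  have hβα : ∀ p, β (α p) = p := by
    intro p
    have : β.comp α = AlgHom.id A _ := by
      refine MvPolynomial.algHom_ext fun j => ?_
      by_cases hj : j = c
      · subst hj
        have : α (X j) = X j + L := by simp [α]
        rw [AlgHom.comp_apply, this, map_add, hβL]
        simp [β]
      · rw [AlgHom.comp_apply, hα j hj, hβ j hj]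
        rfl
    exact congrArg (fun φ : MvPolynomial (Fin n) A →ₐ[A] MvPolynomial (Fin n) A => φ p) this
  refine ⟨β.toLinearMap ∘ₗ d ∘ₗ α.toLinearMap, fun i hi p => ?_, fun p => ?_⟩
  · show β (d (α (X i * p))) = X i * β (d (α p))
    rw [map_mul, hα i hi, hd1 i hi, map_mul, hβ i hi]
  · show β (d (α ((X c - L) * p))) = p
    have : α (X c - L) = X c := by
      rw [map_sub, hαL]
      simp [α]
    rw [map_mul, this, hd2, hβα]

/-- If `f c = ∑ r i * f i`, the vector `e = e_c - ∑ r i e_i` is sent to zero by the differential of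
`f`. So the cycles on `insert c S` are `Z(S) ⊕ e ∧ Z(S)`, and the enlarged complex is the cone of
multiplication by `T = X c - ∑ r i X i` on `Z(S)`. Division by `T` shows that `T` acts injectively
on the homology of `Z(S)`, so the cone is exact in positive degrees. -/
theorem PartExact.insert {f : Fin n → A} {S : Finset (Fin n)} (h : PartExact f S) {c : Fin n}
    (hc : c ∉ S) (hfc : f c ∈ Ideal.span (f '' S)) : PartExact f (insert c S) := by
  obtain ⟨r, hr⟩ := exists_sum_of_mem_span_image hfc
  set P := MvPolynomial (Fin n) A with hP
  obtain ⟨q, hq1, hq2⟩ := exists_division (A := A) c (∑ i ∈ S, C (r i) * X i) hc rfl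
  set T : P := X c - ∑ i ∈ S, C (r i) * X i with hT
  -- Exterior multiplication by `e_c - ∑ r i e_i`.
  let θ : (Finset (Fin n) → P) →ₗ[P] (Finset (Fin n) → P) :=
    wedge P c - ∑ i ∈ S, (C (r i) : P) • wedge P i
  have hθ : ∀ (a : Fin n → P) (x : Finset (Fin n) → P), koszulD a (θ x) + θ (koszulD a x) =
      (a c - ∑ i ∈ S, C (r i) * a i) • x := by
    intro a x
    have e : ∀ x, θ x = wedge P c x - ∑ i ∈ S, (C (r i) : P) • wedge P i x := by
      intro x
      simp [θ, LinearMap.sum_apply]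
    rw [e, e, map_sub, map_sum, sub_add_sub_comm, koszulD_wedge,
      ← Finset.sum_add_distrib, sub_smul, Finset.sum_smul]
    congr 1
    refine Finset.sum_congr rfl fun i _ => ?_
    rw [map_smul, ← smul_add, koszulD_wedge, smul_smul]
  have hθf : ∀ x, fD f x = 0 → fD f (θ x) = 0 := by
    intro x hx
    have h1 := hθ (fun i => C (f i)) x
    have h2 : (C (f c) : P) - ∑ i ∈ S, C (r i) * C (f i) = 0 := by
      rw [← hr]
      simp
    rw [h2, zero_smul] at h1
    have h3 : koszulD (fun i => (C (f i) : P)) x = 0 := hx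
    rwa [h3, map_zero, add_zero] at h1
  have hθT : ∀ x, zD A n (θ x) + θ (zD A n x) = T • x := fun x => hθ (fun i => X i) x
  -- Contraction with the dual vector of `e_c`. As a Koszul differential it anticommutes with the
  -- differentials of `f` and of the variables.
  let ι : (Finset (Fin n) → P) →ₗ[P] (Finset (Fin n) → P) := koszulD (Pi.single c 1)
  have hι : ∀ x σ, ι x σ = if c ∈ σ then 0 else sgn P σ c * x (Insert.insert c σ) := by
    intro x σ
    show koszulD _ x σ = _
    rw [koszulD_apply]
    split_ifs with hσ
    · refine Finset.sum_eq_zero fun i hi => ?_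
      rw [Pi.single_eq_of_ne, mul_zero, zero_mul]
      rintro rfl
      exact Finset.mem_compl.1 hi hσ
    · rw [Finset.sum_eq_single c]
      · rw [Pi.single_eq_same, mul_one]
      · intro i _ hi
        rw [Pi.single_eq_of_ne hi, mul_zero, zero_mul]
      · intro h
        exact absurd (Finset.mem_compl.2 hσ) h
  have hιmem : ∀ l, ∀ x ∈ kosPart P P (Insert.insert c S) (l + 1), ι x ∈ kosPart P P S l := by
    intro l x hx σ hσ
    rw [hι]
    split_ifs with h1
    · rfl
    · rw [hx, mul_zero]
      rintro ⟨h2, h3⟩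
      rw [Finset.card_insert_of_notMem h1] at h3
      exact hσ ⟨(Finset.insert_subset_insert_iff h1).1 h2, by omega⟩
  intro l z hz hzT
  have hzf := fD_eq_zero hz
  have hι1 : fD f (ι z) = 0 := by
    show koszulD _ (koszulD _ z) = 0
    have h3 : koszulD (fun i => (C (f i) : P)) z = 0 := hzf
    rw [koszulD_anticomm, h3, map_zero, neg_zero]
  have hι2 : zD A n (ι z) = 0 := by
    show koszulD _ (koszulD _ z) = 0
    have h3 : koszulD (fun i => (X i : P)) z = 0 := hzT
    rw [koszulD_anticomm, h3, map_zero, neg_zero]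
  have hιz := hιmem l z hz.1
  -- In `z = y0 + θ (ι z)` the summand `y0` does not involve `e_c`.
  set y0 := z - θ (ι z) with hy0
  have hθsub : θ (ι z) = wedge P c (ι z) - ∑ i ∈ S, (C (r i) : P) • wedge P i (ι z) := by
    simp [θ, LinearMap.sum_apply]
  have hwc : ι (wedge P c z) + wedge P c (ι z) = z := by
    have := koszulD_wedge (Pi.single c (1 : P)) c z
    rwa [Pi.single_eq_same, one_smul] at this
  have hcS : c ∈ Insert.insert c S := Finset.mem_insert_self c S
  have hSc : S ⊆ Insert.insert c S := Finset.subset_insert c S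
  have hy0mem : y0 ∈ partCycles f S (l + 1) := by
    refine ⟨?_, ?_⟩
    · have : y0 = ι (wedge P c z) + ∑ i ∈ S, (C (r i) : P) • wedge P i (ι z) := by
        rw [hy0, hθsub]
        nth_rewrite 1 [← hwc]
        abel
      rw [this]
      exact add_mem (hιmem _ _ (wedge_mem hcS hz.1))
        (sum_mem fun i hi => Submodule.smul_mem _ _ (wedge_mem hi hιz))
    · show fD f y0 = 0
      rw [hy0, map_sub, hzf, hθf _ hι1, sub_zero]
  have hy0T : zD A n y0 = -(T • ι z) := by
    have h1 := hθT (ι z)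
    rw [hι2, map_zero, add_zero] at h1
    rw [hy0, map_sub, hzT, h1, zero_sub]
  -- As `y0` is supported on `S`, its differential uses no `X c` and commutes with `q`. Dividing `zD
  -- y0 = -T • ι z` by `T` exhibits `-ι z` as the boundary of `Q0`.
  set Q0 : Finset (Fin n) → P := fun σ => q (y0 σ) with hQ0
  have hQ0mem : Q0 ∈ partCycles f S (l + 1) := by
    refine ⟨map_mem_kosPart q hy0mem.1, ?_⟩
    show fD f Q0 = 0
    rw [hQ0, fD_map, fD_eq_zero hy0mem]
    funext σ
    exact map_zero q
  have hQ0T : zD A n Q0 = -ι z := by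
    have h1 : zD A n Q0 = fun σ => q (zD A n y0 σ) := by
      refine koszulD_map q.toAddMonoidHom q.toAddMonoidHom fun σ i _ => ?_
      show q (X i * y0 (Insert.insert i σ)) = X i * q (y0 (Insert.insert i σ))
      by_cases hi : i = c
      · rw [hy0mem.1 (Insert.insert i σ), mul_zero, map_zero, mul_zero]
        rintro ⟨h1, -⟩
        exact hc (hi ▸ h1 (Finset.mem_insert_self i σ))
      · exact hq1 i hi _
    rw [h1, hy0T]
    funext σ
    show q (-(T * ι z σ)) = -(ι z σ)
    rw [map_neg, hq2]
  have hv : zD A n (θ Q0) = T • Q0 + θ (ι z) := by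
    have h1 := hθT Q0
    rw [hQ0T, map_neg] at h1
    rw [← h1]
    abel
  -- This is `z - zD (θ Q0)`: a cycle supported on `S`, so the hypothesis on `S` applies.
  obtain ⟨y', hy', e⟩ := h l (y0 - T • Q0)
    (sub_mem hy0mem (Submodule.smul_mem _ _ hQ0mem)) (by
      rw [map_sub, map_smul, hy0T, hQ0T, smul_neg, sub_self])
  refine ⟨θ Q0 + y', add_mem ⟨?_, hθf _ (fD_eq_zero hQ0mem)⟩
    ⟨kosPart_mono hSc _ hy'.1, hy'.2⟩, ?_⟩
  · have : θ Q0 = wedge P c Q0 - ∑ i ∈ S, (C (r i) : P) • wedge P i Q0 := by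
      simp [θ, LinearMap.sum_apply]
    rw [this]
    have hQ' := kosPart_mono hSc _ hQ0mem.1
    exact sub_mem (wedge_mem hcS hQ')
      (sum_mem fun i hi => Submodule.smul_mem _ _ (wedge_mem (hSc hi) hQ'))
  · rw [map_add, hv, e, hy0]
    abel

theorem PartExact.of_subset {f : Fin n → A} {S : Finset (Fin n)} (h : PartExact f S)
    (hf : ∀ c, f c ∈ Ideal.span (f '' S)) (D : Finset (Fin n)) : PartExact f (S ∪ D) := by
  induction D using Finset.induction with
  | empty => rwa [Finset.union_empty]
  | insert c D hc ih =>
    by_cases hcS : c ∈ S ∪ D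
    · rw [Finset.union_insert, Finset.insert_eq_of_mem hcS]
      exact ih
    · rw [Finset.union_insert]
      refine ih.insert hcS (Ideal.span_mono (Set.image_mono ?_) (hf c))
      exact_mod_cast Finset.subset_union_left

/-- The Koszul complex of the variables indexed by `S` is exact in positive degrees. -/
theorem exists_zD_eq {S : Finset (Fin n)} {l : ℕ} {z : Finset (Fin n) → MvPolynomial (Fin n) A}
    (hz : z ∈ kosPart (MvPolynomial (Fin n) A) (MvPolynomial (Fin n) A) S (l + 1))
    (h : zD A n z = 0) :
    ∃ y ∈ kosPart (MvPolynomial (Fin n) A) (MvPolynomial (Fin n) A) S (l + 2), zD A n y = z := by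
  -- For `f = 0` every chain is a cycle of `f` and every generator is redundant, so the variables
  -- can be adjoined one at a time to the empty set.
  have h0 : PartExact (fun _ : Fin n => (0 : A)) ∅ := fun l z hz _ =>
    ⟨0, zero_mem _, by rw [map_zero, kosPart_eq_zero (by simp) hz.1]⟩
  have h1 := h0.of_subset (fun c => zero_mem _) S
  rw [Finset.empty_union] at h1
  obtain ⟨y, hy, e⟩ := h1 l z ⟨hz, by
    show koszulD _ z = 0
    funext σ
    rw [koszulD_apply]
    simp⟩ h
  exact ⟨y, hy.1, e⟩

/-! #### The grading by the degree in the variables -/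

/-- All components are homogeneous of degree `t` in the variables. -/
def HomogOfDeg (t : ℕ) (x : Finset (Fin n) → MvPolynomial (Fin n) A) : Prop :=
  ∀ σ, (x σ).IsHomogeneous t

theorem homogeneousComponent_X_mul (i : Fin n) (p : MvPolynomial (Fin n) A) (t : ℕ) :
    homogeneousComponent (t + 1) (X i * p) = X i * homogeneousComponent t p := by
  ext m
  rw [coeff_homogeneousComponent, coeff_X_mul', coeff_X_mul', coeff_homogeneousComponent]
  by_cases h : i ∈ m.support
  · have h1 : Finsupp.single i 1 ≤ m := by
      rw [Finsupp.single_le_iff]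
      exact Nat.one_le_iff_ne_zero.2 (Finsupp.mem_support_iff.1 h)
    have h2 : m.degree = (m - Finsupp.single i 1).degree + 1 := by
      conv_lhs => rw [← tsub_add_cancel_of_le h1]
      rw [map_add, Finsupp.degree_single]
    rw [if_pos h, if_pos h, h2]
    simp only [Nat.add_right_cancel_iff]
  · rw [if_neg h, if_neg h, ite_self]

theorem homogeneousComponent_zero_X_mul (i : Fin n) (p : MvPolynomial (Fin n) A) :
    homogeneousComponent 0 (X i * p) = 0 := by
  rw [homogeneousComponent_zero, coeff_X_mul', if_neg (by simp), map_zero]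

theorem zD_map (q q' : MvPolynomial (Fin n) A →ₗ[A] MvPolynomial (Fin n) A)
    (h : ∀ i p, q' (X i * p) = X i * q p) (x : Finset (Fin n) → MvPolynomial (Fin n) A) :
    zD A n (fun σ => q (x σ)) = fun σ => q' (zD A n x σ) :=
  koszulD_map q.toAddMonoidHom q'.toAddMonoidHom fun _ i _ => h i _

theorem zD_homogeneousComponent (x : Finset (Fin n) → MvPolynomial (Fin n) A) (t : ℕ) :
    zD A n (fun σ => homogeneousComponent t (x σ)) =
      fun σ => homogeneousComponent (t + 1) (zD A n x σ) :=
  zD_map _ _ (fun i p => homogeneousComponent_X_mul i p t) x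

theorem homogeneousComponent_zero_zD (x : Finset (Fin n) → MvPolynomial (Fin n) A)
    (σ : Finset (Fin n)) : homogeneousComponent 0 (zD A n x σ) = 0 := by
  show homogeneousComponent 0 (koszulD _ x σ) = 0
  rw [koszulD_apply, map_sum]
  refine Finset.sum_eq_zero fun i _ => ?_
  rw [mul_assoc, mul_left_comm, homogeneousComponent_zero_X_mul]

theorem HomogOfDeg.eq_self {t : ℕ} {x : Finset (Fin n) → MvPolynomial (Fin n) A}
    (h : HomogOfDeg t x) : (fun σ => homogeneousComponent t (x σ)) = x := by
  funext σ
  rw [homogeneousComponent_of_mem (h σ), if_pos rfl]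

theorem HomogOfDeg.fD {t : ℕ} {x : Finset (Fin n) → MvPolynomial (Fin n) A}
    (h : HomogOfDeg t x) (f : Fin n → A) : HomogOfDeg t (fD f x) := by
  intro σ
  rw [← h.eq_self, fD_map]
  exact homogeneousComponent_isHomogeneous _ _

theorem exists_sum_homogOfDeg (x : Finset (Fin n) → MvPolynomial (Fin n) A) :
    ∃ N, x = ∑ t ∈ Finset.range N, fun σ => homogeneousComponent t (x σ) := by
  refine ⟨Finset.univ.sup (fun σ => (x σ).totalDegree) + 1, funext fun σ => ?_⟩
  rw [Finset.sum_apply]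
  conv_lhs => rw [← sum_homogeneousComponent (x σ)]
  refine Finset.sum_subset (Finset.range_subset_range.2 ?_) fun t _ ht => ?_
  · exact Nat.succ_le_succ (Finset.le_sup (f := fun σ => (x σ).totalDegree) (Finset.mem_univ σ))
  · refine homogeneousComponent_eq_zero _ _ ?_
    rw [Finset.mem_range] at ht
    omega

theorem HomogOfDeg.exists_zD_eq {S : Finset (Fin n)} {l t : ℕ}
    {z : Finset (Fin n) → MvPolynomial (Fin n) A} (ht : HomogOfDeg (t + 1) z)
    (hz : z ∈ kosPart (MvPolynomial (Fin n) A) (MvPolynomial (Fin n) A) S (l + 1))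
    (h : zD A n z = 0) :
    ∃ y ∈ kosPart (MvPolynomial (Fin n) A) (MvPolynomial (Fin n) A) S (l + 2),
      HomogOfDeg t y ∧ zD A n y = z := by
  obtain ⟨y, hy, rfl⟩ := GradedCech.exists_zD_eq hz h
  refine ⟨fun σ => homogeneousComponent t (y σ), map_mem_kosPart _ hy,
    fun σ => homogeneousComponent_isHomogeneous _ _, ?_⟩
  rw [zD_homogeneousComponent, ht.eq_self]

theorem HomogOfDeg.eq_zero {S : Finset (Fin n)} {l : ℕ}
    {z : Finset (Fin n) → MvPolynomial (Fin n) A} (ht : HomogOfDeg 0 z)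
    (hz : z ∈ kosPart (MvPolynomial (Fin n) A) (MvPolynomial (Fin n) A) S (l + 1))
    (h : zD A n z = 0) : z = 0 := by
  obtain ⟨y, hy, rfl⟩ := GradedCech.exists_zD_eq hz h
  rw [← ht.eq_self]
  funext σ
  exact homogeneousComponent_zero_zD y σ

theorem zD_fD (f : Fin n → A) (x : Finset (Fin n) → MvPolynomial (Fin n) A) :
    zD A n (fD f x) = -fD f (zD A n x) := koszulD_anticomm _ _ x

theorem homogeneousComponent_mem_partCycles {f : Fin n → A} {S : Finset (Fin n)} {l : ℕ}
    {z : Finset (Fin n) → MvPolynomial (Fin n) A} (hz : z ∈ partCycles f S l) (t : ℕ) :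
    (fun σ => homogeneousComponent t (z σ)) ∈ partCycles f S l := by
  refine ⟨map_mem_kosPart _ hz.1, ?_⟩
  show fD f _ = 0
  rw [fD_map, fD_eq_zero hz]
  funext σ
  exact map_zero _

theorem zD_homogeneousComponent_eq_zero {z : Finset (Fin n) → MvPolynomial (Fin n) A}
    (h : zD A n z = 0) (t : ℕ) : zD A n (fun σ => homogeneousComponent t (z σ)) = 0 := by
  rw [zD_homogeneousComponent, h]
  funext σ
  exact map_zero _

/-- If the Koszul homology of the `f i`, `i ∈ S`, vanishes in degrees at least two, then the
approximation complex of these elements is exact in positive degrees. -/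
theorem partExact_of_fD_exact {f : Fin n → A} {S : Finset (Fin n)}
    (H : ∀ l, ∀ x ∈ partCycles f S (l + 2),
      ∃ y ∈ kosPart (MvPolynomial (Fin n) A) (MvPolynomial (Fin n) A) S (l + 3), fD f y = x) :
    PartExact f S := by
  have key : ∀ t l, ∀ z ∈ partCycles f S (l + 1), HomogOfDeg t z → zD A n z = 0 →
      ∃ y ∈ partCycles f S (l + 2), zD A n y = z := by
    intro t
    induction t with
    | zero =>
      intro l z hz ht h
      exact ⟨0, zero_mem _, by rw [map_zero, ht.eq_zero hz.1 h]⟩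
    | succ t ih =>
      intro l z hz ht h
      -- The primitive `w` need not be a cycle of `f`. Its defect `fD f w` is a cycle for both
      -- differentials of lower degree in the variables, hence of the form `zD (fD u)` by induction
      -- and `H`; replacing `w` by `w + zD u` removes the defect.
      obtain ⟨w, hw, hwt, rfl⟩ := ht.exists_zD_eq hz.1 h
      have h1 : fD f (zD A n w) = 0 := fD_eq_zero hz
      obtain ⟨w', hw', e⟩ := ih l (fD f w) ⟨koszulD_mem _ hw, koszulD_koszulD _ _⟩ (hwt.fD f)
        (by rw [zD_fD, h1, neg_zero])
      obtain ⟨u, hu, rfl⟩ := H l w' hw'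
      refine ⟨w + zD A n u, ⟨add_mem hw (koszulD_mem _ hu), ?_⟩, ?_⟩
      · show fD f _ = 0
        rw [map_add, ← e, zD_fD, neg_add_cancel]
      · rw [map_add, zD_zD, add_zero]
  intro l z hz h
  obtain ⟨N, hN⟩ := exists_sum_homogOfDeg z
  choose y hy hyz using fun t => key t l _ (homogeneousComponent_mem_partCycles hz t)
    (fun σ => homogeneousComponent_isHomogeneous _ _) (zD_homogeneousComponent_eq_zero h t)
  refine ⟨∑ t ∈ Finset.range N, y t, sum_mem fun t _ => hy t, ?_⟩
  rw [map_sum, hN]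
  exact Finset.sum_congr rfl fun t _ => hyz t

theorem C_smul_eq (r : A) (x : Finset (Fin n) → MvPolynomial (Fin n) A) :
    (C r : MvPolynomial (Fin n) A) • x = r • x := by
  funext σ
  exact (smul_eq_C_mul _ _).symm

theorem zD_fD_wedge {f : Fin n → A} (i : Fin n) {w : Finset (Fin n) → MvPolynomial (Fin n) A}
    (h : fD f (zD A n w) = 0) : zD A n (fD f (wedge (MvPolynomial (Fin n) A) i w)) =
      f i • zD A n w - (X i : MvPolynomial (Fin n) A) • fD f w := by
  have k1 : zD A n (wedge _ i w) + wedge _ i (zD A n w) = (X i : MvPolynomial (Fin n) A) • w :=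
    koszulD_wedge (fun i => X i) i w
  have k2 : fD f (wedge _ i (zD A n w)) + wedge _ i (fD f (zD A n w)) =
      (C (f i) : MvPolynomial (Fin n) A) • zD A n w :=
    koszulD_wedge (fun i => C (f i)) i (zD A n w)
  rw [h, map_zero, add_zero] at k2
  rw [zD_fD, eq_sub_of_add_eq k1, map_sub, k2, map_smul, C_smul_eq]
  abel

/-- The homology of the approximation complex in positive degrees is `I`-power torsion. -/
theorem exists_pow_smul_mem_zD (f : Fin n → A) {l : ℕ}
    {z : Finset (Fin n) → MvPolynomial (Fin n) A} (hz : z ∈ zMod f (l + 1)) (h : zD A n z = 0) :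
    ∃ k, ∀ r ∈ Ideal.span (Set.range f) ^ k, r • z ∈ (zMod f (l + 2)).map (zD A n) := by
  let D : Submodule A (Finset (Fin n) → MvPolynomial (Fin n) A) :=
    ((zMod f (l + 2)).map (zD A n)).restrictScalars A
  let J : (Finset (Fin n) → MvPolynomial (Fin n) A) → Ideal A := fun z =>
    D.comap (LinearMap.toSpanSingleton A _ z)
  have hJ : ∀ z r, r ∈ J z ↔ r • z ∈ (zMod f (l + 2)).map (zD A n) := fun z r => Iff.rfl
  have key : ∀ t, ∀ z ∈ partCycles f Finset.univ (l + 1), HomogOfDeg t z → zD A n z = 0 →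
      Ideal.span (Set.range f) ^ (t + 1) ≤ J z := by
    intro t
    induction t with
    | zero =>
      intro z hz ht h r _
      rw [hJ, ht.eq_zero hz.1 h, smul_zero]
      exact zero_mem _
    | succ t ih =>
      intro z hz ht h
      obtain ⟨w, hw, hwt, rfl⟩ := ht.exists_zD_eq hz.1 h
      have h1 : fD f (zD A n w) = 0 := fD_eq_zero hz
      have h2 := ih (fD f w) ⟨koszulD_mem _ hw, koszulD_koszulD _ _⟩ (hwt.fD f)
        (by rw [zD_fD, h1, neg_zero])
      rw [pow_succ]
      refine Ideal.mul_le.2 fun r hr g hg => ?_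
      have h3 : Ideal.span (Set.range f) ≤
          Submodule.comap (LinearMap.mulLeft A r) (J (zD A n w)) := by
        refine Ideal.span_le.2 ?_
        rintro _ ⟨i, rfl⟩
        show r * f i ∈ J (zD A n w)
        rw [hJ]
        obtain ⟨y1, hy1, e1⟩ := h2 hr
        have e1' : zD A n y1 = r • fD f w := e1
        set e := wedge (MvPolynomial (Fin n) A) i w with he
        have hemem := wedge_mem (Finset.mem_univ i) hw
        have hu : fD f e ∈ zMod f (l + 2) := by
          rw [← partCycles_univ]
          exact ⟨koszulD_mem _ hemem, koszulD_koszulD _ _⟩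
        have hzu := zD_fD_wedge i h1
        -- Since `zD (fD e) = f i • zD w - X i • fD w` and `r • fD w = zD y1`, the term `X i • y1`
        -- cancels the unwanted part and leaves `r * f i` times `zD w`.
        refine ⟨(C r : MvPolynomial (Fin n) A) • fD f e + (X i : MvPolynomial (Fin n) A) • y1,
          add_mem (Submodule.smul_mem _ _ hu) (Submodule.smul_mem _ _ hy1), ?_⟩
        rw [map_add, map_smul, map_smul, hzu, e1', C_smul_eq, smul_sub,
          smul_comm r (X i : MvPolynomial _ A), sub_add_cancel, mul_smul]
      exact h3 hg
  rw [← partCycles_univ] at hz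
  obtain ⟨N, hN⟩ := exists_sum_homogOfDeg z
  -- The component of degree `t` in the variables is killed by `I ^ (t + 1)`, and only `t < N`
  -- occur.
  refine ⟨N, fun r hr => ?_⟩
  rw [hN, Finset.smul_sum]
  refine sum_mem fun t ht => ?_
  refine key t _ (homogeneousComponent_mem_partCycles hz t)
    (fun σ => homogeneousComponent_isHomogeneous _ _) (zD_homogeneousComponent_eq_zero h t)
    (Ideal.pow_le_pow_right ?_ hr)
  exact Finset.mem_range.1 ht

end Exactness

end GradedCech

namespace GradedCech

open MvPolynomial

/-! ### Almost complete intersections -/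

section AlmostCI

/-- Nakayama: a subfamily whose images form a basis of `I` tensored with the residue field generates
`I`, and the dimension of that space is the minimal number of generators. -/
theorem exists_generating_subset {A : Type*} [CommRing A] [IsLocalRing A] {n : ℕ} (f : Fin n → A) :
    ∃ S : Finset (Fin n), Ideal.span (f '' S) = Ideal.span (Set.range f) ∧
      S.card ≤ (Ideal.span (Set.range f)).spanFinrank := by
  classical
  set I := Ideal.span (Set.range f) with hI
  have hfg : I.FG := (Submodule.fg_def).2 ⟨Set.range f, Set.finite_range f, rfl⟩
  have : Module.Finite A I := Module.Finite.iff_fg.2 hfg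
  let K := IsLocalRing.ResidueField A
  let g : Fin n → I := fun i => ⟨f i, Ideal.subset_span (Set.mem_range_self i)⟩
  have hg : Submodule.span A (Set.range g) = ⊤ := by
    refine Submodule.map_injective_of_injective I.injective_subtype ?_
    rw [Submodule.map_span, Submodule.map_top, Submodule.range_subtype, ← Set.range_comp]
    rfl
  let v : Fin n → TensorProduct A K I := fun i => TensorProduct.mk A K I 1 (g i)
  have hv : Submodule.span K (Set.range v) = ⊤ := by
    rw [← IsLocalRing.map_tensorProduct_mk_eq_top, Submodule.map_span, ← Set.range_comp]
      at hg
    rw [← Submodule.restrictScalars_eq_top_iff A, Submodule.restrictScalars_span A K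
      Ideal.Quotient.mk_surjective]
    exact hg
  obtain ⟨κ, a, ha, hspan, hli⟩ := exists_linearIndependent' K v
  have : Finite κ := Finite.of_injective a ha
  have : Fintype κ := Fintype.ofFinite κ
  let e := Module.Basis.mk hli (by rw [hspan, hv])
  have htop := IsLocalRing.span_eq_top_of_tmul_eq_basis (g ∘ a) e fun i => by
    rw [Module.Basis.mk_apply]
    rfl
  refine ⟨Finset.univ.image a, ?_, ?_⟩
  · have h := congrArg (Submodule.map I.subtype) htop
    rw [Submodule.map_span, Submodule.map_top, Submodule.range_subtype, ← Set.range_comp] at h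
    rw [Finset.coe_image, Finset.coe_univ, Set.image_univ, ← Set.range_comp]
    exact h
  · rw [Finset.card_image_of_injective _ ha, Finset.card_univ,
      ← TensorProduct.spanFinrank_top_eq_of_residueField I hfg,
      ← Module.finrank_eq_spanFinrank_of_free]
    exact hli.fintype_card_le_finrank

theorem kos_eq_fD {A : Type*} [CommRing A] {n : ℕ} (f : Fin n → A)
    (x : Finset (Fin n) → MvPolynomial (Fin n) A) : kos f x = fD f x := by
  funext σ
  rw [kos_apply]
  show _ = koszulD _ x σ
  rw [koszulD_apply]
  refine Finset.sum_congr rfl fun i _ => ?_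
  rw [mul_smul, smul_eq_C_mul, smul_eq_C_mul, mul_assoc]
  congr 1
  unfold sgn
  simp

/-- A generating subset with at most `grade + 1` elements has no Koszul homology from degree two on;
the regular sequence stays regular over the flat extension by the variables. The remaining
generators are redundant. -/
theorem partExact_of_local {A : Type*} [CommRing A] [IsLocalRing A] {n : ℕ} (f : Fin n → A)
    (h : ((Ideal.span (Set.range f)).spanFinrank : ℕ∞) ≤ grade (Ideal.span (Set.range f)) + 1) :
    PartExact f Finset.univ := by
  obtain ⟨S, hS, hcard⟩ := exists_generating_subset f
  have hg : ((S.card - 1 : ℕ) : ℕ∞) ≤ grade (Ideal.span (Set.range f)) := by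
    have h1 : (S.card : ℕ∞) ≤ grade (Ideal.span (Set.range f)) + 1 :=
      le_trans (by exact_mod_cast hcard) h
    rw [ENat.natCast_sub]
    exact tsub_le_iff_right.2 h1
  obtain ⟨rs, hmem, hreg, hlen⟩ := exists_isWeaklyRegular_of_le_grade hg
  have hreg' : RingTheory.Sequence.IsWeaklyRegular (MvPolynomial (Fin n) A) rs :=
    (LinearEquiv.isWeaklyRegular_congr (TensorProduct.lid A (MvPolynomial (Fin n) A)) rs).1
      (hreg.isWeaklyRegular_rTensor (M₂ := MvPolynomial (Fin n) A))
  have hex : PartExact f S := partExact_of_fD_exact fun l x hx => by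
    obtain ⟨y, hy, e⟩ := exists_kos_eq_of_isWeaklyRegular f S rs hreg'
      (fun r hr => by rw [hS]; exact hmem r hr) (l := l + 2) (by omega) x hx.1
      (by rw [kos_eq_fD]; exact hx.2)
    exact ⟨y, hy, by rw [← kos_eq_fD, e]⟩
  have := hex.of_subset (fun c => by
    rw [hS]
    exact Ideal.subset_span (Set.mem_range_self c)) Finset.univ
  rwa [Finset.union_eq_right.2 (Finset.subset_univ S)] at this

theorem koszulD_ringHom {A B : Type*} [CommRing A] [CommRing B] {n : ℕ} (φ : A →+* B)
    (a : Fin n → A) (x : Finset (Fin n) → A) :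
    koszulD (fun i => φ (a i)) (fun σ => φ (x σ)) = fun σ => φ (koszulD a x σ) :=
  koszulD_map φ.toAddMonoidHom φ.toAddMonoidHom fun _ _ _ => map_mul φ _ _

variable {R : Type*} [CommRing R] {n : ℕ}

/-- Clear denominators in a primitive over the localization. The cycle condition and the boundary
equation then hold up to elements killed by further factors `w1`, `w2` from the complement of `p`.
-/
theorem exists_smul_mem_of_localization (f : Fin n → R) (p : Ideal R) [p.IsPrime]
    (h : PartExact (fun i => algebraMap R (Localization.AtPrime p) (f i)) Finset.univ) {l : ℕ}
    {z : Finset (Fin n) → MvPolynomial (Fin n) R} (hz : z ∈ zMod f (l + 1))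
    (hd : zD R n z = 0) : ∃ t ∉ p, t • z ∈ (zMod f (l + 2)).map (zD R n) := by
  classical
  set A := Localization.AtPrime p with hA
  set φ := algebraMap R A with hφ
  let _ : Algebra (MvPolynomial (Fin n) R) (MvPolynomial (Fin n) A) :=
    MvPolynomial.algebraMvPolynomial
  let Φ := algebraMap (MvPolynomial (Fin n) R) (MvPolynomial (Fin n) A)
  have hΦC : ∀ r, Φ (C r) = C (φ r) := fun r => MvPolynomial.map_C φ r
  have hΦX : ∀ i, Φ (X i) = X i := fun i => MvPolynomial.map_X φ i
  let W := p.primeCompl.map (C : R →+* MvPolynomial (Fin n) R)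
  have : IsLocalization W (MvPolynomial (Fin n) A) := MvPolynomial.isLocalization p.primeCompl A
  have hf : ∀ x, fD (fun i => φ (f i)) (fun σ => Φ (x σ)) = fun σ => Φ (fD f x σ) := by
    intro x
    have := koszulD_ringHom Φ (fun i => C (f i)) x
    simpa only [hΦC] using this
  have hT : ∀ x, zD A n (fun σ => Φ (x σ)) = fun σ => Φ (zD R n x σ) := by
    intro x
    have := koszulD_ringHom Φ (fun i => X i) x
    simp only [hΦX] at this
    exact this
  have hkill : ∀ x : Finset (Fin n) → MvPolynomial (Fin n) R, (∀ σ, Φ (x σ) = 0) →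
      ∃ w ∈ W, w • x = 0 := by
    intro x hx
    have h1 : ∀ σ, ∃ w : W, (w : MvPolynomial (Fin n) R) * x σ = 0 := fun σ =>
      (IsLocalization.map_eq_zero_iff W (MvPolynomial (Fin n) A) (x σ)).1 (hx σ)
    choose w hw using h1
    refine ⟨∏ σ, (w σ : MvPolynomial (Fin n) R), Submonoid.prod_mem _ fun σ _ => (w σ).2, ?_⟩
    funext σ
    show (∏ σ, (w σ : MvPolynomial (Fin n) R)) * x σ = 0
    rw [← Finset.prod_erase_mul _ _ (Finset.mem_univ σ), mul_assoc, hw, mul_zero]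
  rw [← partCycles_univ] at hz
  obtain ⟨y', hy', e⟩ := h l (fun σ => Φ (z σ))
    ⟨fun σ hσ => by
      show Φ (z σ) = 0
      rw [hz.1 σ hσ, map_zero], by
      show fD _ _ = 0
      rw [hf, fD_eq_zero hz]
      funext σ
      exact map_zero Φ⟩
    (by
      rw [hT, hd]
      funext σ
      exact map_zero Φ)
  obtain ⟨c, hc⟩ := IsLocalization.exist_integer_multiples_of_finite W y'
  choose g hg using hc
  let y0 : Finset (Fin n) → MvPolynomial (Fin n) R := fun σ =>
    if σ ⊆ Finset.univ ∧ σ.card = l + 2 then g σ else 0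
  have hy0 : y0 ∈ kosPart (MvPolynomial (Fin n) R) (MvPolynomial (Fin n) R) Finset.univ (l + 2) :=
    fun σ hσ => if_neg hσ
  have hΦy0 : (fun σ => Φ (y0 σ)) = Φ c • y' := by
    funext σ
    show Φ (y0 σ) = Φ c * y' σ
    by_cases hσ : σ ⊆ Finset.univ ∧ σ.card = l + 2
    · rw [show y0 σ = g σ from if_pos hσ]
      refine (hg σ).trans ?_
      rw [Algebra.smul_def]
    · rw [hy0 σ hσ, hy'.1 σ hσ, map_zero, mul_zero]
  obtain ⟨w1, hw1, e1⟩ := hkill (fD f y0) fun σ => by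
    have : (fun σ => Φ (fD f y0 σ)) = 0 := by
      rw [← hf, hΦy0, map_smul, fD_eq_zero hy', smul_zero]
    exact congrFun this σ
  obtain ⟨w2, hw2, e2⟩ := hkill (zD R n y0 - (c : MvPolynomial (Fin n) R) • z) fun σ => by
    have h1 := congrFun (hT y0) σ
    rw [hΦy0, map_smul, e] at h1
    show Φ (zD R n y0 σ - c * z σ) = 0
    rw [map_sub, map_mul, ← h1]
    exact sub_self _
  obtain ⟨t, ht, hte⟩ : w2 * w1 * c ∈ W := mul_mem (mul_mem hw2 hw1) c.2
  refine ⟨t, ht, (w2 * w1) • y0, ?_, ?_⟩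
  · rw [SetLike.mem_coe, ← partCycles_univ]
    refine ⟨Submodule.smul_mem _ _ hy0, ?_⟩
    show fD f _ = 0
    rw [map_smul, mul_smul, e1, smul_zero]
  · rw [← C_smul_eq]
    have hte' : (C t : MvPolynomial (Fin n) R) = w2 * w1 * c := hte
    rw [hte', map_smul]
    rw [smul_sub, sub_eq_zero] at e2
    rw [mul_comm w2 w1, mul_smul, e2, smul_smul, smul_smul, mul_assoc]

/-- Off `V(B)` the approximation complex of an almost complete intersection is exact. -/
theorem IsAlmostLCIOff.exists_pow_smul_mem {f : Fin n → R} {B : Ideal R}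
    (h : IsAlmostLCIOff B (Ideal.span (Set.range f))) {l : ℕ}
    {z : Finset (Fin n) → MvPolynomial (Fin n) R} (hz : z ∈ zMod f (l + 1))
    (hd : zD R n z = 0) {r : R} (hr : r ∈ B) :
    ∃ k : ℕ, r ^ k • z ∈ (zMod f (l + 2)).map (zD R n) := by
  let D : Submodule R (Finset (Fin n) → MvPolynomial (Fin n) R) :=
    ((zMod f (l + 2)).map (zD R n)).restrictScalars R
  let J : Ideal R := D.comap (LinearMap.toSpanSingleton R _ z)
  suffices h' : r ∈ J.radical from h'
  -- A prime `p` containing `J` but not `r` would not contain `B`, and local exactness at `p` would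
  -- give an element of `J` outside `p`.
  rw [Ideal.radical_eq_sInf, Ideal.mem_sInf]
  rintro p ⟨hJp, hp⟩
  by_contra hrp
  have hp' := h p fun hB => hrp (hB hr)
  rw [Ideal.map_span, ← Set.range_comp] at hp'
  obtain ⟨t, ht, ht'⟩ := exists_smul_mem_of_localization f p (partExact_of_local _ hp') hz hd
  exact ht (hJp ht')

end AlmostCI

end GradedCech

namespace GradedCech

open MvPolynomial

/-! ### Graded submodules of the Koszul complex over the polynomial ring -/

section GradedSub

variable {R : Type*} [CommRing R] {G : Type*} [AddCommGroup G] {𝒜 : G → AddSubgroup R} {n : ℕ}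

theorem isProjFamily_proj [DecidableEq G] [GradedRing 𝒜] :
    IsProjFamily 𝒜 𝒜 (GradedRing.proj 𝒜) where
  mem g m := SetLike.coe_mem _
  self g m hm := DirectSum.decompose_of_mem_same 𝒜 hm
  smul e g r hr m := by
    rw [add_comm]
    exact DirectSum.coe_decompose_mul_add_of_left_mem 𝒜 hr

/-- Application of an additive map to the coefficients of a polynomial. -/
noncomputable def coeffMap (q : R →+ R) : MvPolynomial (Fin n) R →+ MvPolynomial (Fin n) R where
  toFun p := AddMonoidAlgebra.ofCoeff (Finsupp.mapRange q (map_zero q) (AddMonoidAlgebra.coeff p))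
  map_zero' := by
    ext d
    exact map_zero q
  map_add' p p' := by
    ext d
    exact map_add q _ _

theorem coeff_coeffMap (q : R →+ R) (p : MvPolynomial (Fin n) R) (d : Fin n →₀ ℕ) :
    coeff d (coeffMap q p) = q (coeff d p) := rfl

/-- Application of an additive map to all coefficients. -/
noncomputable def chainMap (q : R →+ R) :
    (Finset (Fin n) → MvPolynomial (Fin n) R) →+ (Finset (Fin n) → MvPolynomial (Fin n) R) where
  toFun x σ := coeffMap q (x σ)
  map_zero' := by
    funext σ
    exact map_zero _
  map_add' x y := by
    funext σ
    exact map_add _ _ _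

theorem chainMap_apply (q : R →+ R) (x : Finset (Fin n) → MvPolynomial (Fin n) R)
    (σ : Finset (Fin n)) : chainMap q x σ = coeffMap q (x σ) := rfl

theorem zD_chainMap (q : R →+ R) (x : Finset (Fin n) → MvPolynomial (Fin n) R) :
    zD R n (chainMap q x) = chainMap q (zD R n x) :=
  koszulD_map (coeffMap q) (coeffMap q) fun σ i _ => by
    ext d
    rw [coeff_coeffMap, coeff_X_mul', coeff_X_mul', apply_ite q, map_zero, coeff_coeffMap]

variable (𝒜) in
/-- The chains all of whose coefficients have degree `g`. -/
def chainPiece (n : ℕ) (g : G) : AddSubgroup (Finset (Fin n) → MvPolynomial (Fin n) R) where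
  carrier := {x | ∀ σ d, coeff d (x σ) ∈ 𝒜 g}
  add_mem' hx hy σ d := by
    rw [Pi.add_apply, coeff_add]
    exact add_mem (hx σ d) (hy σ d)
  zero_mem' σ d := by simp
  neg_mem' hx σ d := by
    rw [Pi.neg_apply, coeff_neg]
    exact neg_mem (hx σ d)

variable {π : G → R →+ R}

/-- The basis elements `e_σ` carry degree zero in every homological degree, matching the twists
`Z_l(lγ)`; the differential of `f` therefore shifts degrees by `γ`. -/
theorem fD_chainMap (hπ : IsProjFamily 𝒜 𝒜 π) {γ : G} {f : Fin n → R} (hf : ∀ i, f i ∈ 𝒜 γ) (g : G)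
    (x : Finset (Fin n) → MvPolynomial (Fin n) R) :
    fD f (chainMap (π g) x) = chainMap (π (g + γ)) (fD f x) :=
  koszulD_map (coeffMap (π g)) (coeffMap (π (g + γ))) fun σ i _ => by
    ext d
    rw [coeff_coeffMap, coeff_C_mul, coeff_C_mul, coeff_coeffMap]
    exact hπ.smul γ g (f i) (hf i) _

theorem isProjFamily_chainMap (hπ : IsProjFamily 𝒜 𝒜 π) :
    IsProjFamily 𝒜 (chainPiece 𝒜 n) (fun g => chainMap (π g)) where
  mem g x σ d := hπ.mem g _
  self g x hx := by
    funext σ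
    ext d
    exact hπ.self g _ (hx σ d)
  smul e g r hr x := by
    funext σ
    ext d
    rw [chainMap_apply, coeff_coeffMap, Pi.smul_apply, Pi.smul_apply, coeff_smul, coeff_smul]
    exact hπ.smul e g r hr _

variable (𝒜) in
/-- The grading induced on a submodule of the chains. -/
noncomputable def subPiece (N : Submodule (MvPolynomial (Fin n) R) (Finset (Fin n) → MvPolynomial (Fin n) R))
    (g : G) : AddSubgroup N :=
  (chainPiece 𝒜 n g).comap N.subtype.toAddMonoidHom

variable (𝒜) in
/-- The grading induced on a quotient of submodules of the chains. -/
noncomputable def quotPiece (N N' : Submodule (MvPolynomial (Fin n) R) (Finset (Fin n) → MvPolynomial (Fin n) R))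
    (g : G) : AddSubgroup (N ⧸ N'.submoduleOf N) :=
  (subPiece 𝒜 N g).map (N'.submoduleOf N).mkQ.toAddMonoidHom

/-- A submodule of the chains is stable under the projections to the graded pieces. -/
def Stable (π : G → R →+ R)
    (N : Submodule (MvPolynomial (Fin n) R) (Finset (Fin n) → MvPolynomial (Fin n) R)) : Prop :=
  ∀ g, ∀ x ∈ N, chainMap (π g) x ∈ N

variable {N N' : Submodule (MvPolynomial (Fin n) R) (Finset (Fin n) → MvPolynomial (Fin n) R)}

/-- The projections of a stable submodule. -/
noncomputable def subProj (hN : Stable π N) (g : G) : N →+ N :=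
  AddMonoidHom.mk' (fun x => ⟨chainMap (π g) x.1, hN g x.1 x.2⟩) fun _ _ =>
    Subtype.ext (map_add _ _ _)

theorem isProjFamily_sub (hπ : IsProjFamily 𝒜 𝒜 π) (hN : Stable π N) :
    IsProjFamily 𝒜 (subPiece 𝒜 N) (subProj hN) where
  mem g x := (isProjFamily_chainMap hπ).mem g x.1
  self g x hx := Subtype.ext ((isProjFamily_chainMap hπ).self g x.1 hx)
  smul e g r hr x := Subtype.ext ((isProjFamily_chainMap hπ).smul e g r hr x.1)

/-- The projections of a quotient of stable submodules. -/
noncomputable def quotProj (hN : Stable π N) (hN' : Stable π N') (g : G) :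
    (N ⧸ N'.submoduleOf N) →+ (N ⧸ N'.submoduleOf N) :=
  QuotientAddGroup.map (N'.submoduleOf N).toAddSubgroup (N'.submoduleOf N).toAddSubgroup
    (subProj hN g) fun x hx => hN' g x.1 hx

theorem isProjFamily_quot (hπ : IsProjFamily 𝒜 𝒜 π) (hN : Stable π N) (hN' : Stable π N') :
    IsProjFamily 𝒜 (quotPiece 𝒜 N N') (quotProj hN hN') where
  mem g x := by
    obtain ⟨y, rfl⟩ := Submodule.mkQ_surjective _ x
    exact ⟨subProj hN g y, (isProjFamily_sub hπ hN).mem g y, rfl⟩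
  self g x hx := by
    obtain ⟨y, hy, rfl⟩ := hx
    exact congrArg (N'.submoduleOf N).mkQ ((isProjFamily_sub hπ hN).self g y hy)
  smul e g r hr x := by
    obtain ⟨y, rfl⟩ := Submodule.mkQ_surjective _ x
    exact congrArg (N'.submoduleOf N).mkQ ((isProjFamily_sub hπ hN).smul e g r hr y)

theorem grSMul_sub [SetLike.GradedMonoid 𝒜] : GrSMul 𝒜 (subPiece 𝒜 N) := by
  intro e g r x hr hx σ d
  show coeff d (r • x.1 σ) ∈ _
  rw [coeff_smul, smul_eq_mul, add_comm]
  exact SetLike.mul_mem_graded hr (hx σ d)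

/-- The exact sequence `0 → N' → N → N / N' → 0`. -/
theorem grShortExact_quot (h : N' ≤ N) :
    GrShortExact (subPiece 𝒜 N') (subPiece 𝒜 N) (quotPiece 𝒜 N N')
      ((Submodule.inclusion h).restrictScalars R) ((N'.submoduleOf N).mkQ.restrictScalars R) where
  inj := Submodule.inclusion_injective h
  zero x := (Submodule.Quotient.mk_eq_zero _).2 x.2
  exact x hx := ⟨⟨x.1, (Submodule.Quotient.mk_eq_zero (N'.submoduleOf N)).1 hx⟩, rfl⟩
  mem_iff _ _ := Iff.rfl
  mem _ x hx := ⟨x, hx, rfl⟩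
  surj _ _ hx := hx

/-- The exact sequence `0 → N ∩ ker D → N → D(N) → 0`. -/
theorem grShortExact_map (hπ : IsProjFamily 𝒜 𝒜 π) (hN : Stable π N)
    (D : (Finset (Fin n) → MvPolynomial (Fin n) R) →ₗ[MvPolynomial (Fin n) R]
      (Finset (Fin n) → MvPolynomial (Fin n) R)) {δ : G}
    (hD : ∀ g x, D (chainMap (π g) x) = chainMap (π (g + δ)) (D x)) :
    GrShortExact (subPiece 𝒜 (N ⊓ LinearMap.ker D)) (subPiece 𝒜 N)
      (fun g => subPiece 𝒜 (N.map D) (g + δ))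
      ((Submodule.inclusion inf_le_left).restrictScalars R)
      ((D.restrict (p := N) (q := N.map D) fun _ hx => Submodule.mem_map_of_mem hx).restrictScalars R)
      where
  inj := Submodule.inclusion_injective inf_le_left
  zero x := Subtype.ext x.2.2
  exact x hx := ⟨⟨x.1, x.2, congrArg Subtype.val hx⟩, rfl⟩
  mem_iff _ _ := Iff.rfl
  mem g x hx := by
    show D x.1 ∈ chainPiece 𝒜 n (g + δ)
    rw [← (isProjFamily_chainMap hπ).self g x.1 hx, hD]
    exact (isProjFamily_chainMap hπ).mem _ _
  surj g y hy := by
    obtain ⟨x, hx, hxy⟩ := y.2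
    refine ⟨subProj hN g ⟨x, hx⟩, (isProjFamily_sub hπ hN).mem g _, Subtype.ext ?_⟩
    show D (chainMap (π g) x) = y.1
    rw [hD, hxy]
    exact (isProjFamily_chainMap hπ).self _ _ hy

/-! #### Stable submodules -/

theorem Stable.map (hN : Stable π N)
    {D : (Finset (Fin n) → MvPolynomial (Fin n) R) →ₗ[MvPolynomial (Fin n) R]
      (Finset (Fin n) → MvPolynomial (Fin n) R)} {δ : G}
    (hD : ∀ g x, D (chainMap (π g) x) = chainMap (π (g + δ)) (D x)) : Stable π (N.map D) := by
  rintro g _ ⟨x, hx, rfl⟩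
  refine ⟨chainMap (π (g - δ)) x, hN _ x hx, ?_⟩
  rw [hD, sub_add_cancel]

theorem Stable.inf_ker (hN : Stable π N)
    {D : (Finset (Fin n) → MvPolynomial (Fin n) R) →ₗ[MvPolynomial (Fin n) R]
      (Finset (Fin n) → MvPolynomial (Fin n) R)} {δ : G}
    (hD : ∀ g x, D (chainMap (π g) x) = chainMap (π (g + δ)) (D x)) :
    Stable π (N ⊓ LinearMap.ker D) := by
  rintro g x ⟨hx, hx'⟩
  refine ⟨hN _ x hx, ?_⟩
  show D _ = 0
  rw [hD, show D x = 0 from hx', map_zero]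

theorem stable_koszulChains (l : ℕ) : Stable π (koszulChains (MvPolynomial (Fin n) R) n l) := by
  intro g x hx σ hσ
  rw [chainMap_apply, hx σ hσ, map_zero]

theorem stable_zMod (hπ : IsProjFamily 𝒜 𝒜 π) {γ : G} {f : Fin n → R} (hf : ∀ i, f i ∈ 𝒜 γ) (l : ℕ) :
    Stable π (zMod f l) :=
  (stable_koszulChains l).inf_ker (fD_chainMap hπ hf)

theorem zD_chainMap_add_zero (g : G) (x : Finset (Fin n) → MvPolynomial (Fin n) R) :
    zD R n (chainMap (π g) x) = chainMap (π (g + 0)) (zD R n x) := by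
  rw [add_zero, zD_chainMap]

theorem stable_zCycles (hπ : IsProjFamily 𝒜 𝒜 π) {γ : G} {f : Fin n → R} (hf : ∀ i, f i ∈ 𝒜 γ)
    (l : ℕ) : Stable π (zCycles f l) :=
  (stable_zMod hπ hf l).inf_ker zD_chainMap_add_zero

theorem stable_map_zD (hπ : IsProjFamily 𝒜 𝒜 π) {γ : G} {f : Fin n → R} (hf : ∀ i, f i ∈ 𝒜 γ)
    (l : ℕ) : Stable π ((zMod f l).map (zD R n)) :=
  (stable_zMod hπ hf l).map zD_chainMap_add_zero

theorem zHomologyPiece_eq (f : Fin n → R) (l : ℕ) (g : G) :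
    zHomologyPiece f 𝒜 l g = quotPiece 𝒜 (zCycles f l) ((zMod f (l + 1)).map (zD R n)) g := by
  unfold zHomologyPiece quotPiece
  congr 1
  ext x
  exact ⟨fun h => h.2, fun h => ⟨x.2.1, h⟩⟩

end GradedSub

/-! ### Vanishing for free chain modules -/

section Free

variable {R : Type*} [CommRing R] {G : Type*} [AddCommGroup G] {𝒜 : G → AddSubgroup R} {n : ℕ}
  {s : ℕ} {b : Fin s → R}

/-- Such an `N` is a direct sum of unshifted copies of `R`, one for each admissible `σ` and each
monomial. -/
theorem locVanish_of_support
    {N : Submodule (MvPolynomial (Fin n) R) (Finset (Fin n) → MvPolynomial (Fin n) R)}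
    {Λ : Finset (Fin n) → Prop} (hN : ∀ x, x ∈ N ↔ ∀ σ, ¬Λ σ → x σ = 0) {p : ℕ} {μ : G}
    (h : LocVanish b 𝒜 𝒜 p μ) : LocVanish b 𝒜 (subPiece 𝒜 N) p μ := by
  classical
  let j : {σ // Λ σ} × (Fin n →₀ ℕ) → R →ₗ[R] N := fun i =>
    { toFun := fun r => ⟨Pi.single i.1.1 (monomial i.2 r), (hN _).2 fun σ hσ =>
        Pi.single_eq_of_ne (by rintro rfl; exact hσ i.1.2) _⟩
      map_add' := fun r r' => Subtype.ext (by
        show Pi.single _ _ = Pi.single _ _ + Pi.single _ _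
        rw [map_add, Pi.single_add])
      map_smul' := fun r r' => Subtype.ext (by
        show Pi.single _ _ = r • Pi.single _ _
        rw [map_smul, ← Pi.single_smul]) }
  let q : {σ // Λ σ} × (Fin n →₀ ℕ) → N →ₗ[R] R := fun i =>
    { toFun := fun x => coeff i.2 (x.1 i.1.1)
      map_add' := fun x y => coeff_add _ _ _
      map_smul' := fun r x => coeff_smul _ _ _ }
  refine LocVanish.of_summands j q ?_ ?_ ?_ h
  · intro i g x hx σ d
    show coeff d ((Pi.single i.1.1 (monomial i.2 x) : Finset (Fin n) → MvPolynomial (Fin n) R) σ) ∈ _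
    by_cases hσ : σ = i.1.1
    · subst hσ
      rw [Pi.single_eq_same, coeff_monomial]
      split_ifs
      exacts [hx, zero_mem _]
    · rw [Pi.single_eq_of_ne hσ, coeff_zero]
      exact zero_mem _
  · exact fun i g x hx => hx _ _
  · intro x
    refine ⟨Finset.univ ×ˢ Finset.univ.biUnion fun σ => (x.1 σ).support, fun F hF =>
      Subtype.ext (funext fun σ => ?_)⟩
    ext d
    rw [AddSubmonoidClass.coe_finsetSum, Finset.sum_apply, coeff_sum]
    show ∑ i ∈ F, coeff d ((Pi.single i.1.1 (monomial i.2 (coeff i.2 (x.1 i.1.1))) :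
      Finset (Fin n) → MvPolynomial (Fin n) R) σ) = _
    by_cases hσ : Λ σ
    · have h1 : ∀ i ∈ F, i ≠ (⟨σ, hσ⟩, d) →
          coeff d ((Pi.single i.1.1 (monomial i.2 (coeff i.2 (x.1 i.1.1))) :
            Finset (Fin n) → MvPolynomial (Fin n) R) σ) = 0 := by
        intro i _ hi
        by_cases h1 : σ = i.1.1
        · subst h1
          rw [Pi.single_eq_same, coeff_monomial, if_neg]
          rintro rfl
          exact hi rfl
        · rw [Pi.single_eq_of_ne h1, coeff_zero]
      rw [Finset.sum_eq_single (⟨σ, hσ⟩, d) h1]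
      · rw [Pi.single_eq_same, coeff_monomial, if_pos rfl]
      · intro hmem
        have : coeff d (x.1 σ) = 0 := by
          by_contra hne
          refine hmem (hF (Finset.mem_product.2 ⟨Finset.mem_univ _, Finset.mem_biUnion.2
            ⟨σ, Finset.mem_univ _, mem_support_iff.2 hne⟩⟩))
        rw [Pi.single_eq_same, coeff_monomial, if_pos rfl, this]
    · rw [(hN x.1).1 x.2 σ hσ, coeff_zero]
      refine Finset.sum_eq_zero fun i _ => ?_
      rw [Pi.single_eq_of_ne, coeff_zero]
      rintro rfl
      exact hσ i.1.2

theorem locVanish_koszulChains {p : ℕ} {μ : G} (h : LocVanish b 𝒜 𝒜 p μ) (l : ℕ) :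
    LocVanish b 𝒜 (subPiece 𝒜 (koszulChains (MvPolynomial (Fin n) R) n l)) p μ :=
  locVanish_of_support (Λ := fun σ => σ.card = l) (fun _ => Iff.rfl) h

/-- `R` is a retract of `Z_0`, via constants and the constant coefficient. Vanishing for cycles thus
flows back to `R`. -/
theorem locVanish_of_zMod_zero {f : Fin n → R} {p : ℕ} {μ : G}
    (h : LocVanish b 𝒜 (subPiece 𝒜 (zMod f 0)) p μ) : LocVanish b 𝒜 𝒜 p μ := by
  classical
  have hmem : ∀ r, (Pi.single ∅ (C r) : Finset (Fin n) → MvPolynomial (Fin n) R) ∈ zMod f 0 := by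
    intro r
    have h1 : (Pi.single ∅ (C r) : Finset (Fin n) → MvPolynomial (Fin n) R) ∈
        koszulChains (MvPolynomial (Fin n) R) n 0 := fun σ hσ =>
      Pi.single_eq_of_ne (by rintro rfl; exact hσ Finset.card_empty) _
    refine ⟨h1, ?_⟩
    rw [← kosPart_univ] at h1
    show koszulD _ _ = 0
    rw [koszulD_eq_kos, kos_eq_zero_of_zero _ h1]
  let j : R →ₗ[R] zMod f 0 :=
    { toFun := fun r => ⟨Pi.single ∅ (C r), hmem r⟩
      map_add' := fun r r' => Subtype.ext (by
        show Pi.single _ _ = Pi.single _ _ + Pi.single _ _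
        rw [map_add, Pi.single_add])
      map_smul' := fun r r' => Subtype.ext (by
        show Pi.single _ _ = r • Pi.single _ _
        rw [← Pi.single_smul, smul_eq_C_mul, ← map_mul]
        rfl) }
  let q : zMod f 0 →ₗ[R] R :=
    { toFun := fun x => coeff 0 (x.1 ∅)
      map_add' := fun x y => coeff_add _ _ _
      map_smul' := fun r x => coeff_smul _ _ _ }
  refine LocVanish.of_summands (ι := Unit) (fun _ => q) (fun _ => j) ?_ ?_ ?_ h
  · exact fun _ g x hx => hx _ _
  · intro _ g r hr σ d
    show coeff d ((Pi.single ∅ (C r) : Finset (Fin n) → MvPolynomial (Fin n) R) σ) ∈ _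
    by_cases hσ : σ = ∅
    · subst hσ
      rw [Pi.single_eq_same, coeff_C]
      split_ifs
      exacts [hr, zero_mem _]
    · rw [Pi.single_eq_of_ne hσ, coeff_zero]
      exact zero_mem _
  · intro r
    refine ⟨Finset.univ, fun F hF => ?_⟩
    rw [Finset.eq_univ_of_forall fun x => hF (Finset.mem_univ x), Finset.univ_unique,
      Finset.sum_singleton]
    show coeff 0 ((Pi.single ∅ (C r) : Finset (Fin n) → MvPolynomial (Fin n) R) ∅) = r
    rw [Pi.single_eq_same, coeff_C, if_pos rfl]

end Free

end GradedCech

namespace GradedCech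

open MvPolynomial

/-! ### Vanishing for the cycles and the homology of the approximation complex -/

section Chase

universe u

variable {R : Type u} [CommRing R] {G : Type*} [AddCommGroup G] {𝒜 : G → AddSubgroup R}
  [SetLike.GradedMonoid 𝒜] {π : G → R →+ R} {n s : ℕ} {b : Fin s → R} {γ : G} {f : Fin n → R}

theorem smul_mem_map_fD {l : ℕ} {z : Finset (Fin n) → MvPolynomial (Fin n) R} (hz : z ∈ zMod f l)
    {r : R} (hr : r ∈ Ideal.span (Set.range f)) :
    r • z ∈ (koszulChains (MvPolynomial (Fin n) R) n (l + 1)).map (fD f) := by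
  let J : Ideal R := (((koszulChains (MvPolynomial (Fin n) R) n (l + 1)).map
    (fD f)).restrictScalars R).comap (LinearMap.toSpanSingleton R _ z)
  have : Ideal.span (Set.range f) ≤ J := by
    refine Ideal.span_le.2 ?_
    rintro _ ⟨i, rfl⟩
    refine ⟨wedge (MvPolynomial (Fin n) R) i z, ?_, ?_⟩
    · rw [← kosPart_univ]
      refine wedge_mem (Finset.mem_univ i) ?_
      rw [kosPart_univ]
      exact hz.1
    · have h1 : fD f (wedge _ i z) + wedge _ i (fD f z) =
          (C (f i) : MvPolynomial (Fin n) R) • z :=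
        koszulD_wedge (fun i => C (f i)) i z
      rw [show fD f z = 0 from hz.2, map_zero, add_zero, C_smul_eq] at h1
      exact h1
  exact this hr

theorem map_fD_le_zMod (f : Fin n → R) (l : ℕ) :
    (koszulChains (MvPolynomial (Fin n) R) n (l + 1)).map (fD f) ≤ zMod f l := by
  rintro _ ⟨x, hx, rfl⟩
  exact ⟨koszulD_mem_chains _ hx, koszulD_koszulD _ x⟩

theorem map_zD_le_zCycles (f : Fin n → R) (l : ℕ) :
    (zMod f (l + 1)).map (zD R n) ≤ zCycles f l := by
  rintro _ ⟨x, hx, rfl⟩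
  exact ⟨zD_mem f hx, zD_zD x⟩

theorem locVanish_zMod_quot (hb : ∀ i, SetLike.IsHomogeneousElem 𝒜 (b i))
    (hπ : IsProjFamily 𝒜 𝒜 π) (hf : ∀ i, f i ∈ 𝒜 γ)
    (htor : ∀ p, 1 < p → LocVanishAll b (R ⧸ Ideal.span (Set.range f)) p) (l : ℕ) {p : ℕ}
    (hp : 1 < p) (μ : G) :
    LocVanish b 𝒜 (quotPiece 𝒜 (zMod f l)
      ((koszulChains (MvPolynomial (Fin n) R) n (l + 1)).map (fD f))) p μ := by
  refine LocVanishAll.locVanish hb (isProjFamily_quot hπ (stable_zMod hπ hf l)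
    ((stable_koszulChains (l + 1)).map (fD_chainMap hπ hf))) (locVanishAll_of_torsion htor hp _ ?_) μ
  intro x
  obtain ⟨z, rfl⟩ := Submodule.mkQ_surjective _ x
  refine ⟨1, fun r hr => ?_⟩
  rw [pow_one] at hr
  exact (Submodule.Quotient.mk_eq_zero _).2 (smul_mem_map_fD z.2 hr)

/-- For `l ≥ n` there are no chains of degree `l + 1`, so `Z_l` equals its Koszul homology and is
killed by `I`. This handles `m = 1`. -/
theorem locVanish_zMod_of_le (hb : ∀ i, SetLike.IsHomogeneousElem 𝒜 (b i))
    (hπ : IsProjFamily 𝒜 𝒜 π) (hf : ∀ i, f i ∈ 𝒜 γ)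
    (htor : ∀ p, 1 < p → LocVanishAll b (R ⧸ Ideal.span (Set.range f)) p) {l : ℕ} (hl : n ≤ l)
    {p : ℕ} (hp : 1 < p) (μ : G) : LocVanish b 𝒜 (subPiece 𝒜 (zMod f l)) p μ := by
  refine LocVanishAll.locVanish hb (isProjFamily_sub hπ (stable_zMod hπ hf l))
    (locVanishAll_of_torsion htor hp _ fun z => ⟨1, fun r hr => Subtype.ext ?_⟩) μ
  rw [pow_one] at hr
  obtain ⟨y, hy, e⟩ := smul_mem_map_fD z.2 hr
  rw [SetLike.mem_coe, ← kosPart_univ] at hy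
  rw [kosPart_eq_zero (by rw [Finset.card_univ, Fintype.card_fin]; omega) hy, map_zero] at e
  exact e.symm

theorem locVanish_zHomology_of_torsion (hb : ∀ i, SetLike.IsHomogeneousElem 𝒜 (b i))
    (hπ : IsProjFamily 𝒜 𝒜 π) (hf : ∀ i, f i ∈ 𝒜 γ)
    (htor : ∀ p, 1 < p → LocVanishAll b (R ⧸ Ideal.span (Set.range f)) p) (l : ℕ) {p : ℕ}
    (hp : 1 < p) (μ : G) :
    LocVanish b 𝒜 (quotPiece 𝒜 (zCycles f (l + 1)) ((zMod f (l + 2)).map (zD R n))) p μ := by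
  refine LocVanishAll.locVanish hb (isProjFamily_quot hπ (stable_zCycles hπ hf _)
    (stable_map_zD hπ hf _)) (locVanishAll_of_torsion htor hp _ ?_) μ
  intro x
  obtain ⟨z, rfl⟩ := Submodule.mkQ_surjective _ x
  obtain ⟨k, hk⟩ := exists_pow_smul_mem_zD f z.2.1 z.2.2
  exact ⟨k, fun r hr => (Submodule.Quotient.mk_eq_zero _).2 (hk r hr)⟩

theorem locVanish_sub_zero (hb : ∀ i, SetLike.IsHomogeneousElem 𝒜 (b i)) {μ : G}
    (h : LocVanish b 𝒜 𝒜 0 μ)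
    (N : Submodule (MvPolynomial (Fin n) R) (Finset (Fin n) → MvPolynomial (Fin n) R)) :
    LocVanish b 𝒜 (subPiece 𝒜 N) 0 μ :=
  (grShortExact_quot (𝒜 := 𝒜) (le_top : N ≤ ⊤)).locVanish_left hb grSMul_sub
    (locVanish_of_support (Λ := fun _ => True) (by simp) h) fun q hq => by omega

/-- `Z_l` is the kernel of a map between free modules: `H^0` and `H^1` of the source vanish, and so
does `H^0` of the image. -/
theorem locVanish_zMod_le_one (hb : ∀ i, SetLike.IsHomogeneousElem 𝒜 (b i))
    (hπ : IsProjFamily 𝒜 𝒜 π) (hf : ∀ i, f i ∈ 𝒜 γ)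
    (h : ∀ p ≤ 1, ∀ μ, LocVanish b 𝒜 𝒜 p μ) (l : ℕ) {p : ℕ} (hp : p ≤ 1) (μ : G) :
    LocVanish b 𝒜 (subPiece 𝒜 (zMod f l)) p μ := by
  refine (grShortExact_map hπ (stable_koszulChains l) (fD f) (fD_chainMap hπ hf)).locVanish_left
    hb grSMul_sub (locVanish_koszulChains (h p hp μ) l) fun q hq => ?_
  obtain rfl : q = 0 := by omega
  exact (locVanish_shift _ _ _ _).2 (locVanish_sub_zero hb (h 0 zero_le_one _) _)

/-- Each passage from `Z_l` to `Z_{l+1}` raises the cohomological degree by one and lowers the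
internal degree by `γ`, so `j` counts the shifts and `i` the distance from the diagonal on which
`hR` speaks. The outer induction on `K` descends in the cohomological degree, and the inner one on
`i` moves away from the diagonal. -/
theorem locVanish_zMod_aux (hb : ∀ i, SetLike.IsHomogeneousElem 𝒜 (b i))
    (hπ : IsProjFamily 𝒜 𝒜 π) (hf : ∀ i, f i ∈ 𝒜 γ)
    (htor : ∀ p, 1 < p → LocVanishAll b (R ⧸ Ideal.span (Set.range f)) p) {α : G}
    (hR : ∀ j, LocVanish b 𝒜 𝒜 (j + 2) (α - (j + 1) • γ)) (K : ℕ) :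
    ∀ i j l : ℕ, s < j + 2 + i + K →
      LocVanish b 𝒜 (subPiece 𝒜 (zMod f l)) (j + 2 + i) (α - j • γ) := by
  induction K with
  | zero => exact fun i j l h => locVanish_of_lt _ (by omega) _
  | succ K ihK =>
    intro i
    induction i with
    | zero =>
      intro j l h
      refine (grShortExact_quot (map_fD_le_zMod f l)).locVanish_middle hb grSMul_sub ?_
        (locVanish_zMod_quot hb hπ hf htor l (by omega) _)
      have h1 := (grShortExact_map hπ (stable_koszulChains (l + 1)) (fD f)
        (fD_chainMap hπ hf)).locVanish_right hb grSMul_sub (locVanish_koszulChains (hR j) (l + 1))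
        (by
          have := ihK 0 (j + 1) (l + 1) (by omega)
          rwa [show j + 1 + 2 + 0 = j + 2 + 1 by omega] at this)
      rw [locVanish_shift, succ_nsmul, sub_add_eq_sub_sub, sub_add_cancel] at h1
      exact h1
    | succ i ihi =>
      intro j l h
      refine (grShortExact_quot (map_fD_le_zMod f l)).locVanish_middle hb grSMul_sub ?_
        (locVanish_zMod_quot hb hπ hf htor l (by omega) _)
      -- Off the diagonal `hR` says nothing about `R`. The inner hypothesis for `Z_0`, with one more
      -- shift and the same cohomological degree, supplies the vanishing since `R` is a summand of
      -- `Z_0`.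
      have h2 := ihi (j + 1) 0 (by omega)
      rw [show j + 1 + 2 + i = j + 2 + (i + 1) by omega] at h2
      have h1 := (grShortExact_map hπ (stable_koszulChains (l + 1)) (fD f)
        (fD_chainMap hπ hf)).locVanish_right hb grSMul_sub
        (locVanish_koszulChains (locVanish_of_zMod_zero h2) (l + 1))
        (by
          have := ihK (i + 1) (j + 1) (l + 1) (by omega)
          rwa [show j + 1 + 2 + (i + 1) = j + 2 + (i + 1) + 1 by omega] at this)
      rw [locVanish_shift, succ_nsmul, sub_add_eq_sub_sub, sub_add_cancel] at h1
      exact h1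

/-- Vanishing of `H^p_B(Z_l)_α` for `p ≥ 2`. -/
theorem locVanish_zMod (hb : ∀ i, SetLike.IsHomogeneousElem 𝒜 (b i))
    (hπ : IsProjFamily 𝒜 𝒜 π) (hf : ∀ i, f i ∈ 𝒜 γ)
    (htor : ∀ p, 1 < p → LocVanishAll b (R ⧸ Ideal.span (Set.range f)) p) {α : G}
    (hR : ∀ j, LocVanish b 𝒜 𝒜 (j + 2) (α - (j + 1) • γ)) (l : ℕ) {p : ℕ} (hp : 1 < p) :
    LocVanish b 𝒜 (subPiece 𝒜 (zMod f l)) p α := by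
  obtain ⟨i, rfl⟩ := Nat.exists_eq_add_of_le (show 0 + 2 ≤ p by omega)
  have := locVanish_zMod_aux hb hπ hf htor hR (s + 1) i 0 l (by omega)
  rwa [zero_nsmul, sub_zero] at this

/-- The boundaries in degree `l` are `Z_{l+1}` modulo the cycles of `𝒵`, and these cycles are the
next boundaries extended by torsion homology, invisible to `H^{p+1}` as `p ≥ 1`. Both `p` and `l` go
up by one, so the bound with offset `c` persists until `p > s`. -/
theorem locVanish_map_zD_aux (hb : ∀ i, SetLike.IsHomogeneousElem 𝒜 (b i))
    (hπ : IsProjFamily 𝒜 𝒜 π) (hf : ∀ i, f i ∈ 𝒜 γ)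
    (htor : ∀ p, 1 < p → LocVanishAll b (R ⧸ Ideal.span (Set.range f)) p) {μ : G} {c : ℕ}
    (hV : ∀ p l, p ≤ l + c → LocVanish b 𝒜 (subPiece 𝒜 (zMod f l)) p μ) (K : ℕ) :
    ∀ p l : ℕ, 1 ≤ p → p ≤ l + 1 + c → s < p + K →
      LocVanish b 𝒜 (subPiece 𝒜 ((zMod f (l + 1)).map (zD R n))) p μ := by
  induction K with
  | zero => exact fun p l _ _ h => locVanish_of_lt _ (by omega) _
  | succ K ih =>
    intro p l hp hpl h
    have h1 := (grShortExact_map hπ (stable_zMod hπ hf (l + 1)) (zD R n)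
      zD_chainMap_add_zero).locVanish_right hb grSMul_sub (hV p (l + 1) hpl)
      ((grShortExact_quot (map_zD_le_zCycles f (l + 1))).locVanish_middle hb grSMul_sub
        (ih (p + 1) (l + 1) (by omega) (by omega) (by omega))
        (locVanish_zHomology_of_torsion hb hπ hf htor l (by omega) μ))
    rwa [locVanish_shift, add_zero] at h1

theorem locVanish_map_zD (hb : ∀ i, SetLike.IsHomogeneousElem 𝒜 (b i))
    (hπ : IsProjFamily 𝒜 𝒜 π) (hf : ∀ i, f i ∈ 𝒜 γ)
    (h0 : ∀ μ, LocVanish b 𝒜 𝒜 0 μ)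
    (htor : ∀ p, 1 < p → LocVanishAll b (R ⧸ Ideal.span (Set.range f)) p) {μ : G} {c : ℕ}
    (hV : ∀ p l, p ≤ l + c → LocVanish b 𝒜 (subPiece 𝒜 (zMod f l)) p μ) {p l : ℕ}
    (hp : p ≤ l + 1 + c) :
    LocVanish b 𝒜 (subPiece 𝒜 ((zMod f (l + 1)).map (zD R n))) p μ := by
  rcases Nat.eq_zero_or_pos p with rfl | h
  · exact locVanish_sub_zero hb (h0 _) _
  · exact locVanish_map_zD_aux hb hπ hf htor hV (s + 1) p l h hp (by omega)

theorem zCycles_zero (f : Fin n → R) : zCycles f 0 = zMod f 0 := by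
  refine inf_eq_left.2 fun x hx => ?_
  have h1 := hx.1
  rw [← kosPart_univ] at h1
  show koszulD _ x = 0
  rw [koszulD_eq_kos, kos_eq_zero_of_zero _ h1]

theorem locVanish_zCycles (hb : ∀ i, SetLike.IsHomogeneousElem 𝒜 (b i))
    (hπ : IsProjFamily 𝒜 𝒜 π) (hf : ∀ i, f i ∈ 𝒜 γ)
    (h0 : ∀ μ, LocVanish b 𝒜 𝒜 0 μ)
    (htor : ∀ p, 1 < p → LocVanishAll b (R ⧸ Ideal.span (Set.range f)) p) {μ : G} {c : ℕ}
    (hV : ∀ p l, p ≤ l + c → LocVanish b 𝒜 (subPiece 𝒜 (zMod f l)) p μ) {p l : ℕ}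
    (hp : p ≤ l + c) : LocVanish b 𝒜 (subPiece 𝒜 (zCycles f l)) p μ := by
  cases l with
  | zero =>
    rw [zCycles_zero]
    exact hV p 0 hp
  | succ l =>
    refine (grShortExact_map hπ (stable_zMod hπ hf (l + 1)) (zD R n)
      zD_chainMap_add_zero).locVanish_left hb grSMul_sub (hV p (l + 1) hp) fun q hq => ?_
    rw [locVanish_shift, add_zero]
    exact locVanish_map_zD hb hπ hf h0 htor hV (by omega)

theorem locVanish_zHomology (hb : ∀ i, SetLike.IsHomogeneousElem 𝒜 (b i))
    (hπ : IsProjFamily 𝒜 𝒜 π) (hf : ∀ i, f i ∈ 𝒜 γ)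
    (h0 : ∀ μ, LocVanish b 𝒜 𝒜 0 μ)
    (htor : ∀ p, 1 < p → LocVanishAll b (R ⧸ Ideal.span (Set.range f)) p) {μ : G} {c : ℕ}
    (hV : ∀ p l, p ≤ l + c → LocVanish b 𝒜 (subPiece 𝒜 (zMod f l)) p μ) {p l : ℕ}
    (hp : p ≤ l + c) : LocVanish b 𝒜 (zHomologyPiece f 𝒜 l) p μ := by
  rw [show zHomologyPiece f 𝒜 l = quotPiece 𝒜 (zCycles f l) ((zMod f (l + 1)).map (zD R n)) from
    funext (zHomologyPiece_eq f l)]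
  exact (grShortExact_quot (map_zD_le_zCycles f l)).locVanish_right hb grSMul_sub
    (locVanish_zCycles hb hπ hf h0 htor hV hp) (locVanish_map_zD hb hπ hf h0 htor hV (by omega))

/-! ### Degrees outside the region, and acyclicity of strands -/

theorem locVanish_of_notMem_region (hb : ∀ i, SetLike.IsHomogeneousElem 𝒜 (b i))
    (hπ : IsProjFamily 𝒜 𝒜 π) {m : ℕ} (hm : 2 ≤ m) {μ : G} (hμ : μ ∉ region b 𝒜 m γ) (j : ℕ) :
    LocVanish b 𝒜 𝒜 (j + 2) (μ - (j + 1) • γ) := by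
  intro x hx hxμ hd
  refine hπ.exists_graded_of_mem_coboundaries hb hxμ ?_
  by_contra hcon
  -- The index `k = 1` is admissible because a nonzero class in `H^{j+2}_B(R)` gives `cd_B(R) > 1`.
  -- The witness `μ + γ` is the degree `μ - (j + 1)γ` of that class shifted by `(j + 2)γ`.
  refine hμ (Set.mem_iUnion₂.2 ⟨1, ⟨one_pos, lt_min ?_ ?_⟩, μ + γ, ?_, ?_⟩)
  · exact_mod_cast hm
  · refine lt_of_lt_of_le ?_ (natCast_le_cd hx hd hcon)
    exact_mod_cast (by omega : 1 < j + 2)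
  · refine Set.mem_iUnion.2 ⟨j + 2, μ - (j + 1) • γ, fun h => ?_, ?_⟩
    · exact hcon (mem_coboundaries_of_locCohPiece h hx hxμ hd)
    · show μ - (j + 1) • γ + (j + 2) • γ = μ + γ
      rw [show j + 2 = j + 1 + 1 from rfl, succ_nsmul γ (j + 1), ← add_assoc, sub_add_cancel]
  · show μ + γ - 1 • γ = μ
    rw [one_nsmul, add_sub_cancel_right]

/-- An element of degree `μ` annihilated by powers of the `b i` vanishes if `H^0_B(M)_μ = 0`. -/
theorem LocVanish.eq_zero {M : Type*} [AddCommGroup M] [Module R M] {ℳ : G → AddSubgroup M} {μ : G}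
    (h : LocVanish b 𝒜 ℳ 0 μ) {x : M} (hx : x ∈ ℳ μ) (hk : ∀ i, ∃ k : ℕ, b i ^ k • x = 0) :
    x = 0 := by
  classical
  set w : Cochain b M := Pi.single ∅ (LocalizedModule.mk x 1) with hw
  have h1 : w ∈ cochains b M 0 := fun σ hσ =>
    Pi.single_eq_of_ne (by rintro rfl; exact hσ Finset.card_empty) _
  have h2 : w ∈ cochainPiece b 𝒜 ℳ μ := by
    intro σ
    by_cases hσ : σ = ∅
    · subst hσ
      rw [hw, Pi.single_eq_same]
      exact mk_mem_locPiece (e := 0) SetLike.GradedOne.one_mem (by rwa [add_zero])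
    · rw [hw, Pi.single_eq_of_ne hσ]
      exact zero_mem _
  have h3 : cechD b M w = 0 := by
    funext τ
    rw [cechD_apply]
    refine Finset.sum_eq_zero fun i _ => ?_
    -- The only faces that matter have `τ = {i}`, where `x / 1` vanishes because a power of `b i`
    -- kills `x`.
    by_cases hσ : τ.erase i.1 = ∅
    · have : ∀ ρ : Finset (Fin s), ρ = ∅ → ∀ hρ : ρ ⊆ τ, res b M hρ (w ρ) = 0 := by
        rintro _ rfl hρ
        rw [hw, Pi.single_eq_same, res_mk]
        obtain ⟨k, hk⟩ := hk i.1
        rw [← LocalizedModule.zero_mk 1, LocalizedModule.mk_eq]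
        have hi : b i.1 ∈ mon b τ := Submonoid.subset_closure ⟨i.1, i.2, rfl⟩
        refine ⟨⟨b i.1 ^ k, pow_mem hi k⟩, ?_⟩
        rw [one_smul, smul_zero, smul_zero]
        exact hk
      rw [this _ hσ, smul_zero]
    · rw [hw, Pi.single_eq_of_ne hσ, map_zero, smul_zero]
  obtain ⟨y, hy, -, e⟩ := h w h1 h2 h3
  rw [cochainsBelow_zero, Submodule.mem_bot] at hy
  have h4 : w ∅ = 0 := by rw [← e, hy, map_zero, Pi.zero_apply]
  rw [hw, Pi.single_eq_same, ← LocalizedModule.zero_mk 1, LocalizedModule.mk_eq] at h4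
  obtain ⟨⟨t, ht⟩, hu⟩ := h4
  rw [mon, Finset.coe_empty, Set.image_empty, Submonoid.closure_empty, Submonoid.mem_bot] at ht
  subst ht
  simpa [Submonoid.smul_def] using hu

theorem zAcyclicIn_of_locVanish (hπ : IsProjFamily 𝒜 𝒜 π) (hf : ∀ i, f i ∈ 𝒜 γ) {μ : G}
    (hV : ∀ l, LocVanish b 𝒜 (zHomologyPiece f 𝒜 (l + 1)) 0 μ)
    (h : IsAlmostLCIOff (Ideal.span (Set.range b)) (Ideal.span (Set.range f))) :
    ZAcyclicIn f 𝒜 μ := by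
  intro l x hx hd
  let z : zCycles f (l + 1) := ⟨x, hx.1, hd⟩
  have h1 := (hV l).eq_zero (x := (((zMod f (l + 2)).map (zD R n)).submoduleOf
    (zCycles f (l + 1))).mkQ z) ⟨z, hx, rfl⟩ fun i => by
      obtain ⟨k, hk⟩ := h.exists_pow_smul_mem hx.1 hd (Ideal.subset_span (Set.mem_range_self i))
      exact ⟨k, (Submodule.Quotient.mk_eq_zero _).2 hk⟩
  obtain ⟨y, hy, e⟩ := (Submodule.Quotient.mk_eq_zero
    (((zMod f (l + 2)).map (zD R n)).submoduleOf (zCycles f (l + 1)))).1 h1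
  have e' : zD R n y = x := e
  -- The primitive `y` need not be homogeneous; its degree `μ` projection has the same boundary `x`.
  refine ⟨chainMap (π μ) y, ⟨stable_zMod hπ hf _ _ y hy, (isProjFamily_chainMap hπ).mem μ y⟩, ?_⟩
  rw [zD_chainMap, e']
  exact (isProjFamily_chainMap hπ).self μ x hx.2

end Chase

end GradedCech

namespace GradedCech

open MvPolynomial

/-! ### The symmetric algebra as the zeroth homology of the approximation complex -/

section Sym

variable {R : Type*} [CommRing R] {n : ℕ}

/-- The presentation `R[T] → Sym(I)`, `T_i ↦ f_i`. -/
noncomputable def symMap (f : Fin n → R) :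
    MvPolynomial (Fin n) R →ₐ[R] SymmetricAlgebra R (Ideal.span (Set.range f)) :=
  aeval fun i => SymmetricAlgebra.ι R (Ideal.span (Set.range f))
    ⟨f i, Ideal.subset_span (Set.mem_range_self i)⟩

theorem symMap_X (f : Fin n → R) (i : Fin n) :
    symMap f (X i) = SymmetricAlgebra.ι R (Ideal.span (Set.range f))
      ⟨f i, Ideal.subset_span (Set.mem_range_self i)⟩ :=
  aeval_X _ _

theorem single_mem_zMod_zero (f : Fin n → R) (p : MvPolynomial (Fin n) R) :
    (Pi.single ∅ p : Finset (Fin n) → MvPolynomial (Fin n) R) ∈ zMod f 0 := by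
  have h1 : (Pi.single ∅ p : Finset (Fin n) → MvPolynomial (Fin n) R) ∈
      koszulChains (MvPolynomial (Fin n) R) n 0 := fun σ hσ =>
    Pi.single_eq_of_ne (by rintro rfl; exact hσ Finset.card_empty) _
  refine ⟨h1, ?_⟩
  rw [← kosPart_univ] at h1
  show koszulD _ _ = 0
  rw [koszulD_eq_kos, kos_eq_zero_of_zero _ h1]

theorem eq_single_of_mem_zMod_zero {f : Fin n → R} {x : Finset (Fin n) → MvPolynomial (Fin n) R}
    (hx : x ∈ zMod f 0) : Pi.single ∅ (x ∅) = x := by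
  funext σ
  by_cases h : σ = ∅
  · rw [h, Pi.single_eq_same]
  · rw [Pi.single_eq_of_ne h, hx.1 σ (by rwa [Ne, Finset.card_eq_zero])]

theorem koszulD_wedge_single {A : Type*} [CommRing A] (a : Fin n → A) (i : Fin n) (p : A) :
    koszulD a (wedge A i (Pi.single ∅ p)) = Pi.single ∅ (a i * p) := by
  have h1 : (Pi.single ∅ p : Finset (Fin n) → A) ∈ kosPart A A Finset.univ 0 := fun σ hσ =>
    Pi.single_eq_of_ne (by rintro rfl; exact hσ ⟨Finset.subset_univ _, Finset.card_empty⟩) _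
  have h2 := koszulD_wedge a i (Pi.single ∅ p)
  rw [koszulD_eq_kos, kos_eq_zero_of_zero a h1, map_zero, add_zero, ← Pi.single_smul,
    smul_eq_mul] at h2
  exact h2

theorem koszulD_apply_empty {A : Type*} [CommRing A] (a : Fin n → A) (x : Finset (Fin n) → A) :
    koszulD a x ∅ = ∑ i, a i * x {i} := by
  rw [koszulD_apply, Finset.compl_empty]
  refine Finset.sum_congr rfl fun i _ => ?_
  rw [sgn, Finset.filter_empty, Finset.card_empty, pow_zero, one_mul, insert_empty_eq]

/-- For each monomial, the coefficients of the degree one part of a cycle form a linear syzygy of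
`f`, which becomes zero in `I` and hence in `Sym(I)`. -/
theorem symMap_zD (f : Fin n → R) {z : Finset (Fin n) → MvPolynomial (Fin n) R}
    (hz : fD f z = 0) : symMap f (zD R n z ∅) = 0 := by
  classical
  have h0 : ∀ d, ∑ i, f i * coeff d (z {i}) = 0 := by
    intro d
    have h1 : fD f z ∅ = ∑ i, C (f i) * z {i} := koszulD_apply_empty _ z
    rw [hz] at h1
    have h2 := congrArg (coeff d) h1.symm
    rw [coeff_sum] at h2
    simpa only [coeff_C_mul, Pi.zero_apply, coeff_zero] using h2
  have h3 : ∀ i, symMap f (z {i}) = ∑ d ∈ Finset.univ.biUnion fun i => (z {i}).support,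
      coeff d (z {i}) • symMap f (monomial d 1) := by
    intro i
    conv_lhs => rw [(z {i}).as_sum, map_sum]
    rw [← Finset.sum_subset (Finset.subset_biUnion_of_mem (fun i => (z {i}).support)
      (Finset.mem_univ i)) fun d _ hd => by rw [notMem_support_iff.1 hd, zero_smul]]
    refine Finset.sum_congr rfl fun d _ => ?_
    rw [← map_smul, smul_monomial, smul_eq_mul, mul_one]
  have h4 : zD R n z ∅ = ∑ i, X i * z {i} := koszulD_apply_empty _ z
  rw [h4, map_sum]
  simp only [map_mul, h3, Finset.mul_sum]
  rw [Finset.sum_comm]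
  refine Finset.sum_eq_zero fun d _ => ?_
  have h5 : ∑ i, coeff d (z {i}) •
      (⟨f i, Ideal.subset_span (Set.mem_range_self i)⟩ : Ideal.span (Set.range f)) = 0 := by
    refine Subtype.ext ?_
    rw [AddSubmonoidClass.coe_finsetSum]
    show ∑ i, coeff d (z {i}) * f i = 0
    rw [← h0 d]
    exact Finset.sum_congr rfl fun i _ => mul_comm _ _
  have h6 := congrArg (fun y => SymmetricAlgebra.ι R (Ideal.span (Set.range f)) y *
    symMap f (monomial d 1)) h5
  simp only [map_sum, map_smul, map_zero, Finset.sum_mul, zero_mul, smul_mul_assoc] at h6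
  rw [← h6]
  exact Finset.sum_congr rfl fun i _ => by rw [symMap_X, mul_smul_comm]

/-- Let `J` be the ideal of degree zero boundaries. The assignment `f i ↦ X i` is well defined from
`I` to `R[T]/J`, and its extension to `Sym(I)` composes with the presentation to the quotient map.
So the kernel of the presentation lies in `J`. -/
theorem single_mem_map_zD (f : Fin n → R) {p : MvPolynomial (Fin n) R} (hp : symMap f p = 0) :
    (Pi.single ∅ p : Finset (Fin n) → MvPolynomial (Fin n) R) ∈ (zMod f 1).map (zD R n) := by
  let J : Ideal (MvPolynomial (Fin n) R) := ((zMod f 1).map (zD R n)).comap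
    (LinearMap.single (MvPolynomial (Fin n) R) (fun _ => MvPolynomial (Fin n) R) ∅)
  let g : (Fin n → R) →ₗ[R] Ideal.span (Set.range f) :=
    Fintype.linearCombination R fun i => ⟨f i, Ideal.subset_span (Set.mem_range_self i)⟩
  have hg_apply : ∀ a, (g a : R) = ∑ i, a i * f i := fun a => by
    show ((Fintype.linearCombination R _ a : Ideal.span (Set.range f)) : R) = _
    rw [Fintype.linearCombination_apply, AddSubmonoidClass.coe_finsetSum]
    rfl
  have hg : Function.Surjective g := by
    rintro ⟨x, hx⟩
    obtain ⟨a, ha⟩ := Ideal.mem_span_range_iff_exists_fun.1 hx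
    exact ⟨a, Subtype.ext ((hg_apply a).trans ha)⟩
  let q : (Fin n → R) →ₗ[R] (MvPolynomial (Fin n) R ⧸ J) :=
    Fintype.linearCombination R fun i => Ideal.Quotient.mkₐ R J (X i)
  have hq : LinearMap.ker g ≤ LinearMap.ker q := by
    intro a ha
    have h0 : ∑ i, a i * f i = 0 := by
      rw [← hg_apply a, show g a = 0 from ha]
      rfl
    show q a = 0
    have h1 : q a = Ideal.Quotient.mkₐ R J (∑ i, a i • X i) := by
      rw [map_sum]
      simp only [map_smul]
      exact Fintype.linearCombination_apply _ _ _
    rw [h1]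
    refine Ideal.Quotient.eq_zero_iff_mem.2 ?_
    have key : ∀ c : Fin n → MvPolynomial (Fin n) R, koszulD c (∑ i, wedge (MvPolynomial (Fin n) R) i
        (Pi.single ∅ (C (a i)))) = Pi.single ∅ (∑ i, c i * C (a i)) := by
      intro c
      rw [map_sum]
      simp only [koszulD_wedge_single]
      exact (map_sum (LinearMap.single (MvPolynomial (Fin n) R)
        (fun _ : Finset (Fin n) => MvPolynomial (Fin n) R) ∅) _ _).symm
    -- A syzygy `a` of `f` is the cycle `∑ a i e_i` in `Z_1`, with boundary `∑ a i X i`.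
    refine ⟨∑ i, wedge (MvPolynomial (Fin n) R) i (Pi.single ∅ (C (a i))), ⟨?_, ?_⟩, ?_⟩
    · refine sum_mem fun i _ => ?_
      rw [← kosPart_univ]
      refine wedge_mem (Finset.mem_univ i) ?_
      rw [kosPart_univ]
      exact (single_mem_zMod_zero f _).1
    · show koszulD _ _ = 0
      rw [key]
      have : ∑ i, (C (f i) * C (a i) : MvPolynomial (Fin n) R) = C (∑ i, a i * f i) := by
        rw [map_sum]
        exact Finset.sum_congr rfl fun i _ => by rw [map_mul, mul_comm]
      rw [this, h0, map_zero, Pi.single_zero]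
    · show koszulD _ _ = Pi.single ∅ _
      rw [key]
      congr 1
      exact Finset.sum_congr rfl fun i _ => by rw [smul_eq_C_mul, mul_comm]
  let l : Ideal.span (Set.range f) →ₗ[R] (MvPolynomial (Fin n) R ⧸ J) :=
    (LinearMap.ker g).liftQ q hq ∘ₗ (g.quotKerEquivOfSurjective hg).symm.toLinearMap
  have hl : ∀ a, l (g a) = q a := by
    intro a
    show (LinearMap.ker g).liftQ q hq ((g.quotKerEquivOfSurjective hg).symm (g a)) = q a
    have : (g.quotKerEquivOfSurjective hg).symm (g a) = (LinearMap.ker g).mkQ a :=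
      (LinearEquiv.symm_apply_eq _).2 rfl
    rw [this]
    rfl
  have hcomp : (SymmetricAlgebra.lift l).comp (symMap f) = Ideal.Quotient.mkₐ R J := by
    refine MvPolynomial.algHom_ext fun i => ?_
    rw [AlgHom.comp_apply, symMap_X, SymmetricAlgebra.lift_ι_apply]
    have h1 : g (Pi.single i 1) = ⟨f i, Ideal.subset_span (Set.mem_range_self i)⟩ := by
      show Fintype.linearCombination R _ _ = _
      rw [Fintype.linearCombination_apply_single, one_smul]
    rw [← h1, hl]
    show Fintype.linearCombination R _ _ = _
    rw [Fintype.linearCombination_apply_single, one_smul]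
  have h2 := DFunLike.congr_fun hcomp p
  rw [AlgHom.comp_apply, hp, map_zero] at h2
  exact Ideal.Quotient.eq_zero_iff_mem.1 h2.symm

variable {G : Type*} [AddCommGroup G] {𝒜 : G → AddSubgroup R}

/-- The exact sequence `0 → d(𝒵_1) → 𝒵_0 → Sym(I) → 0`. -/
theorem grShortExact_sym (f : Fin n → R) :
    GrShortExact (subPiece 𝒜 ((zMod f 1).map (zD R n))) (subPiece 𝒜 (zCycles f 0)) (symPiece f 𝒜)
      ((Submodule.inclusion (map_zD_le_zCycles f 0)).restrictScalars R)
      ((symMap f).toLinearMap ∘ₗ LinearMap.proj ∅ ∘ₗ (zCycles f 0).subtype.restrictScalars R) where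
  inj := Submodule.inclusion_injective (map_zD_le_zCycles f 0)
  zero := by
    rintro ⟨_, z, hz, rfl⟩
    exact symMap_zD f hz.2
  exact x hx := by
    have h1 := single_mem_map_zD f (p := x.1 ∅) hx
    rw [eq_single_of_mem_zMod_zero x.2.1] at h1
    exact ⟨⟨x.1, h1⟩, rfl⟩
  mem_iff _ _ := Iff.rfl
  mem _ x hx := ⟨x.1 ∅, hx ∅, rfl⟩
  surj := by
    rintro g _ ⟨p, hp, rfl⟩
    have h1 : (Pi.single ∅ p : Finset (Fin n) → MvPolynomial (Fin n) R) ∈ zCycles f 0 := by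
      rw [zCycles_zero]
      exact single_mem_zMod_zero f p
    refine ⟨⟨_, h1⟩, fun σ d => ?_, ?_⟩
    · show coeff d ((Pi.single ∅ p : Finset (Fin n) → MvPolynomial (Fin n) R) σ) ∈ 𝒜 g
      by_cases hσ : σ = ∅
      · subst hσ
        rw [Pi.single_eq_same]
        exact hp d
      · rw [Pi.single_eq_of_ne hσ, coeff_zero]
        exact zero_mem _
    · show symMap f ((Pi.single ∅ p : Finset (Fin n) → MvPolynomial (Fin n) R) ∅) = _
      rw [Pi.single_eq_same]
      rfl

end Sym

end GradedCech

/-! ### Assembly of the main theorem -/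

theorem mainTheorem8 {G : Type*} [AddCommGroup G] [DecidableEq G]
    {R : Type*} [CommRing R] (𝒜 : G → AddSubgroup R) [GradedRing 𝒜]
    {s : ℕ} (b : Fin s → R) (hb : ∀ i, SetLike.IsHomogeneousElem 𝒜 (b i))
    (B : Ideal R) (hB : B = Ideal.span (Set.range b))
    {m : ℕ} (hm : 1 ≤ m) (γ : G) (f : Fin (m + 1) → R) (hf : ∀ i, f i ∈ 𝒜 γ)
    (I : Ideal R) (hI : I = Ideal.span (Set.range f))
    (hgrade : 2 ≤ GradedCech.grade B) (hcd : GradedCech.cd b (R ⧸ I) ≤ 1) :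
    (∀ μ ∉ GradedCech.region b 𝒜 m γ, ∀ i j : ℕ, (2 ≤ m ∨ i = 0 ∨ 1 ≤ j) →
      GradedCech.locCohPiece b 𝒜 (GradedCech.zHomologyPiece f 𝒜 j) i μ = ⊥) ∧
    (GradedCech.IsAlmostLCIOff B I → ∀ μ ∉ GradedCech.region b 𝒜 m γ,
      GradedCech.ZAcyclicIn f 𝒜 μ ∧
      GradedCech.locCohPiece b 𝒜 (GradedCech.symPiece f 𝒜) 0 μ = ⊥) := by
  subst hB hI
  have hπ := GradedCech.isProjFamily_proj (𝒜 := 𝒜)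
  have htor : ∀ p, 1 < p → GradedCech.LocVanishAll b (R ⧸ Ideal.span (Set.range f)) p :=
    fun p hp => GradedCech.locVanishAll_of_cd (c := 1) (by exact_mod_cast hcd) hp
  have h1 : ∀ p ≤ 1, ∀ μ, GradedCech.LocVanish b 𝒜 𝒜 p μ := fun p hp μ =>
    (GradedCech.locVanishAll_of_two_le_grade hgrade hp).locVanish hb hπ μ
  have h0 := h1 0 zero_le_one
  have hV2 : 2 ≤ m → ∀ μ ∉ GradedCech.region b 𝒜 m γ, ∀ p l,
      GradedCech.LocVanish b 𝒜 (GradedCech.subPiece 𝒜 (GradedCech.zMod f l)) p μ := by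
    intro hm2 μ hμ p l
    rcases Nat.lt_or_ge 1 p with hp | hp
    · exact GradedCech.locVanish_zMod hb hπ hf htor
        (GradedCech.locVanish_of_notMem_region hb hπ hm2 hμ) l hp
    · exact GradedCech.locVanish_zMod_le_one hb hπ hf h1 l hp μ
  -- Offset `c = 0`. If `m = 1` and `p ≥ 2`, then `p ≤ l` gives `l ≥ 2`, the number of generators,
  -- so `Z_l` is killed by `I`.
  have hV : ∀ μ ∉ GradedCech.region b 𝒜 m γ, ∀ p l, p ≤ l + 0 →
      GradedCech.LocVanish b 𝒜 (GradedCech.subPiece 𝒜 (GradedCech.zMod f l)) p μ := by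
    intro μ hμ p l hpl
    rcases Nat.lt_or_ge 1 m with hm2 | hm2
    · exact hV2 hm2 μ hμ p l
    rcases Nat.lt_or_ge 1 p with hp | hp
    · exact GradedCech.locVanish_zMod_of_le hb hπ hf htor (by omega) hp μ
    · exact GradedCech.locVanish_zMod_le_one hb hπ hf h1 l hp μ
  have hZ : ∀ μ ∉ GradedCech.region b 𝒜 m γ, ∀ i j : ℕ, (2 ≤ m ∨ i = 0 ∨ 1 ≤ j) →
      GradedCech.LocVanish b 𝒜 (GradedCech.zHomologyPiece f 𝒜 j) i μ := by
    intro μ hμ i j hij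
    rcases Nat.lt_or_ge 1 m with hm2 | hm2
    -- For `m ≥ 2` the cycles vanish for all `p` and `l`, so the offset may be chosen as large as
    -- needed; `c = i` suffices.
    · exact GradedCech.locVanish_zHomology hb hπ hf h0 htor (c := i)
        (fun p l _ => hV2 hm2 μ hμ p l) (Nat.le_add_left i j)
    -- For `m = 1` and `i > j` the side condition forces `j ≥ 1`, hence `i ≥ 2`, and torsion of the
    -- homology is enough.
    rcases Nat.lt_or_ge j i with hlt | hle
    · obtain ⟨l, rfl⟩ := Nat.exists_eq_add_of_le' (show 1 ≤ j by omega)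
      rw [show GradedCech.zHomologyPiece f 𝒜 (l + 1) = _ from
        funext (GradedCech.zHomologyPiece_eq f (l + 1))]
      exact GradedCech.locVanish_zHomology_of_torsion hb hπ hf htor l (by omega) μ
    · exact GradedCech.locVanish_zHomology hb hπ hf h0 htor (hV μ hμ) hle
  refine ⟨fun μ hμ i j hij => (hZ μ hμ i j hij).locCohPiece_eq_bot, fun h μ hμ => ⟨?_, ?_⟩⟩
  · exact GradedCech.zAcyclicIn_of_locVanish hπ hf (fun l => hZ μ hμ 0 (l + 1) (by simp)) h
  -- `H^0_B(Sym)` sits between `H^0_B` of `𝒵_0` and `H^1_B` of the boundaries coming from `𝒵_1`;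
  -- both strands vanish.
  · exact ((GradedCech.grShortExact_sym f).locVanish_right hb GradedCech.grSMul_sub
      (GradedCech.locVanish_zCycles hb hπ hf h0 htor (hV μ hμ) (Nat.zero_le _))
      (GradedCech.locVanish_map_zD hb hπ hf h0 htor (hV μ hμ) le_rfl)).locCohPiece_eq_bot
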